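/- **Setting.** The state $\omega\in[0,1]$ has a prior $F$ with a strictly positive density; $\mu_F$ is the corresponding probability measure. Receiver has actions $a_0,\dots,a_{n-1}$ ($n\ge 1$), and there are cutoffs $0=\gamma_0\le\gamma_1\le\dots\le\gamma_n=1$ such that $a_i$ is optimal for Receiver iff her posterior mean of the state lies in $A_i=[\gamma_i,\gamma_{i+1}]$. Sender's payoff $v(a_i)$ depends only on the action, with $v(a_0)=0$ and $v$ strictly increasing in $i$. Let $u(x)=\max\{v(a_i): x\in A_i\}$; a signal with posterior mean $x$ *recommends* the action attaining this maximum. *Information design.* An optimal signal distribution is a maximizer $G$ of $\int u\,dG$ over the mean-preserving contractions of $F$; the maximum is the commitment payoff. *Verifiable disclosure game.* In state $\omega$ Sender may send (possibly at random) any closed set $m\subseteq[0,1]$ with $\omega\in m$; Receiver forms a belief $p(m)$ and plays a possibly mixed action $\tau(m)$. A (perfect Bayesian) equilibrium is a triple $(\sigma,\tau,p)$ such that in every state Sender uses only messages that are best for her among the feasible ones, every action that Receiver uses after a message $m$ is optimal at the mean of $p(m)$, $p(m)$ is supported in $m$, and $p$ is obtained from $F$ and $\sigma$ by Bayes' rule.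 An optimal signal distribution $G$ is *implementable* if in some equilibrium Receiver's posterior mean has law $G$ and Sender's ex ante payoff is the commitment payoff. *Bi-pooling solutions.* A bi-pooling solution is an optimal signal distribution $G$ for which there is a family of intervals $[\underline\omega,\overline\omega]$, $\underline\omega<\overline\omega$, with pairwise disjoint interiors, such that on the interior of each of them $G$ and $F$ have the same mass and the same mean and $G$ has at most two support points there, and $G=F$ off these interiors. An interval with these properties is a *pooling interval* if $G$ has one support point in it and a *bi-pooling interval* if it has two, $z_L<z_H$. A *nested intervals representation* of a bi-pooling interval is a pair $\{B_L,B_H\}$ with $B_L=[\underline b_L,\overline b_L]$, $B_H=[\underline\omega,\underline b_L]\cup[\overline b_L,\overline\omega]$ ($\underline\omega\le\underline b_L\le\overline b_L\le\overline\omega$), $\mathbb E_F[\omega\mid B_L]=z_L$ and $\mathbb E_F[\omega\mid B_H]=z_H$. *Canonical representation.* Call $a_i$ *skipped* in a sequence $B_0,\dots,B_{n-1}$ of subsets of $[0,1]$ if $B_i$ has empty interior (in $[0,1]$). A *deterministic representation* of $G$ is a sequence of (possibly empty) closed sets $B_0,\dots,B_{n-1}$ with union $[0,1]$ and $\mu_F$-null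 pairwise intersections, such that $\mu_F(B_i)$ is the probability under $G$ that $a_i$ is recommended, $\mu_F(B_i)=0$ if $a_i$ is skipped, and, if $a_j$ is the lowest unskipped action, $\mathbb E_F[\omega\mid B_j]\ge\gamma_j$ and $\mathbb E_F[\omega\mid B_i]=\gamma_i$ for every unskipped $a_i$ with $i>j$. It is *canonical* if, for some family of intervals as above: every interval of the family in which $G$ recommends a single action $a_i$ is contained in $B_i$; for every bi-pooling interval $I$ of the family whose two signals recommend different actions $a_L,a_H$, $L<H$, the pair $\{B_L\cap I,B_H\cap I\}$ is a nested intervals representation of $I$; every unskipped $B_i$ other than the lowest one is contained in an interval of the family; and the lowest unskipped $B_j$ is the closure of its interior. **Proposition.** Every bi-pooling solution $G$ has a canonical representation, and for every canonical representation $\{B_i\}_{i=0}^{n-1}$ of $G$, $G$ is implementable if and only if (i) for every $i\ge1$ such that $a_i$ is skipped, $\sup B_j\le\gamma_i$ for every unskipped action $a_j$ with $j<i$; and (ii) for all $L<H$ such that $\{B_L,B_H\}$ is a nested intervals representation of a bi-pooling interval of $G$, $\sup B_L\le\gamma_H$. -/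

import Mathlib

open MeasureTheory ProbabilityTheory

noncomputable section

namespace Disclosure

/-- Messages: nonempty closed subsets of the state space `[0,1]` (closed = compact there),
with the Hausdorff (Vietoris) topology. -/
abbrev Message : Type := TopologicalSpace.NonemptyCompacts unitInterval

/-- Messages carry the Borel σ-algebra of the Hausdorff distance. -/
instance : MeasurableSpace Message := borel Message

instance : BorelSpace Message := ⟨rfl⟩

/-- The primitives: a prior on `[0,1]` with strictly positive density, `n` actions
`a_0, …, a_{n-1}`, cutoffs `0 = γ_0 ≤ γ_1 ≤ ⋯ ≤ γ_n = 1`, and Sender's payoff from each action. -/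
structure Environment (n : ℕ) [NeZero n] where
  density : unitInterval → ℝ
  density_measurable : Measurable density
  density_pos : ∀ x, 0 < density x
  density_total : ∫⁻ x, ENNReal.ofReal (density x) = 1
  cutoff : Fin (n + 1) → unitInterval
  cutoff_mono : Monotone cutoff
  cutoff_zero : cutoff 0 = 0
  cutoff_last : cutoff (Fin.last n) = 1
  v : Fin n → ℝ
  v_zero : v 0 = 0
  v_strictMono : StrictMono v

namespace Environment

variable {n : ℕ} [NeZero n] (E : Environment n)

/-- The prior (as a probability measure on the states). -/
def prior : Measure unitInterval :=
  volume.withDensity fun x => ENNReal.ofReal (E.density x)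

/-- The lower cutoff `γ_i` of action `a_i`. -/
def γ (i : Fin n) : unitInterval := E.cutoff i.castSucc

/-- `A_i = [γ_i, γ_{i+1}]`, the posterior means at which `a_i` is optimal for Receiver. -/
def A (i : Fin n) : Set unitInterval := Set.Icc (E.cutoff i.castSucc) (E.cutoff i.succ)

/-- Sender's value function: her best payoff from an optimal action of Receiver at posterior
mean `x`. -/
def u (x : unitInterval) : ℝ := sSup (E.v '' {i | x ∈ E.A i})

/-- The posterior means at which `a_i` is, among Receiver's optimal actions, the best one for
Sender; a signal with such a posterior mean recommends `a_i`. -/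
def recommending (i : Fin n) : Set unitInterval := {x | IsGreatest {k | x ∈ E.A k} i}

/-! ### The information design problem -/

/-- `G` is a mean-preserving contraction of the prior: the integrated distribution functions are
ordered, with equality at `1`. -/
def IsMPC (G : Measure unitInterval) : Prop :=
  IsProbabilityMeasure G ∧
  (∀ x : unitInterval,
    ∫ s in Set.Iic x, G.real (Set.Iic s) ≤ ∫ s in Set.Iic x, E.prior.real (Set.Iic s)) ∧
  ∫ s, G.real (Set.Iic s) = ∫ s, E.prior.real (Set.Iic s)

/-- `G` is an optimal signal distribution. -/
def IsOptimalSignal (G : Measure unitInterval) : Prop :=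
  E.IsMPC G ∧ ∀ G' : Measure unitInterval, E.IsMPC G' → ∫ x, E.u x ∂G' ≤ ∫ x, E.u x ∂G

/-- `(G, R)` is a commitment outcome. -/
def IsCommitmentOutcome (G : Measure unitInterval) (R : ℝ) : Prop :=
  E.IsOptimalSignal G ∧ R = ∫ x, E.u x ∂G

/-! ### The verifiable disclosure game -/

/-- Sender's expected payoff from message `m` when Receiver plays `τ`. -/
def messagePayoff (τ : Kernel Message (Fin n)) (m : Message) : ℝ :=
  ∑ i, (τ m).real {i} * E.v i

/-- Perfect Bayesian equilibria `(σ, τ, p)` of the verifiable disclosure game. -/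
structure IsEquilibrium (σ : Kernel unitInterval Message) (τ : Kernel Message (Fin n))
    (p : Kernel Message unitInterval) : Prop where
  markov_sender : IsMarkovKernel σ
  markov_receiver : IsMarkovKernel τ
  markov_belief : IsMarkovKernel p
  /-- Sender uses only feasible messages that are best among the feasible ones. -/
  sender_optimal : ∀ ω, ∀ᵐ m ∂(σ ω), ω ∈ m ∧
    ∀ m' : Message, ω ∈ m' → E.messagePayoff τ m' ≤ E.messagePayoff τ m
  /-- Receiver uses only actions that are optimal at the posterior mean. -/
  receiver_optimal : ∀ m i, 0 < τ m {i} →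
    (E.cutoff i.castSucc : ℝ) ≤ ∫ x, (x : ℝ) ∂(p m) ∧
      ∫ x, (x : ℝ) ∂(p m) ≤ (E.cutoff i.succ : ℝ)
  /-- Receiver excludes the states in which the message is not feasible. -/
  belief_verifiable : ∀ m : Message, (p m).support ⊆ (m : Set unitInterval)
  /-- Bayes' rule: `p` is a conditional distribution of the state given the message. -/
  bayes : (E.prior ⊗ₘ σ).map Prod.swap = (σ ∘ₘ E.prior) ⊗ₘ p

/-- `(G, R)` is an equilibrium outcome: `G` is the law of Receiver's posterior mean and `R` is
Sender's ex ante payoff in some equilibrium. -/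
def IsEquilibriumOutcome (G : Measure unitInterval) (R : ℝ) : Prop :=
  ∃ (σ : Kernel unitInterval Message) (τ : Kernel Message (Fin n))
    (p : Kernel Message unitInterval), E.IsEquilibrium σ τ p ∧
    (σ ∘ₘ E.prior).map (fun m => ∫ x, (x : ℝ) ∂(p m)) = G.map (fun x : unitInterval => (x : ℝ)) ∧
    ∫ m, E.messagePayoff τ m ∂(σ ∘ₘ E.prior) = R

/-- `G` is implementable: the commitment outcome it induces is an equilibrium outcome. -/
def IsImplementable (G : Measure unitInterval) : Prop :=
  ∃ R, E.IsCommitmentOutcome G R ∧ E.IsEquilibriumOutcome G R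

/-! ### Bi-pooling solutions -/

/-- The support of `G` restricted to the open interval `(a, b)`. -/
def supp (G : Measure unitInterval) (a b : unitInterval) : Set unitInterval :=
  (G.restrict (Set.Ioo a b)).support

/-- The states between `a` and `b` are pooled into at most two signals under `G`: `G` and the
prior have the same mass and the same mean there, and `G` has at most two support points. -/
structure IsBlock (G : Measure unitInterval) (a b : unitInterval) : Prop where
  lt : a < b
  mass : G (Set.Ioo a b) = E.prior (Set.Ioo a b)
  mean : ∫ x in Set.Ioo a b, (x : ℝ) ∂G = ∫ x in Set.Ioo a b, (x : ℝ) ∂E.prior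
  supp_le : (supp G a b).encard ≤ 2

/-- `J` is a collection of intervals (pairs of end points), without common interior points, that
exhibits `G` as a bi-pooling distribution: off these intervals, `G` is the prior. -/
structure IsBiPoolingFamily (G : Measure unitInterval)
    (J : Set (unitInterval × unitInterval)) : Prop where
  block : ∀ I ∈ J, E.IsBlock G I.1 I.2
  disjoint : J.PairwiseDisjoint fun I => Set.Ioo I.1 I.2
  off : G.restrict (⋃ I ∈ J, Set.Ioo I.1 I.2)ᶜ = E.prior.restrict (⋃ I ∈ J, Set.Ioo I.1 I.2)ᶜ

/-- `G` is a bi-pooling distribution. -/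
def IsBiPooling (G : Measure unitInterval) : Prop :=
  E.IsMPC G ∧ ∃ J, E.IsBiPoolingFamily G J

/-- `G` is a bi-pooling solution. -/
def IsBiPoolingSolution (G : Measure unitInterval) : Prop :=
  E.IsBiPooling G ∧ E.IsOptimalSignal G

/-! ### Representations -/

/-- The conditional mean of the state on `B` (used for sets of positive probability). -/
def condMean (B : Set unitInterval) : ℝ := ⨍ x in B, (x : ℝ) ∂E.prior

/-- `[a, b]` is a bi-pooling interval of `G` with signals `zL < zH`, and `{BL, BH}` is a
bi-partition of it. -/
structure IsBiPartition (G : Measure unitInterval) (a b zL zH : unitInterval)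
    (BL BH : Set unitInterval) : Prop where
  block : E.IsBlock G a b
  signals_lt : zL < zH
  supp_eq : supp G a b = {zL, zH}
  closed_low : IsClosed BL
  closed_high : IsClosed BH
  union : BL ∪ BH = Set.Icc a b
  null : E.prior (BL ∩ BH) = 0
  mean_low : E.condMean BL = zL
  mean_high : E.condMean BH = zH

/-- `{BL, BH}` is a nested intervals representation of the bi-pooling interval `[a, b]` of `G`
with signals `zL < zH`. -/
def IsNestedIntervals (G : Measure unitInterval) (a b zL zH : unitInterval)
    (BL BH : Set unitInterval) : Prop :=
  E.IsBiPartition G a b zL zH BL BH ∧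
    ∃ c d : unitInterval, a ≤ c ∧ c ≤ d ∧ d ≤ b ∧
      BL = Set.Icc c d ∧ BH = Set.Icc a c ∪ Set.Icc d b

/-- The action with set `B` is skipped (it is recommended with probability zero). -/
def IsSkipped (B : Set unitInterval) : Prop := interior B = ∅

/-- `j` is the lowest action that is not skipped. -/
def IsLowest (B : Fin n → Set unitInterval) (j : Fin n) : Prop :=
  IsLeast {i | ¬ IsSkipped (B i)} j

/-- `B` is a deterministic representation of `G`: closed sets of states that cover `[0,1]`,
overlap in null sets only, have the conditional means that make the recommendations obedient,
and recommend each action with the same probability as `G` does. -/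
structure IsDeterministicRep (G : Measure unitInterval) (B : Fin n → Set unitInterval) :
    Prop where
  closed : ∀ i, IsClosed (B i)
  cover : ⋃ i, B i = Set.univ
  null : ∀ i j, i ≠ j → E.prior (B i ∩ B j) = 0
  skipped_null : ∀ i, IsSkipped (B i) → E.prior (B i) = 0
  mean_lowest : ∀ j, IsLowest B j → (E.γ j : ℝ) ≤ E.condMean (B j)
  mean_higher : ∀ j, IsLowest B j → ∀ i, j < i → ¬ IsSkipped (B i) → E.condMean (B i) = E.γ i
  prob : ∀ i, E.prior (B i) = G (E.recommending i)

/-- `B` is a canonical representation of `G`: the deterministic representation in which every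
bi-pooling interval whose two signals recommend different actions is split into nested
intervals, every other interval on which `G` pools goes to the one action recommended there, each
unskipped action above the lowest one is recommended on a pooling interval or on a component of a
nested intervals representation, and the lowest unskipped action takes what is left
(no stray null parts: it is the closure of its interior). -/
def IsCanonicalRep (G : Measure unitInterval) (B : Fin n → Set unitInterval) : Prop :=
  E.IsDeterministicRep G B ∧
  ∃ J, E.IsBiPoolingFamily G J ∧
    (∀ I ∈ J, ∀ i, supp G I.1 I.2 ⊆ E.recommending i → Set.Icc I.1 I.2 ⊆ B i) ∧
    (∀ I ∈ J, ∀ zL zH : unitInterval, zL < zH → supp G I.1 I.2 = {zL, zH} →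
      ∀ L H, L ≠ H → zL ∈ E.recommending L → zH ∈ E.recommending H →
        E.IsNestedIntervals G I.1 I.2 zL zH
          (B L ∩ Set.Icc I.1 I.2) (B H ∩ Set.Icc I.1 I.2)) ∧
    (∀ j, IsLowest B j → B j = closure (interior (B j)) ∧
      ∀ i, j < i → ¬ IsSkipped (B i) → ∃ I ∈ J, B i ⊆ Set.Icc I.1 I.2)

/-- If `a_i` is skipped, then `sup B_j ≤ γ_i` for every unskipped lower action `a_j`. -/
def SkipCondition (B : Fin n → Set unitInterval) : Prop :=
  ∀ i : Fin n, 1 ≤ (i : ℕ) → IsSkipped (B i) →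
    ∀ j, j < i → ¬ IsSkipped (B j) → sSup (B j) ≤ E.γ i

/-- `sup B_L ≤ γ_H` whenever `{B_L, B_H}`, `L < H`, is a nested intervals representation of some
bi-pooling interval. -/
def NestedCondition (G : Measure unitInterval) (B : Fin n → Set unitInterval) : Prop :=
  ∀ L H : Fin n, L < H →
    (∃ a b zL zH : unitInterval, E.IsNestedIntervals G a b zL zH (B L) (B H)) →
    sSup (B L) ≤ E.γ H

end Environment

end Disclosure

end

noncomputable section

namespace Disclosure

namespace Environment

variable {n : ℕ} [NeZero n] (E : Environment n)

/-! ### The action recommended at a posterior mean -/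

/-! Optimality of `G` enters through one fact: merging parts of a feasible distribution into their
barycentres cannot raise the payoff (`IsOptimalSignal.pool_le`). Two consequences shape `G`. If a
lower action has positive probability, a higher action `a_i` is recommended only at the mean `γ_i`,
since any slack there could absorb signals of the lower action (`IsOptimalSignal.ae_eq_cutoff`). And
if a bi-pooling interval splits between the lowest recommended action and a higher one, then either
it starts at state 0 or its low component is flush with its left end (`IsSplit.left_eq`).

The two directions of the equivalence meet in the notion of an assignment (`IsAssignment`): a set of
states for each action, with the mass and first moment that `G` gives to the signals recommending
it. Deterministic representations are assignments, and so are the level sets of Sender's equilibrium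
payoff when it equals the commitment payoff (`IsEquilibrium.exists_assignment`). An upper interval
is, up to null sets, the only set of states with its mass and first moment (`ae_eq_of_threshold`).
So the states assigned to `a_i` and above form the same upper interval in every assignment, unless a
bi-pooling interval has one signal below `a_i` and one at or above it (`exists_threshold`); in this
exceptional case the two sets of a canonical representation are exactly the components of that
interval (`IsCanonicalData.rep_eq_of_two`).

Necessity. A state above `γ_i` can reveal itself and obtain at least `v(a_i)`, so in an equilibrium
assignment almost every such state belongs to an action from `a_i` up. With a common threshold `e`
this gives `e ≤ γ_i`, and lower actions live below `e`. In the exceptional case the high sets of the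
two assignments are compared: were `sup B_L` above `γ_i`, their differences would be separated by
the left end of the low component, and equality of mass and mean would force the sets to coincide,
which they do not (`IsCanonicalData.subset_Iic_of_assignment`).

Sufficiency. The two conditions imply that no state in `B_k` exceeds the upper cutoff of `a_k`
(`IsCanonicalData.le_cutoff_succ`). Sender then announces the component that contains the state, or
reveals a state outside all components; any other message is attributed to its lowest state. No
deviation pays (`IsDisclosureScheme.isImplementable`).

Existence. Sliding an interval of fixed mass across a bi-pooling interval and using the intermediate
value theorem yields nested intervals (`IsBiPoolingFamily.exists_isSplit`). Each recommended action
above the lowest takes the component of its only signal, and the lowest takes the closure of the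
rest (`exists_isCanonicalRep`). -/

theorem exists_top (x : unitInterval) : ∃ i : Fin n, ∀ k : Fin n, k ≤ i ↔ E.γ k ≤ x := by
  classical
  have hne : (Finset.univ.filter fun k : Fin n => E.γ k ≤ x).Nonempty :=
    ⟨0, Finset.mem_filter.2 ⟨Finset.mem_univ _, (E.cutoff_zero.trans_le unitInterval.nonneg' :
      E.cutoff 0 ≤ x)⟩⟩
  refine ⟨Finset.max' _ hne, fun k => ⟨fun h => ?_, fun h =>
    Finset.le_max' _ k (Finset.mem_filter.2 ⟨Finset.mem_univ _, h⟩)⟩⟩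
  have := Finset.max'_mem _ hne
  rw [Finset.mem_filter] at this
  exact (E.cutoff_mono (Fin.castSucc_le_castSucc_iff.2 h)).trans this.2

/-- The highest action that is optimal at posterior mean `x`. -/
def top (x : unitInterval) : Fin n := (E.exists_top x).choose

theorem le_top_iff {x : unitInterval} {k : Fin n} : k ≤ E.top x ↔ E.γ k ≤ x :=
  (E.exists_top x).choose_spec k

theorem γ_top_le (x : unitInterval) : E.γ (E.top x) ≤ x := E.le_top_iff.1 le_rfl

theorem lt_cutoff_succ_of_top_lt {x : unitInterval} {i k : Fin n} (h : E.top x = i) (hk : i < k) :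
    x < E.cutoff i.succ := by
  have h1 : (i : ℕ) + 1 < n := by have := k.2; have : (i : ℕ) < k := hk; omega
  have h2 : ¬ E.γ ⟨i + 1, h1⟩ ≤ x := by
    rw [← E.le_top_iff, h, not_le, Fin.lt_def]; simp
  exact not_le.1 h2

theorem top_mem_A (x : unitInterval) : x ∈ E.A (E.top x) := by
  refine ⟨E.γ_top_le x, ?_⟩
  by_cases h : (E.top x : ℕ) + 1 < n
  · exact (E.lt_cutoff_succ_of_top_lt rfl (k := ⟨E.top x + 1, h⟩) (by simp [Fin.lt_def])).le
  · have : (E.top x).succ = Fin.last n := by ext; simp; omega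
    rw [this, E.cutoff_last]
    exact unitInterval.le_one'

theorem isGreatest_top (x : unitInterval) : IsGreatest {k | x ∈ E.A k} (E.top x) :=
  ⟨E.top_mem_A x, fun _ hk => E.le_top_iff.2 hk.1⟩

theorem mem_recommending {x : unitInterval} {i : Fin n} :
    x ∈ E.recommending i ↔ E.top x = i :=
  ⟨fun h => (E.isGreatest_top x).unique h, fun h => h ▸ E.isGreatest_top x⟩

theorem recommending_eq (i : Fin n) : E.recommending i = E.top ⁻¹' {i} := by
  ext x; exact E.mem_recommending

theorem u_eq (x : unitInterval) : E.u x = E.v (E.top x) :=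
  (E.v_strictMono.monotone.map_isGreatest (E.isGreatest_top x)).csSup_eq

theorem top_mono : Monotone E.top := fun _ _ h =>
  E.le_top_iff.2 ((E.γ_top_le _).trans h)

theorem measurable_top : Measurable E.top := by
  refine measurable_to_countable' fun i => ?_
  have : E.top ⁻¹' {i} = {x | E.γ i ≤ x} \ ⋃ k ∈ {k | i < k}, {x | E.γ k ≤ x} := by
    ext x
    simp only [Set.mem_preimage, Set.mem_singleton_iff, Set.mem_sdiff, Set.mem_ofPred_eq,
      Set.mem_iUnion, ← E.le_top_iff, not_exists, not_le, exists_prop, not_and]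
    constructor
    · rintro rfl; exact ⟨le_rfl, fun k hk => hk⟩
    · rintro ⟨h1, h2⟩
      by_contra h
      exact lt_irrefl _ (h2 _ (lt_of_le_of_ne h1 (Ne.symm h)))
  rw [this]
  exact measurableSet_Ici.diff (.biUnion (Set.to_countable _) fun k _ => measurableSet_Ici)

theorem measurable_u : Measurable E.u := by
  have : E.u = E.v ∘ E.top := funext E.u_eq
  rw [this]
  exact (measurable_of_countable _).comp E.measurable_top

theorem exists_low (x : unitInterval) : ∃ i : Fin n, ∀ k : Fin n, i ≤ k ↔ x ≤ E.cutoff k.succ := by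
  classical
  have hne : (Finset.univ.filter fun k : Fin n => x ≤ E.cutoff k.succ).Nonempty :=
    ⟨E.top x, by simpa using (E.top_mem_A x).2⟩
  refine ⟨Finset.min' _ hne, fun k => ⟨fun h => ?_, fun h => 
    Finset.min'_le _ k (Finset.mem_filter.2 ⟨Finset.mem_univ _, h⟩)⟩⟩
  have := Finset.min'_mem _ hne
  rw [Finset.mem_filter] at this
  exact this.2.trans (E.cutoff_mono (Fin.succ_le_succ_iff.2 h))

/-- The lowest action that is optimal at posterior mean `x`. -/
def low (x : unitInterval) : Fin n := (E.exists_low x).choose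

theorem low_le_iff {x : unitInterval} {k : Fin n} : E.low x ≤ k ↔ x ≤ E.cutoff k.succ :=
  (E.exists_low x).choose_spec k

theorem low_mono : Monotone E.low := fun _ _ h =>
  E.low_le_iff.2 (h.trans (E.low_le_iff.1 le_rfl))

theorem low_mem_A (x : unitInterval) : x ∈ E.A (E.low x) := by
  refine ⟨?_, E.low_le_iff.1 le_rfl⟩
  by_contra h
  rw [not_le] at h
  rcases Nat.eq_zero_or_pos (E.low x : ℕ) with h0 | h0
  · have : (E.low x).castSucc = 0 := by ext; simpa using h0
    rw [this, E.cutoff_zero] at h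
    exact absurd h (not_lt.2 unitInterval.nonneg')
  · have hlt : (E.low x : ℕ) - 1 < n := by have := (E.low x).2; omega
    have hs : (⟨(E.low x : ℕ) - 1, hlt⟩ : Fin n).succ = (E.low x).castSucc := by
      ext; simp; omega
    have h2 : E.low x ≤ ⟨(E.low x : ℕ) - 1, hlt⟩ := by
      rw [E.low_le_iff, hs]; exact h.le
    have h3 := Fin.le_def.1 h2
    simp at h3
    omega

/-- Ties occur only at the finitely many cutoffs, which are null for the prior. Hence breaking ties
against Sender at revealed states costs nothing ex ante. -/
theorem low_eq_top {x : unitInterval} (hx : x ∉ Set.range E.cutoff) : E.low x = E.top x := by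
  refine le_antisymm (E.low_le_iff.2 (E.top_mem_A x).2) ?_
  by_contra h
  rw [not_le] at h
  have h1 := E.low_le_iff.1 (le_refl (E.low x))
  have h2 : E.cutoff (E.low x).succ ≤ x :=
    (E.cutoff_mono (show (E.low x).succ ≤ (E.top x).castSucc from by
      rw [Fin.le_def]; simpa using h)).trans (E.γ_top_le x)
  exact hx ⟨_, le_antisymm h2 h1⟩

theorem measurable_low : Measurable E.low := by
  refine measurable_to_countable' fun i => ?_
  have : E.low ⁻¹' {i} = {x | x ≤ E.cutoff i.succ} \ ⋃ k ∈ {k | k < i},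
      {x | x ≤ E.cutoff k.succ} := by
    ext x
    simp only [Set.mem_preimage, Set.mem_singleton_iff, Set.mem_sdiff, Set.mem_ofPred_eq,
      Set.mem_iUnion, ← E.low_le_iff, not_exists, not_le, exists_prop, not_and]
    constructor
    · rintro rfl; exact ⟨le_rfl, fun k hk => hk⟩
    · rintro ⟨h1, h2⟩
      by_contra h
      exact lt_irrefl _ (h2 _ (lt_of_le_of_ne h1 h))
  rw [this]
  exact measurableSet_Iic.diff (.biUnion (Set.to_countable _) fun k _ => measurableSet_Iic)

/-! ### The prior -/

instance : IsProbabilityMeasure E.prior :=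
  ⟨by simpa [prior] using E.density_total⟩

theorem prior_ac : E.prior ≪ volume := withDensity_absolutelyContinuous _ _

theorem ac_prior : (volume : Measure unitInterval) ≪ E.prior :=
  withDensity_absolutelyContinuous' E.density_measurable.ennreal_ofReal.aemeasurable
    (.of_forall fun x => by simpa using E.density_pos x)

instance : NullSingletonClass E.prior := ⟨fun x => E.prior_ac (measure_singleton x)⟩

theorem prior_Ioo_pos {a b : unitInterval} (h : a < b) : 0 < E.prior (Set.Ioo a b) := by
  refine pos_iff_ne_zero.2 fun h0 => ?_
  have := E.ac_prior h0
  rw [unitInterval.volume_Ioo, ENNReal.ofReal_eq_zero, sub_nonpos] at this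
  exact absurd h (not_lt.2 this)

/-- This turns almost-everywhere statements about open sets into exact ones. The top state needs an
interval to its left, every other state one to its right. -/
instance : E.prior.IsOpenPosMeasure where
  open_pos U hU hne h0 := by
    obtain ⟨x, hx⟩ := hne
    by_cases h1 : x < 1
    · obtain ⟨y, hy, hxy⟩ := exists_Ico_subset_of_mem_nhds (hU.mem_nhds hx) ⟨1, h1⟩
      exact (E.prior_Ioo_pos hy).ne'
        (measure_mono_null (Set.Ioo_subset_Ico_self.trans hxy) h0)
    · have h2 : 0 < x := lt_of_lt_of_le zero_lt_one (not_lt.1 h1)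
      obtain ⟨y, hy, hxy⟩ := exists_Ioc_subset_of_mem_nhds (hU.mem_nhds hx) ⟨0, h2⟩
      exact (E.prior_Ioo_pos hy).ne'
        (measure_mono_null (Set.Ioo_subset_Ioc_self.trans hxy) h0)

end Environment

/-! ### The convex order on finite measures on the unit interval -/

theorem integrable_of_continuous {μ : Measure unitInterval} [IsFiniteMeasure μ]
    {f : unitInterval → ℝ} (hf : Continuous f) : Integrable f μ := by
  obtain ⟨C, hC⟩ := isCompact_univ.exists_bound_of_continuousOn hf.continuousOn
  exact .of_bound hf.aestronglyMeasurable C (.of_forall fun x => hC x trivial)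

theorem integrable_coe {μ : Measure unitInterval} [IsFiniteMeasure μ] :
    Integrable (fun x : unitInterval => (x : ℝ)) μ :=
  integrable_of_continuous continuous_subtype_val

theorem integrable_put {μ : Measure unitInterval} [IsFiniteMeasure μ] (t : unitInterval) :
    Integrable (fun x : unitInterval => max ((t : ℝ) - x) 0) μ :=
  integrable_of_continuous (by fun_prop)

/-- `μ` is below `ν` in the convex order. -/
structure CxLE (μ ν : Measure unitInterval) : Prop where
  mass : μ.real Set.univ = ν.real Set.univ
  mean : ∫ x, (x : ℝ) ∂μ = ∫ x, (x : ℝ) ∂ν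
  put : ∀ t : unitInterval, ∫ x, max ((t : ℝ) - x) 0 ∂μ ≤ ∫ x, max ((t : ℝ) - x) 0 ∂ν

theorem CxLE.refl (μ : Measure unitInterval) : CxLE μ μ := ⟨rfl, rfl, fun _ => le_rfl⟩

theorem CxLE.trans {μ ν ρ : Measure unitInterval} (h : CxLE μ ν) (h' : CxLE ν ρ) : CxLE μ ρ :=
  ⟨h.mass.trans h'.mass, h.mean.trans h'.mean, fun t => (h.put t).trans (h'.put t)⟩

theorem CxLE.add {μ ν μ' ν' : Measure unitInterval} [IsFiniteMeasure μ] [IsFiniteMeasure ν]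
    [IsFiniteMeasure μ'] [IsFiniteMeasure ν'] (h : CxLE μ ν) (h' : CxLE μ' ν') :
    CxLE (μ + μ') (ν + ν') := by
  refine ⟨?_, ?_, fun t => ?_⟩
  · rw [measureReal_add_apply, measureReal_add_apply, h.mass, h'.mass]
  · rw [integral_add_measure integrable_coe integrable_coe,
      integral_add_measure integrable_coe integrable_coe, h.mean, h'.mean]
  · rw [integral_add_measure (integrable_put t) (integrable_put t),
      integral_add_measure (integrable_put t) (integrable_put t)]
    exact add_le_add (h.put t) (h'.put t)

/-- The barycentre of a finite measure. -/
def bary (ν : Measure unitInterval) : unitInterval :=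
  Set.projIcc 0 1 zero_le_one (⨍ x, (x : ℝ) ∂ν)

theorem integral_coe_nonneg (ν : Measure unitInterval) : 0 ≤ ∫ x, (x : ℝ) ∂ν :=
  integral_nonneg fun x => x.2.1

theorem integral_coe_le (ν : Measure unitInterval) [IsFiniteMeasure ν] :
    ∫ x, (x : ℝ) ∂ν ≤ ν.real Set.univ := by
  calc ∫ x, (x : ℝ) ∂ν ≤ ∫ _, (1 : ℝ) ∂ν :=
        integral_mono integrable_coe (integrable_const _) fun x => x.2.2
    _ = ν.real Set.univ := by simp

/-- The average of a nonzero measure already lies in `[0,1]`, so the projection in `bary` does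
nothing; for the zero measure both sides vanish. -/
theorem mass_mul_bary (ν : Measure unitInterval) [IsFiniteMeasure ν] :
    ν.real Set.univ * (bary ν : ℝ) = ∫ x, (x : ℝ) ∂ν := by
  by_cases h0 : ν = 0
  · simp [h0]
  have hpos : 0 < ν.real Set.univ := by
    rw [measureReal_def, ENNReal.toReal_pos_iff]
    exact ⟨by simpa [pos_iff_ne_zero] using h0, measure_lt_top _ _⟩
  have h1 : (⨍ x, (x : ℝ) ∂ν) = (ν.real Set.univ)⁻¹ * ∫ x, (x : ℝ) ∂ν := by
    rw [average_eq, smul_eq_mul]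
  have hm : (⨍ x, (x : ℝ) ∂ν) ∈ Set.Icc (0 : ℝ) 1 := by
    rw [h1, inv_mul_eq_div]
    exact ⟨div_nonneg (integral_coe_nonneg _) hpos.le,
      (div_le_one hpos).2 (integral_coe_le ν)⟩
  rw [bary, Set.projIcc_of_mem _ hm]
  change _ * (⨍ x, (x : ℝ) ∂ν) = _
  rw [h1, mul_inv_cancel_left₀ hpos.ne']

theorem le_bary {ν : Measure unitInterval} [IsFiniteMeasure ν] {c : unitInterval}
    (h0 : 0 < ν.real Set.univ) (h : ν.real Set.univ * c ≤ ∫ x, (x : ℝ) ∂ν) : c ≤ bary ν := by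
  rw [← mass_mul_bary] at h
  exact Subtype.coe_le_coe.1 (le_of_mul_le_mul_left h h0)

/-- All the mass of `ν` moved to its barycentre. -/
def pool (ν : Measure unitInterval) : Measure unitInterval := ν Set.univ • Measure.dirac (bary ν)

instance (ν : Measure unitInterval) [IsFiniteMeasure ν] : IsFiniteMeasure (pool ν) :=
  Measure.smul_finite _ (measure_ne_top _ _)

theorem integral_pool (ν : Measure unitInterval) (f : unitInterval → ℝ) :
    ∫ x, f x ∂(pool ν) = ν.real Set.univ * f (bary ν) := by
  rw [pool, integral_smul_measure, integral_dirac, measureReal_def, smul_eq_mul]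

theorem pool_univ (ν : Measure unitInterval) : (pool ν).real Set.univ = ν.real Set.univ := by
  simp [pool, measureReal_def]

/-- Jensen's inequality for the convex functions `max (t - x) 0`. -/
theorem cxLE_pool (ν : Measure unitInterval) [IsFiniteMeasure ν] : CxLE (pool ν) ν := by
  refine ⟨pool_univ ν, ?_, fun t => ?_⟩
  · rw [integral_pool, mass_mul_bary]
  · rw [integral_pool, mul_max_of_nonneg _ _ measureReal_nonneg, mul_zero, mul_sub, mass_mul_bary]
    refine max_le ?_ (integral_nonneg fun x => le_max_right _ _)
    have : ν.real Set.univ * t - ∫ x, (x : ℝ) ∂ν = ∫ x, ((t : ℝ) - x) ∂ν := by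
      rw [integral_sub (integrable_const _) integrable_coe]; simp
    rw [this]
    exact integral_mono ((integrable_const _).sub integrable_coe) (integrable_put t)
      fun x => le_max_left _ _

/-! ### Mean-preserving contractions -/

/-- Tonelli: for fixed `y` the points `s` with `y ≤ s ≤ x` have length `max (x - y) 0`. -/
theorem setIntegral_cdf (G : Measure unitInterval) [IsFiniteMeasure G] (x : unitInterval) :
    ∫ s in Set.Iic x, G.real (Set.Iic s) = ∫ y, max ((x : ℝ) - y) 0 ∂G := by
  have hS : MeasurableSet {p : unitInterval × unitInterval | p.2 ≤ p.1} :=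
    measurableSet_le measurable_snd measurable_fst
  have h1 : ∫⁻ s in Set.Iic x, G (Set.Iic s) =
      ∫⁻ y, ENNReal.ofReal ((x : ℝ) - y) ∂G := by
    have e1 := Measure.prod_apply (μ := volume.restrict (Set.Iic x)) (ν := G) hS
    have e2 := Measure.prod_apply_symm (μ := volume.restrict (Set.Iic x)) (ν := G) hS
    rw [e1] at e2
    refine Eq.trans e2 (lintegral_congr fun y => ?_)
    have : (fun s => (s, y)) ⁻¹' {p : unitInterval × unitInterval | p.2 ≤ p.1} = Set.Ici y := rfl
    rw [this, Measure.restrict_apply measurableSet_Ici, Set.Ici_inter_Iic,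
      unitInterval.volume_Icc]
  have hm : Measurable fun s : unitInterval => G (Set.Iic s) := measurable_measure_prodMk_left hS
  calc ∫ s in Set.Iic x, G.real (Set.Iic s) = (∫⁻ s in Set.Iic x, G (Set.Iic s)).toReal :=
        integral_toReal hm.aemeasurable (.of_forall fun _ => measure_lt_top _ _)
    _ = (∫⁻ y, ENNReal.ofReal ((x : ℝ) - y) ∂G).toReal := by rw [h1]
    _ = ∫ y, (ENNReal.ofReal ((x : ℝ) - y)).toReal ∂G := by
        refine (integral_toReal ?_ (.of_forall fun _ => ENNReal.ofReal_lt_top)).symm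
        exact (Measurable.ennreal_ofReal (by fun_prop)).aemeasurable
    _ = _ := by simp [ENNReal.toReal_ofReal']

theorem integral_cdf (G : Measure unitInterval) [IsFiniteMeasure G] :
    ∫ s, G.real (Set.Iic s) = G.real Set.univ - ∫ y, (y : ℝ) ∂G := by
  have h := setIntegral_cdf G 1
  have h1 : Set.Iic (1 : unitInterval) = Set.univ := by
    ext y; simpa using unitInterval.le_one'
  rw [h1, setIntegral_univ] at h
  rw [h]
  have : ∀ y : unitInterval, max (((1 : unitInterval) : ℝ) - y) 0 = 1 - y := fun y =>
    max_eq_left (by simpa using y.2.2)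
  simp_rw [this]
  rw [integral_sub (integrable_const _) integrable_coe]; simp

namespace Environment

variable {n : ℕ} [NeZero n] (E : Environment n)

/-- The integrated distribution functions are the integrals of the put functions, and at `1` they
equal one minus the mean. In this form the order can be added over pieces of measures. -/
theorem isMPC_iff (G : Measure unitInterval) :
    E.IsMPC G ↔ IsProbabilityMeasure G ∧ CxLE G E.prior := by
  refine and_congr_right fun hG => ?_
  simp only [setIntegral_cdf, integral_cdf, probReal_univ, sub_right_inj]
  exact ⟨fun h => ⟨by simp, h.2, h.1⟩, fun h => ⟨h.put, h.mean⟩⟩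

theorem isMPC_of_cxLE {G : Measure unitInterval} [IsFiniteMeasure G] (h : CxLE G E.prior) :
    E.IsMPC G := by
  refine (E.isMPC_iff G).2 ⟨⟨?_⟩, h⟩
  have := h.mass
  rwa [probReal_univ (μ := E.prior), measureReal_def, ENNReal.toReal_eq_one_iff] at this

theorem integrable_u (μ : Measure unitInterval) [IsFiniteMeasure μ] : Integrable E.u μ := by
  refine .of_bound (C := ∑ i, ‖E.v i‖) E.measurable_u.aestronglyMeasurable
    (.of_forall fun x => ?_)
  rw [E.u_eq]
  exact Finset.single_le_sum (f := fun i => ‖E.v i‖) (fun i _ => norm_nonneg _)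
    (Finset.mem_univ _)

/-- Pooling parts of a feasible signal distribution cannot improve upon an optimal one. -/
theorem IsOptimalSignal.pool_le {E : Environment n} {G : Measure unitInterval}
    (hG : E.IsOptimalSignal G) {M ν₁ ν₂ : Measure unitInterval} [IsFiniteMeasure M]
    [IsFiniteMeasure ν₁] [IsFiniteMeasure ν₂] (h : CxLE (M + ν₁ + ν₂) E.prior) :
    ∫ x, E.u x ∂M + ν₁.real Set.univ * E.u (bary ν₁) + ν₂.real Set.univ * E.u (bary ν₂) ≤
      ∫ x, E.u x ∂G := by
  have h1 : CxLE (M + pool ν₁ + pool ν₂) E.prior :=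
    (((CxLE.refl M).add (cxLE_pool ν₁)).add (cxLE_pool ν₂)).trans h
  have h2 := hG.2 _ (E.isMPC_of_cxLE h1)
  rwa [integral_add_measure (E.integrable_u _) (E.integrable_u _),
    integral_add_measure (E.integrable_u _) (E.integrable_u _), integral_pool,
    integral_pool] at h2

theorem u_ge {x : unitInterval} {i : Fin n} (h : E.γ i ≤ x) : E.v i ≤ E.u x := by
  rw [E.u_eq]
  exact E.v_strictMono.monotone (E.le_top_iff.2 h)


/-! ### Higher actions are recommended only at their cutoffs -/

variable {n : ℕ} [NeZero n] {E : Environment n} {G : Measure unitInterval}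

theorem measurableSet_recommending (E : Environment n) (i : Fin n) :
    MeasurableSet (E.recommending i) := by
  rw [E.recommending_eq]; exact E.measurable_top (measurableSet_singleton i)

theorem setIntegral_u {S : Set unitInterval} {i : Fin n} [IsFiniteMeasure G]
    (hS : MeasurableSet S) (h : ∀ x ∈ S, E.top x = i) :
    ∫ x in S, E.u x ∂G = G.real S * E.v i := by
  rw [setIntegral_congr_fun hS (g := fun _ => E.v i) fun x hx => by simp [E.u_eq, h x hx]]
  simp

/-- An optimal signal distribution recommends every action but the lowest one with the least
favourable posterior mean. -/
theorem IsOptimalSignal.ae_eq_cutoff (hG : E.IsOptimalSignal G) {j i : Fin n}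
    (hj : G (E.recommending j) ≠ 0) (hji : j < i) :
    ∀ᵐ x ∂G, E.top x = i → x = E.γ i := by
  obtain ⟨hp, hle⟩ := (E.isMPC_iff G).1 hG.1
  by_contra hcon
  set R := E.recommending j with hR
  set S : Set unitInterval := E.top ⁻¹' {i} ∩ Set.Ioi (E.γ i) with hS
  have hRm : MeasurableSet R := E.measurableSet_recommending j
  have hSm : MeasurableSet S := (E.measurable_top (measurableSet_singleton i)).inter measurableSet_Ioi
  have hS0 : G S ≠ 0 := by
    intro h0
    refine hcon ?_
    filter_upwards [measure_eq_zero_iff_ae_notMem.1 h0] with x hx hxi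
    by_contra hne
    exact hx ⟨hxi, lt_of_le_of_ne (hxi ▸ E.γ_top_le x) (Ne.symm hne)⟩
  have hSR : Disjoint S R := by
    rw [Set.disjoint_left]
    rintro x ⟨hx, -⟩ hx'
    rw [hR, E.mem_recommending] at hx'
    exact hji.ne (hx'.symm.trans hx)
  set α : ℝ := ∫ x in S, ((x : ℝ) - E.γ i) ∂G with hα
  have hα0 : 0 < α := by
    rw [hα, setIntegral_pos_iff_support_of_nonneg_ae]
    · refine lt_of_lt_of_le (pos_iff_ne_zero.2 hS0) (measure_mono fun x hx => ⟨?_, hx⟩)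
      have : (E.γ i : ℝ) < x := hx.2
      simpa [sub_eq_zero] using this.ne'
    · refine (ae_restrict_iff' hSm).2 (.of_forall fun x hx => ?_)
      have : (E.γ i : ℝ) < x := hx.2
      simpa using this.le
    · exact (integrable_coe.sub (integrable_const _)).integrableOn
  have hβ : -1 ≤ ∫ x in R, ((x : ℝ) - E.γ i) ∂G := by
    have h1 : ∫ _ in R, (-1 : ℝ) ∂G ≤ ∫ x in R, ((x : ℝ) - E.γ i) ∂G :=
      integral_mono (integrable_const _) (integrable_coe.sub (integrable_const _)) fun x => by
        have h1 := x.2.1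
        have h2 := (E.γ i).2.2
        change (-1 : ℝ) ≤ (x : ℝ) - E.γ i
        linarith
    have h2 : ∫ _ in R, (-1 : ℝ) ∂G = -(G.real R) := by simp
    have h3 : G.real R ≤ 1 := measureReal_le_one
    linarith
  -- Pool the slack part `S` with a fraction `ε` of the low part `R`. Relative to `γ i`, `S`
  -- contributes `α` to the first moment and all of `R` at least `-1`, so `ε ≤ α` keeps the
  -- barycentre at or above `γ i`, while the fraction of `R` is upgraded from `a_j` to `a_i`.
  set ε : NNReal := min 1 α.toNNReal with hε
  have hε1 : ε ≤ 1 := min_le_left _ _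
  have hε0 : (0 : ℝ) < ε := by
    rw [NNReal.coe_pos, hε, lt_min_iff]; exact ⟨one_pos, Real.toNNReal_pos.2 hα0⟩
  have hεα : (ε : ℝ) ≤ α := by
    calc (ε : ℝ) ≤ α.toNNReal := NNReal.coe_le_coe.2 (min_le_right _ _)
      _ = α := Real.coe_toNNReal _ hα0.le
  have hεc : ((1 - ε : NNReal) : ℝ) = 1 - ε := by rw [NNReal.coe_sub hε1]; rfl
  set M := G.restrict (S ∪ R)ᶜ + (1 - ε) • G.restrict R with hM
  set ν := G.restrict S + ε • G.restrict R with hν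
  have hsplit : G.restrict (S ∪ R)ᶜ + (G.restrict S + G.restrict R) = G := by
    rw [← Measure.restrict_union hSR hRm, add_comm, Measure.restrict_add_restrict_compl
      (hSm.union hRm)]
  have hsum : M + ν + 0 = G := by
    have : (1 - ε) • G.restrict R + ε • G.restrict R = G.restrict R := by
      rw [← add_smul, tsub_add_cancel_of_le hε1, one_smul]
    rw [hM, hν, add_zero]
    calc _ = G.restrict (S ∪ R)ᶜ + (G.restrict S +
          ((1 - ε) • G.restrict R + ε • G.restrict R)) := by abel
      _ = G := by rw [this, hsplit]
  have key := hG.pool_le (M := M) (ν₁ := ν) (ν₂ := 0) (by rw [hsum]; exact hle)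
  have hνmass : ν.real Set.univ = G.real S + ε * G.real R := by
    rw [hν, measureReal_add_apply, measureReal_nnreal_smul_apply]
    simp
  have hνpos : 0 < ν.real Set.univ := by
    rw [hνmass]
    have : 0 < G.real S := ENNReal.toReal_pos hS0 (measure_ne_top _ _)
    positivity
  have hνint : ∫ x, (x : ℝ) ∂ν = ∫ x in S, (x : ℝ) ∂G + ε * ∫ x in R, (x : ℝ) ∂G := by
    rw [hν, integral_add_measure integrable_coe integrable_coe, integral_smul_nnreal_measure]
    rfl
  have hc : ∀ T : Set unitInterval, ∫ x in T, ((x : ℝ) - E.γ i) ∂G =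
      ∫ x in T, (x : ℝ) ∂G - G.real T * E.γ i := fun T => by
    rw [integral_sub integrable_coe (integrable_const _)]; simp
  have hb : E.γ i ≤ bary ν := by
    refine le_bary hνpos ?_
    rw [hνmass, hνint]
    rw [hc] at hβ
    rw [hc] at hα
    nlinarith
  have hu := E.u_ge hb
  have hMu : ∫ x, E.u x ∂M = ∫ x in (S ∪ R)ᶜ, E.u x ∂G + (1 - ε) * (G.real R * E.v j) := by
    rw [hM, integral_add_measure (E.integrable_u _) (E.integrable_u _),
      integral_smul_nnreal_measure, setIntegral_u hRm fun x hx => E.mem_recommending.1 hx,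
      ← hεc]
    rfl
  have hGu : ∫ x, E.u x ∂G = ∫ x in (S ∪ R)ᶜ, E.u x ∂G + (G.real S * E.v i + G.real R * E.v j) := by
    conv_lhs => rw [← hsplit]
    rw [integral_add_measure (E.integrable_u _) (E.integrable_u _),
      integral_add_measure (E.integrable_u _) (E.integrable_u _),
      setIntegral_u hRm fun x hx => E.mem_recommending.1 hx,
      setIntegral_u hSm fun x hx => hx.1]
  have hv := E.v_strictMono hji
  have hRpos : 0 < G.real R := ENNReal.toReal_pos hj (measure_ne_top _ _)
  rw [hMu, hGu] at key
  simp only [measureReal_zero, Pi.zero_apply, zero_mul, add_zero] at key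
  have h1 := mul_le_mul_of_nonneg_left hu hνpos.le
  rw [hνmass] at h1 key
  have h2 : (ε : ℝ) * G.real R * E.v j < ε * G.real R * E.v i :=
    mul_lt_mul_of_pos_left hv (by positivity)
  nlinarith

/-! ### Blocks -/

section Block

variable {a b : unitInterval}

theorem IsBlock.finite (hb : E.IsBlock G a b) : (supp G a b).Finite :=
  Set.finite_of_encard_le_coe hb.supp_le

theorem ae_mem_supp (G : Measure unitInterval) (a b : unitInterval) :
    ∀ᵐ x ∂G, x ∈ Set.Ioo a b → x ∈ supp G a b :=
  (ae_restrict_iff' measurableSet_Ioo).1 Measure.support_mem_ae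

/-- The support is finite, so removing its other points leaves an open neighbourhood of `z`. It has
positive mass, and none of this mass lies off the support. -/
theorem IsBlock.restrict_singleton_ne_zero (hb : E.IsBlock G a b) {z : unitInterval}
    (hz : z ∈ supp G a b) : G.restrict (Set.Ioo a b) {z} ≠ 0 := by
  have hU : (supp G a b \ {z})ᶜ ∈ nhds z :=
    (hb.finite.subset Set.sdiff_subset).isClosed.isOpen_compl.mem_nhds (by simp)
  have h1 := (Measure.mem_support_iff_forall z).1 hz _ hU
  intro h0
  refine h1.ne' (measure_mono_null (t := {z} ∪ (supp G a b)ᶜ) ?_ ?_)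
  · intro x hx
    by_cases hxz : x = z
    · exact .inl hxz
    · exact .inr fun hxs => hx ⟨hxs, hxz⟩
  · exact measure_union_null h0 Measure.measure_compl_support

theorem IsBlock.supp_subset (hb : E.IsBlock G a b) : supp G a b ⊆ Set.Ioo a b := by
  intro z hz
  by_contra h
  refine hb.restrict_singleton_ne_zero hz ?_
  rw [Measure.restrict_apply (measurableSet_singleton z),
    Set.singleton_inter_eq_empty.2 h, measure_empty]

theorem IsBlock.singleton_ne_zero (hb : E.IsBlock G a b) {z : unitInterval}
    (hz : z ∈ supp G a b) : G {z} ≠ 0 := fun h0 =>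
  hb.restrict_singleton_ne_zero hz (le_antisymm (h0 ▸ Measure.restrict_apply_le _ _) bot_le)

theorem IsBlock.nonempty (hb : E.IsBlock G a b) : (supp G a b).Nonempty := by
  refine Measure.nonempty_support fun h0 => ?_
  have h1 : G (Set.Ioo a b) = 0 := by
    rw [← Measure.restrict_apply_univ, h0]; rfl
  exact (E.prior_Ioo_pos hb.lt).ne' (hb.mass ▸ h1)

theorem IsBlock.supp_eq (hb : E.IsBlock G a b) :
    (∃ z, supp G a b = {z}) ∨ ∃ zL zH, zL < zH ∧ supp G a b = {zL, zH} := by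
  rcases hb.supp_le.lt_or_eq with h | h
  · left
    have h1 : (supp G a b).encard ≤ 1 := Order.le_of_lt_add_one (by simpa [one_add_one_eq_two] using h)
    have h2 : (supp G a b).encard = 1 :=
      le_antisymm h1 (Set.one_le_encard_iff_nonempty.2 hb.nonempty)
    exact Set.encard_eq_one.1 h2
  · right
    obtain ⟨x, y, hxy, hs⟩ := Set.encard_eq_two.1 h
    rcases lt_or_gt_of_ne hxy with h | h
    · exact ⟨x, y, h, hs⟩
    · exact ⟨y, x, h, hs.trans (Set.pair_comm _ _)⟩

end Block

/-! ### Cut points -/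

section Family

variable {J : Set (unitInterval × unitInterval)}

/-- The states that no interval of the family contains in its interior. -/
def offSet (J : Set (unitInterval × unitInterval)) : Set unitInterval :=
  (⋃ I ∈ J, Set.Ioo I.1 I.2)ᶜ

theorem mem_offSet {e : unitInterval} : e ∈ offSet J ↔ ∀ I ∈ J, e ∉ Set.Ioo I.1 I.2 := by
  simp only [offSet, Set.mem_compl_iff, Set.mem_iUnion, not_exists]

theorem IsBiPoolingFamily.countable (hJ : E.IsBiPoolingFamily G J) : J.Countable :=
  hJ.disjoint.countable_of_isOpen (fun _ _ => isOpen_Ioo)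
    fun I hI => Set.nonempty_Ioo.2 (hJ.block I hI).lt

theorem measurableSet_offSet (J : Set (unitInterval × unitInterval)) :
    MeasurableSet (offSet J) :=
  (isOpen_biUnion fun _ _ => isOpen_Ioo).measurableSet.compl

theorem IsBiPoolingFamily.eq_of_mem (hJ : E.IsBiPoolingFamily G J)
    {I I' : unitInterval × unitInterval} (hI : I ∈ J) (hI' : I' ∈ J) {x : unitInterval}
    (hx : x ∈ Set.Ioo I.1 I.2) (hx' : x ∈ Set.Ioo I'.1 I'.2) : I = I' :=
  hJ.disjoint.elim_set hI hI' x hx hx'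

theorem IsBiPoolingFamily.measure_eq_of_subset (hJ : E.IsBiPoolingFamily G J)
    {S : Set unitInterval} (hS : MeasurableSet S) (h : S ⊆ offSet J) : G S = E.prior S := by
  have h1 := congrArg (fun μ => μ S) hJ.off
  simp only [Measure.restrict_apply hS] at h1
  change G (S ∩ offSet J) = E.prior (S ∩ offSet J) at h1
  rwa [Set.inter_eq_left.2 h] at h1

theorem IsBiPoolingFamily.singleton_eq_zero (hJ : E.IsBiPoolingFamily G J) {e : unitInterval}
    (he : e ∈ offSet J) : G {e} = 0 := by
  rw [hJ.measure_eq_of_subset (measurableSet_singleton e) (by simpa using he), measure_singleton]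

/-- A saturated set is the disjoint union of countably many blocks and of a part off all blocks,
where the two measures coincide. The cases `f = 1` and `f = x` give masses and means. -/
theorem IsBiPoolingFamily.lintegral_eq (hJ : E.IsBiPoolingFamily G J) {S : Set unitInterval}
    (hS : MeasurableSet S) (hsat : ∀ I ∈ J, Set.Ioo I.1 I.2 ⊆ S ∨ Disjoint (Set.Ioo I.1 I.2) S)
    {f : unitInterval → ENNReal}
    (hf : ∀ I ∈ J, ∫⁻ x in Set.Ioo I.1 I.2, f x ∂G = ∫⁻ x in Set.Ioo I.1 I.2, f x ∂E.prior) :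
    ∫⁻ x in S, f x ∂G = ∫⁻ x in S, f x ∂E.prior := by
  set J' := {I ∈ J | Set.Ioo I.1 I.2 ⊆ S} with hJ'
  have hJ'J : J' ⊆ J := fun I hI => hI.1
  have hc : J'.Countable := hJ.countable.mono hJ'J
  have hdec : S = (⋃ I ∈ J', Set.Ioo I.1 I.2) ∪ (S ∩ offSet J) := by
    ext x
    constructor
    · intro hx
      by_cases h : x ∈ offSet J
      · exact .inr ⟨hx, h⟩
      · rw [mem_offSet] at h
        push Not at h
        obtain ⟨I, hI, hxI⟩ := h
        refine .inl (Set.mem_biUnion (x := I) ⟨hI, ?_⟩ hxI)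
        exact (hsat I hI).resolve_right fun hd => Set.disjoint_left.1 hd hxI hx
    · rintro (h | h)
      · obtain ⟨I, hI, hx⟩ := Set.mem_iUnion₂.1 h
        exact hI.2 hx
      · exact h.1
  have hdisj : Disjoint (⋃ I ∈ J', Set.Ioo I.1 I.2) (S ∩ offSet J) := by
    rw [Set.disjoint_left]
    intro x hx hx'
    obtain ⟨I, hI, hxI⟩ := Set.mem_iUnion₂.1 hx
    exact mem_offSet.1 hx'.2 I hI.1 hxI
  have hoffS : G.restrict (S ∩ offSet J) = E.prior.restrict (S ∩ offSet J) := by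
    rw [← Measure.restrict_restrict hS, ← Measure.restrict_restrict hS]
    exact congrArg _ hJ.off
  have hm : MeasurableSet (S ∩ offSet J) := hS.inter (measurableSet_offSet J)
  rw [hdec, lintegral_union hm hdisj, lintegral_union hm hdisj, hoffS,
    lintegral_biUnion hc (fun _ _ => measurableSet_Ioo) (hJ.disjoint.subset hJ'J),
    lintegral_biUnion hc (fun _ _ => measurableSet_Ioo) (hJ.disjoint.subset hJ'J)]
  congr 1
  exact tsum_congr fun I => hf I I.2.1

theorem IsBiPoolingFamily.mass_eq (hJ : E.IsBiPoolingFamily G J) {S : Set unitInterval}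
    (hS : MeasurableSet S)
    (hsat : ∀ I ∈ J, Set.Ioo I.1 I.2 ⊆ S ∨ Disjoint (Set.Ioo I.1 I.2) S) :
    G S = E.prior S := by
  have := hJ.lintegral_eq hS hsat (f := fun _ => 1) fun I hI => by
    simpa using (hJ.block I hI).mass
  simpa using this

theorem ofReal_setIntegral_coe (μ : Measure unitInterval) [IsFiniteMeasure μ]
    (S : Set unitInterval) : ENNReal.ofReal (∫ x in S, (x : ℝ) ∂μ) =
      ∫⁻ x in S, ENNReal.ofReal (x : ℝ) ∂μ :=
  ofReal_integral_eq_lintegral_ofReal integrable_coe (.of_forall fun x => x.2.1)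

theorem IsBiPoolingFamily.mean_eq [IsFiniteMeasure G] (hJ : E.IsBiPoolingFamily G J)
    {S : Set unitInterval} (hS : MeasurableSet S)
    (hsat : ∀ I ∈ J, Set.Ioo I.1 I.2 ⊆ S ∨ Disjoint (Set.Ioo I.1 I.2) S) :
    ∫ x in S, (x : ℝ) ∂G = ∫ x in S, (x : ℝ) ∂E.prior := by
  have := hJ.lintegral_eq hS hsat (f := fun x => ENNReal.ofReal (x : ℝ)) fun I hI => by
    rw [← ofReal_setIntegral_coe, ← ofReal_setIntegral_coe, (hJ.block I hI).mean]
  rw [← ofReal_setIntegral_coe, ← ofReal_setIntegral_coe] at this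
  exact (ENNReal.ofReal_eq_ofReal_iff (integral_coe_nonneg _) (integral_coe_nonneg _)).1 this

theorem saturated_Ioi {e : unitInterval} (he : e ∈ offSet J) :
    ∀ I ∈ J, Set.Ioo I.1 I.2 ⊆ Set.Ioi e ∨ Disjoint (Set.Ioo I.1 I.2) (Set.Ioi e) := by
  intro I hI
  have := mem_offSet.1 he I hI
  rcases le_or_gt I.2 e with h | h
  · right
    rw [Set.disjoint_left]
    exact fun x hx hx' => absurd (hx.2.trans_le h) (not_lt.2 (le_of_lt hx'))
  · left
    have h1 : e ≤ I.1 := not_lt.1 fun h1 => this ⟨h1, h⟩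
    exact fun x hx => h1.trans_lt hx.1

theorem saturated_Iic {e : unitInterval} (he : e ∈ offSet J) :
    ∀ I ∈ J, Set.Ioo I.1 I.2 ⊆ Set.Iic e ∨ Disjoint (Set.Ioo I.1 I.2) (Set.Iic e) := by
  intro I hI
  rw [← Set.compl_Ioi, Set.subset_compl_iff_disjoint_right, Set.disjoint_compl_right_iff_subset]
  exact (saturated_Ioi he I hI).symm

/-- Masses and means agree on both sides of a cut point. For `t ≤ e` the put vanishes beyond `e`;
for `t ≥ e` it is affine up to `e`, so the part up to `e` contributes equally to both sides of the
global inequality and cancels. -/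
theorem IsBiPoolingFamily.cxLE_Ioi [IsProbabilityMeasure G] (hJ : E.IsBiPoolingFamily G J)
    (hle : CxLE G E.prior) {e : unitInterval} (he : e ∈ offSet J) :
    CxLE (G.restrict (Set.Ioi e)) (E.prior.restrict (Set.Ioi e)) := by
  refine ⟨?_, hJ.mean_eq measurableSet_Ioi (saturated_Ioi he), fun t => ?_⟩
  · simp only [measureReal_def, Measure.restrict_apply_univ,
      hJ.mass_eq measurableSet_Ioi (saturated_Ioi he)]
  · have hz : ∀ (μ : Measure unitInterval), t ≤ e →
        ∫ x in Set.Ioi e, max ((t : ℝ) - x) 0 ∂μ = 0 := fun μ hte => by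
      rw [setIntegral_congr_fun measurableSet_Ioi (g := fun _ => (0 : ℝ))]
      · simp
      · intro x hx
        have h1 : (e : ℝ) < x := hx
        have h2 : (t : ℝ) ≤ e := hte
        exact max_eq_right (by linarith)
    rcases le_total t e with hte | hte
    · rw [hz _ hte, hz _ hte]
    · have hd : ∀ (μ : Measure unitInterval) [IsFiniteMeasure μ],
          ∫ x in Set.Ioi e, max ((t : ℝ) - x) 0 ∂μ = ∫ x, max ((t : ℝ) - x) 0 ∂μ -
            (μ.real (Set.Iic e) * t - ∫ x in Set.Iic e, (x : ℝ) ∂μ) := fun μ _ => by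
        have h1 := integral_add_compl (μ := μ) (measurableSet_Iic (a := e)) (integrable_put t)
        have h2 : ∫ x in Set.Iic e, max ((t : ℝ) - x) 0 ∂μ =
            μ.real (Set.Iic e) * t - ∫ x in Set.Iic e, (x : ℝ) ∂μ := by
          rw [setIntegral_congr_fun measurableSet_Iic (g := fun x : unitInterval => (t : ℝ) - x)]
          · rw [integral_sub (integrable_const _) integrable_coe]; simp
          · intro x hx
            have h1 : (x : ℝ) ≤ e := hx
            have h2 : (e : ℝ) ≤ t := hte
            exact max_eq_left (by linarith)
        rw [Set.compl_Iic] at h1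
        linarith
      rw [hd, hd, hJ.mean_eq measurableSet_Iic (saturated_Iic he), measureReal_def,
        measureReal_def, hJ.mass_eq measurableSet_Iic (saturated_Iic he)]
      linarith [hle.put t]

/-- If another interval contained the end point in its interior, the two interiors would meet. -/
theorem IsBiPoolingFamily.left_mem_offSet (hJ : E.IsBiPoolingFamily G J)
    {I : unitInterval × unitInterval} (hI : I ∈ J) : I.1 ∈ offSet J := by
  rw [mem_offSet]
  intro I' hI' h
  have hlt := lt_min h.2 (hJ.block I hI).lt
  obtain ⟨x, hx⟩ := exists_between hlt
  have := hJ.eq_of_mem hI hI' (x := x) ⟨hx.1, hx.2.trans_le (min_le_right _ _)⟩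
    ⟨h.1.trans hx.1, hx.2.trans_le (min_le_left _ _)⟩
  rw [this] at h
  exact lt_irrefl _ h.1

theorem IsBiPoolingFamily.right_mem_offSet (hJ : E.IsBiPoolingFamily G J)
    {I : unitInterval × unitInterval} (hI : I ∈ J) : I.2 ∈ offSet J := by
  rw [mem_offSet]
  intro I' hI' h
  have hlt := max_lt h.1 (hJ.block I hI).lt
  obtain ⟨x, hx⟩ := exists_between hlt
  have := hJ.eq_of_mem hI hI' (x := x) ⟨(le_max_right _ _).trans_lt hx.1, hx.2⟩
    ⟨(le_max_left _ _).trans_lt hx.1, hx.2.trans h.2⟩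
  rw [this] at h
  exact lt_irrefl _ h.2

/-- Distinct intervals of the family lie on different sides of each other. -/
theorem IsBiPoolingFamily.le_or_le (hJ : E.IsBiPoolingFamily G J)
    {I I' : unitInterval × unitInterval} (hI : I ∈ J) (hI' : I' ∈ J) (hne : I ≠ I') :
    I.2 ≤ I'.1 ∨ I'.2 ≤ I.1 := by
  by_contra h
  push Not at h
  have h1 := max_lt (lt_min (hJ.block I hI).lt h.2) (lt_min h.1 (hJ.block I' hI').lt)
  obtain ⟨x, hx⟩ := exists_between h1
  simp only [max_lt_iff, lt_min_iff] at hx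
  exact hne (hJ.eq_of_mem hI hI' (x := x) (by constructor <;> grind) (by constructor <;> grind))

end Family


/-! ### Sets of states determined by mass and mean -/

variable {n : ℕ} [NeZero n] {E : Environment n} {G : Measure unitInterval}

theorem setIntegral_sub_const {μ : Measure unitInterval} [IsFiniteMeasure μ]
    (S : Set unitInterval) (t : ℝ) :
    ∫ x in S, ((x : ℝ) - t) ∂μ = ∫ x in S, (x : ℝ) ∂μ - μ.real S * t := by
  rw [integral_sub integrable_coe (integrable_const _)]; simp

theorem setIntegral_coe_le {μ : Measure unitInterval} [IsFiniteMeasure μ] {S : Set unitInterval}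
    (hS : MeasurableSet S) {t : ℝ} (h : ∀ x ∈ S, (x : ℝ) ≤ t) :
    ∫ x in S, (x : ℝ) ∂μ ≤ μ.real S * t := by
  have := setIntegral_nonpos (μ := μ) hS (f := fun x : unitInterval => (x : ℝ) - t)
    fun x hx => sub_nonpos.2 (h x hx)
  rw [setIntegral_sub_const] at this
  linarith

theorem le_setIntegral_coe {μ : Measure unitInterval} [IsFiniteMeasure μ] {S : Set unitInterval}
    (hS : MeasurableSet S) {t : ℝ} (h : ∀ x ∈ S, t ≤ (x : ℝ)) :
    μ.real S * t ≤ ∫ x in S, (x : ℝ) ∂μ := by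
  have := setIntegral_nonneg (μ := μ) hS (f := fun x : unitInterval => (x : ℝ) - t)
    fun x hx => sub_nonneg.2 (h x hx)
  rw [setIntegral_sub_const] at this
  linarith

/-- Two sets of states of equal mass and equal mean coincide if some state separates their
differences. -/
theorem ae_eq_of_threshold {S S' : Set unitInterval} (hS : MeasurableSet S)
    (hS' : MeasurableSet S') (hm : E.prior S = E.prior S')
    (hi : ∫ x in S, (x : ℝ) ∂E.prior = ∫ x in S', (x : ℝ) ∂E.prior) (t : unitInterval)
    (h1 : ∀ᵐ x ∂E.prior, x ∈ S → x ∉ S' → x ≤ t)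
    (h2 : ∀ᵐ x ∂E.prior, x ∈ S' → x ∉ S → t ≤ x) : S =ᵐ[E.prior] S' := by
  classical
  set f : unitInterval → ℝ := fun x => (x : ℝ) - t with hf
  have hfi : Integrable f E.prior := integrable_coe.sub (integrable_const _)
  -- The function `(1_{S'} - 1_S)(x - t)` is nonnegative by separation and has integral zero because
  -- masses and means agree. So it vanishes almost everywhere, and away from the null point `t` the
  -- two indicators are equal.
  have hg0 : 0 ≤ᵐ[E.prior] fun x => S'.indicator f x - S.indicator f x := by
    filter_upwards [h1, h2] with x hx1 hx2
    by_cases hxS : x ∈ S <;> by_cases hxS' : x ∈ S' <;>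
      simp only [Set.indicator, hxS, hxS', if_true, if_false, sub_self, zero_sub, sub_zero,
        Pi.zero_apply, le_refl]
    · have : (x : ℝ) ≤ t := hx1 hxS hxS'
      simp only [hf]; linarith
    · have : (t : ℝ) ≤ x := hx2 hxS' hxS
      simp only [hf]; linarith
  have hgi : ∫ x, (S'.indicator f x - S.indicator f x) ∂E.prior = 0 := by
    rw [integral_sub (hfi.indicator hS') (hfi.indicator hS), integral_indicator hS',
      integral_indicator hS, setIntegral_sub_const, setIntegral_sub_const, hi, measureReal_def,
      measureReal_def, hm, sub_self]
  have hg := (integral_eq_zero_iff_of_nonneg_ae hg0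
    ((hfi.indicator hS').sub (hfi.indicator hS))).1 hgi
  have ht : ∀ᵐ x ∂E.prior, x ≠ t := measure_eq_zero_iff_ae_notMem.1 (measure_singleton t)
  refine Filter.eventuallyEq_set.2 ?_
  filter_upwards [hg, ht] with x hx hxt
  have hne : (x : ℝ) - t ≠ 0 := sub_ne_zero.2 fun h => hxt (Subtype.ext h)
  by_cases hxS : x ∈ S <;> by_cases hxS' : x ∈ S' <;>
    simp only [Set.indicator, hxS, hxS', if_true, if_false, sub_self, zero_sub, sub_zero,
      Pi.zero_apply, neg_eq_zero, hf, hne] at hx ⊢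

/-! ### Signals in a block -/

theorem restrict_Ioo_eq (G : Measure unitInterval) {a b : unitInterval} (hb : E.IsBlock G a b) :
    G.restrict (Set.Ioo a b) = G.restrict (supp G a b) := by
  refine Measure.restrict_congr_set (Filter.eventuallyEq_set.2 ?_)
  filter_upwards [ae_mem_supp G a b] with x hx
  exact ⟨hx, fun h => hb.supp_subset h⟩

theorem IsBlock.setIntegral_pair [IsFiniteMeasure G] {a b zL zH : unitInterval}
    (hb : E.IsBlock G a b) (hz : zL < zH) (hs : supp G a b = {zL, zH})
    {f : unitInterval → ℝ} (hf : Integrable f G) :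
    ∫ x in Set.Ioo a b, f x ∂G = G.real {zL} * f zL + G.real {zH} * f zH := by
  rw [restrict_Ioo_eq G hb, hs, Set.insert_eq, setIntegral_union (by simpa using hz.ne)
    (measurableSet_singleton _) hf.integrableOn hf.integrableOn, integral_singleton,
    integral_singleton, smul_eq_mul, smul_eq_mul]

theorem IsBlock.mass_pair [IsFiniteMeasure G] {a b zL zH : unitInterval}
    (hb : E.IsBlock G a b) (hz : zL < zH) (hs : supp G a b = {zL, zH}) :
    E.prior.real (Set.Ioo a b) = G.real {zL} + G.real {zH} := by
  have := hb.setIntegral_pair hz hs (f := fun _ => 1) (integrable_const _)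
  simpa [measureReal_def, hb.mass] using this

theorem IsBlock.mean_pair [IsFiniteMeasure G] {a b zL zH : unitInterval}
    (hb : E.IsBlock G a b) (hz : zL < zH) (hs : supp G a b = {zL, zH}) :
    ∫ x in Set.Ioo a b, (x : ℝ) ∂E.prior = G.real {zL} * zL + G.real {zH} * zH := by
  rw [← hb.mean]; exact hb.setIntegral_pair hz hs integrable_coe

/-- `[c, d]` and its complement in `[a, b]` generate the signals `zL` and `zH`. -/
structure IsSplit (E : Environment n) (G : Measure unitInterval) (a b zL zH c d : unitInterval) :
    Prop where
  le_left : a ≤ c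
  lt : c < d
  lt_right : d < b
  mass_low : E.prior (Set.Icc c d) = G {zL}
  mass_high : E.prior (Set.Icc a c ∪ Set.Icc d b) = G {zH}
  mean_low : ∫ x in Set.Icc c d, (x : ℝ) ∂E.prior = G.real {zL} * zL
  mean_high : ∫ x in Set.Icc a c ∪ Set.Icc d b, (x : ℝ) ∂E.prior = G.real {zH} * zH

/-! ### Distribution function and quantiles of the prior -/

/-- As `x` tends to `x₀`, the indicator of `Iic x` fails to converge at most at `s = x₀`, which is
no atom; dominated convergence applies. -/
theorem continuous_setIntegral_Iic {f : unitInterval → ℝ} (hf : Integrable f E.prior) :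
    Continuous fun x => ∫ s in Set.Iic x, f s ∂E.prior := by
  simp_rw [← integral_indicator measurableSet_Iic]
  rw [continuous_iff_continuousAt]
  intro x₀
  refine continuousAt_of_dominated (bound := fun s => ‖f s‖)
    (.of_forall fun x => (hf.indicator measurableSet_Iic).aestronglyMeasurable)
    (.of_forall fun x => .of_forall fun s => norm_indicator_le_norm_self _ _) hf.norm ?_
  filter_upwards [measure_eq_zero_iff_ae_notMem.1 (measure_singleton (μ := E.prior) x₀)] with s hs
  rcases lt_or_gt_of_ne (show s ≠ x₀ from hs) with h | h
  · refine continuousAt_const.congr (f := fun _ => f s) ?_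
    filter_upwards [lt_mem_nhds h] with x hx
    exact (Set.indicator_of_mem (show s ∈ Set.Iic x from hx.le) f).symm
  · refine continuousAt_const.congr (f := fun _ => (0 : ℝ)) ?_
    filter_upwards [gt_mem_nhds h] with x hx
    exact (Set.indicator_of_notMem (show s ∉ Set.Iic x from not_le.2 hx) f).symm

theorem setIntegral_Icc_eq {f : unitInterval → ℝ} (hf : Integrable f E.prior)
    {c d : unitInterval} (h : c ≤ d) : ∫ s in Set.Icc c d, f s ∂E.prior =
      ∫ s in Set.Iic d, f s ∂E.prior - ∫ s in Set.Iic c, f s ∂E.prior := by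
  rw [Measure.restrict_congr_set (Ioc_ae_eq_Icc (μ := E.prior) (a := c) (b := d)).symm,
    ← Set.Iic_union_Ioc_eq_Iic h, setIntegral_union (Set.Iic_disjoint_Ioc le_rfl) measurableSet_Ioc hf.integrableOn hf.integrableOn]
  ring

theorem measureReal_Icc_eq {c d : unitInterval} (h : c ≤ d) : E.prior.real (Set.Icc c d) =
    E.prior.real (Set.Iic d) - E.prior.real (Set.Iic c) := by
  have := setIntegral_Icc_eq (E := E) (integrable_const (1 : ℝ)) h
  simpa using this

theorem continuous_cdf : Continuous fun x => E.prior.real (Set.Iic x) := by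
  have := continuous_setIntegral_Iic (E := E) (integrable_const (1 : ℝ))
  simpa using this

theorem measureReal_Icc_pos {c d : unitInterval} (h : c < d) : 0 < E.prior.real (Set.Icc c d) :=
  ENNReal.toReal_pos ((E.prior_Ioo_pos h).trans_le (measure_mono Set.Ioo_subset_Icc_self)).ne'
    (measure_ne_top _ _)

theorem strictMono_cdf : StrictMono fun x => E.prior.real (Set.Iic x) := fun c d h => by
  have h1 := measureReal_Icc_eq (E := E) h.le
  have h2 := measureReal_Icc_pos (E := E) h
  simp only
  linarith

/-- A continuous quantile function. -/
theorem exists_quantile (E : Environment n) : ∃ Q : ℝ → unitInterval, Continuous Q ∧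
    ∀ t ∈ Set.Icc (0 : ℝ) 1, E.prior.real (Set.Iic (Q t)) = t := by
  set Φ : unitInterval → unitInterval := fun x =>
    ⟨E.prior.real (Set.Iic x), measureReal_nonneg, measureReal_le_one⟩ with hΦ
  have hmono : StrictMono Φ := fun x y h => strictMono_cdf (E := E) h
  have hcont : Continuous Φ := continuous_cdf.subtype_mk _
  have hsurj : Function.Surjective Φ := by
    intro y
    refine mem_range_of_exists_le_of_exists_ge hcont ⟨0, ?_⟩ ⟨1, ?_⟩
    · have h0 : Set.Iic (0 : unitInterval) = {0} := Set.Iic_bot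
      have : E.prior.real (Set.Iic (0 : unitInterval)) = 0 := by
        rw [h0, measureReal_def, measure_singleton]; rfl
      exact Subtype.coe_le_coe.1 (this.trans_le y.2.1)
    · have h1 : Set.Iic (1 : unitInterval) = Set.univ := Set.Iic_top
      have : E.prior.real (Set.Iic (1 : unitInterval)) = 1 := by rw [h1, probReal_univ]
      exact Subtype.coe_le_coe.1 (y.2.2.trans this.ge)
  let e := hmono.orderIsoOfSurjective Φ hsurj
  refine ⟨fun t => e.symm (Set.projIcc 0 1 zero_le_one t),
    e.symm.continuous.comp continuous_projIcc, fun t ht => ?_⟩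
  have : e (e.symm (Set.projIcc 0 1 zero_le_one t)) = Set.projIcc 0 1 zero_le_one t :=
    e.apply_symm_apply _
  change (Φ (e.symm (Set.projIcc 0 1 zero_le_one t)) : ℝ) = t
  rw [Set.projIcc_of_mem _ ht] at this ⊢
  exact congrArg Subtype.val this

theorem setIntegral_union_Icc {a b c d : unitInterval} (hcd : c < d) {f : unitInterval → ℝ} (hf : Integrable f E.prior) :
    ∫ x in Set.Icc a c ∪ Set.Icc d b, f x ∂E.prior =
      ∫ x in Set.Icc a c, f x ∂E.prior + ∫ x in Set.Icc d b, f x ∂E.prior :=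
  setIntegral_union (Set.disjoint_left.2 fun _ hx hx' =>
    absurd (hx.2.trans_lt hcd) (not_lt.2 hx'.1)) measurableSet_Icc hf.integrableOn hf.integrableOn

theorem measureReal_union_Icc {a b c d : unitInterval} (hcd : c < d) :
    E.prior.real (Set.Icc a c ∪ Set.Icc d b) =
      E.prior.real (Set.Icc a c) + E.prior.real (Set.Icc d b) :=
  measureReal_union (Set.disjoint_left.2 fun _ hx hx' =>
    absurd (hx.2.trans_lt hcd) (not_lt.2 hx'.1)) measurableSet_Icc

theorem measureReal_singleton_pos [IsFiniteMeasure G] {a b z : unitInterval}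
    (hb : E.IsBlock G a b) (hz : z ∈ supp G a b) : 0 < G.real {z} :=
  ENNReal.toReal_pos (hb.singleton_ne_zero hz) (measure_ne_top _ _)

/-- Intervals of equal mass and mean determine a split. -/
theorem IsBlock.isSplit_of_low [IsFiniteMeasure G] {a b zL zH c d : unitInterval}
    (hb : E.IsBlock G a b) (hz : zL < zH) (hs : supp G a b = {zL, zH}) (hac : a ≤ c)
    (hcd : c ≤ d) (hdb : d ≤ b) (hm : E.prior.real (Set.Icc c d) = G.real {zL})
    (hi : ∫ x in Set.Icc c d, (x : ℝ) ∂E.prior = G.real {zL} * zL) :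
    E.IsSplit G a b zL zH c d := by
  have hL := measureReal_singleton_pos hb (z := zL) (by simp [hs])
  have hH := measureReal_singleton_pos hb (z := zH) (by simp [hs])
  have hzR : (zL : ℝ) < zH := hz
  have hcd' : c < d := by
    rcases hcd.lt_or_eq with h | h
    · exact h
    · rw [h, Set.Icc_self, measureReal_def, measure_singleton] at hm
      exact absurd hm hL.ne
  have hmass := hb.mass_pair hz hs
  have hmean := hb.mean_pair hz hs
  have e1 : E.prior.real (Set.Ioo a b) = E.prior.real (Set.Icc a b) :=
    measureReal_congr Ioo_ae_eq_Icc
  rw [Measure.restrict_congr_set (Ioo_ae_eq_Icc (μ := E.prior) (a := a) (b := b)),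
    setIntegral_Icc_eq integrable_coe hb.lt.le] at hmean
  rw [e1, measureReal_Icc_eq hb.lt.le] at hmass
  have hmH : E.prior.real (Set.Icc a c ∪ Set.Icc d b) = G.real {zH} := by
    rw [measureReal_union_Icc hcd', measureReal_Icc_eq hac, measureReal_Icc_eq hdb]
    rw [measureReal_Icc_eq hcd] at hm
    linarith
  have hiH : ∫ x in Set.Icc a c ∪ Set.Icc d b, (x : ℝ) ∂E.prior = G.real {zH} * zH := by
    rw [setIntegral_union_Icc hcd' integrable_coe, setIntegral_Icc_eq integrable_coe hac,
      setIntegral_Icc_eq integrable_coe hdb]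
    rw [setIntegral_Icc_eq integrable_coe hcd] at hi
    linarith
  refine ⟨hac, hcd', ?_, ?_, ?_, hi, hiH⟩
  -- If `d = b`, the high component lies to the left of the low one up to a null set, so `zH ≤ c ≤
  -- zL`.
  · refine lt_of_le_of_ne hdb fun hdb' => ?_
    have h1 : (c : ℝ) ≤ zL := by
      have := le_setIntegral_coe (μ := E.prior) (measurableSet_Icc (a := c) (b := d)) (t := c)
        fun x hx => hx.1
      rw [hm, hi] at this
      exact le_of_mul_le_mul_left this hL
    have h2 : (zH : ℝ) ≤ c := by
      have := setIntegral_coe_le (μ := E.prior) (measurableSet_Icc (a := a) (b := c)) (t := c)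
        fun x hx => hx.2
      have h3 : Set.Icc d b =ᵐ[E.prior] (∅ : Set unitInterval) := by
        rw [hdb', Set.Icc_self]; exact ae_eq_empty.2 (measure_singleton b)
      have h4 : (Set.Icc a c ∪ Set.Icc d b : Set unitInterval) =ᵐ[E.prior] Set.Icc a c := by
        simpa using (Filter.EventuallyEq.refl _ (Set.Icc a c)).union h3
      rw [← measureReal_congr h4, ← Measure.restrict_congr_set h4, hmH, hiH] at this
      exact le_of_mul_le_mul_left this hH
    linarith
  · exact (measureReal_eq_measureReal_iff (measure_ne_top _ _) (measure_ne_top _ _)).1 hm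
  · exact (measureReal_eq_measureReal_iff (measure_ne_top _ _) (measure_ne_top _ _)).1 hmH

/-- Slide an interval `[c, d c]` of constant prior mass `G {zL}` across the block. Its first moment
is continuous in `c`, at most the required value at the left end by the convex order, and at least
this value at the right end. -/
theorem IsBiPoolingFamily.exists_isSplit [IsProbabilityMeasure G]
    {J : Set (unitInterval × unitInterval)} (hJ : E.IsBiPoolingFamily G J)
    (hle : CxLE G E.prior) {I : unitInterval × unitInterval} (hI : I ∈ J)
    {zL zH : unitInterval} (hz : zL < zH) (hs : supp G I.1 I.2 = {zL, zH}) :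
    ∃ c d, E.IsSplit G I.1 I.2 zL zH c d := by
  obtain ⟨a, b⟩ := I
  have hb := hJ.block _ hI
  simp only at hb hs ⊢
  have hL := measureReal_singleton_pos hb (z := zL) (by simp [hs])
  have hH := measureReal_singleton_pos hb (z := zH) (by simp [hs])
  have hzR : (zL : ℝ) < zH := hz
  have hmass := hb.mass_pair hz hs
  have hmean := hb.mean_pair hz hs
  have e1 : E.prior.real (Set.Ioo a b) = E.prior.real (Set.Icc a b) :=
    measureReal_congr Ioo_ae_eq_Icc
  rw [Measure.restrict_congr_set (Ioo_ae_eq_Icc (μ := E.prior) (a := a) (b := b)),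
    setIntegral_Icc_eq integrable_coe hb.lt.le] at hmean
  rw [e1, measureReal_Icc_eq hb.lt.le] at hmass
  set Φ : unitInterval → ℝ := fun x => E.prior.real (Set.Iic x) with hΦ
  set Ψ : unitInterval → ℝ := fun x => ∫ s in Set.Iic x, (s : ℝ) ∂E.prior with hΨ
  have hΦmono : StrictMono Φ := strictMono_cdf
  have hΦ0 : ∀ x, 0 ≤ Φ x := fun x => measureReal_nonneg
  have hΦ1 : ∀ x, Φ x ≤ 1 := fun x => measureReal_le_one
  obtain ⟨Q, hQc, hQ⟩ := E.exists_quantile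
  have hΨc : Continuous Ψ := continuous_setIntegral_Iic integrable_coe
  have hΦc : Continuous Φ := continuous_cdf
  replace hQ : ∀ t ∈ Set.Icc (0 : ℝ) 1, Φ (Q t) = t := hQ
  replace hmass : Φ b - Φ a = G.real {zL} + G.real {zH} := hmass
  replace hmean : Ψ b - Ψ a = G.real {zL} * zL + G.real {zH} * zH := hmean
  set p := G.real {zL} with hp
  set q := G.real {zH} with hq
  -- The last admissible left end point: `[c₁, b]` has mass `p`.
  set c₁ := Q (Φ b - p) with hc₁
  have hΦc₁ : Φ c₁ = Φ b - p := hQ _ ⟨by linarith [hΦ0 a], by linarith [hΦ1 b]⟩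
  have hac₁ : a ≤ c₁ := hΦmono.le_iff_le.1 (by linarith)
  have hc₁b : c₁ ≤ b := hΦmono.le_iff_le.1 (by linarith)
  set d : unitInterval → unitInterval := fun c => Q (Φ c + p) with hd
  have hdΦ : ∀ c, c ≤ c₁ → Φ (d c) = Φ c + p := fun c hc => by
    have := hΦmono.monotone hc
    exact hQ _ ⟨by linarith [hΦ0 c], by linarith [hΦ1 b]⟩
  have hcd : ∀ c, c ≤ c₁ → c ≤ d c := fun c hc => hΦmono.le_iff_le.1 (by linarith [hdΦ c hc])
  have hdb : ∀ c, c ≤ c₁ → d c ≤ b := fun c hc => hΦmono.le_iff_le.1 (by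
    linarith [hdΦ c hc, hΦmono.monotone hc])
  set M : unitInterval → ℝ := fun c => Ψ (d c) - Ψ c with hM
  have hMc : Continuous M := (hΨc.comp (hQc.comp (hΦc.add continuous_const))).sub hΨc
  -- The convex order survives restriction to the states beyond `a`. Test it with the put struck at
  -- `d a`: under `G` the atom `zL` alone contributes at least `p * (d a - zL)`, and under the prior
  -- the value is `p * d a - M a`.
  have hlow : M a ≤ p * zL := by
    have hput := (hJ.cxLE_Ioi hle (hJ.left_mem_offSet hI)).put (d a)
    have h1 : p * max ((d a : ℝ) - zL) 0 ≤ ∫ x in Set.Ioi a, max ((d a : ℝ) - x) 0 ∂G := by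
      have : ∫ x in {zL}, max ((d a : ℝ) - x) 0 ∂G ≤
          ∫ x in Set.Ioi a, max ((d a : ℝ) - x) 0 ∂G := by
        refine setIntegral_mono_set (integrable_put _).integrableOn
          (.of_forall fun x => le_max_right _ _) (LE.le.eventuallyLE
            (Set.singleton_subset_iff.2 (hb.supp_subset (by simp [hs])).1))
      rwa [integral_singleton, smul_eq_mul] at this
    have h2 : ∫ x in Set.Ioi a, max ((d a : ℝ) - x) 0 ∂E.prior =
        ∫ x in Set.Icc a (d a), ((d a : ℝ) - x) ∂E.prior := by
      rw [← Measure.restrict_congr_set (Ioc_ae_eq_Icc (μ := E.prior) (a := a) (b := d a)),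
        setIntegral_eq_of_subset_of_forall_sdiff_eq_zero measurableSet_Ioi
          (s := Set.Ioc a (d a)) (fun x hx => hx.1)]
      · refine setIntegral_congr_fun measurableSet_Ioc fun x hx => max_eq_left ?_
        have : (x : ℝ) ≤ d a := hx.2
        linarith
      · intro x hx
        have : ¬ x ≤ d a := fun h => hx.2 ⟨hx.1, h⟩
        have : (d a : ℝ) < x := not_le.1 this
        exact max_eq_right (by linarith)
    simp only at hput
    rw [h2, integral_sub (integrable_const _) integrable_coe,
      setIntegral_Icc_eq integrable_coe (hcd a hac₁), setIntegral_const, smul_eq_mul,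
      measureReal_Icc_eq (hcd a hac₁)] at hput
    change _ ≤ (Φ (d a) - Φ a) * (d a : ℝ) - (Ψ (d a) - Ψ a) at hput
    rw [hdΦ a hac₁] at hput
    have h3 : p * ((d a : ℝ) - zL) ≤ p * max ((d a : ℝ) - zL) 0 :=
      mul_le_mul_of_nonneg_left (le_max_left _ _) hL.le
    simp only [hM]
    nlinarith
  -- Otherwise `c₁ < zL < zH`, while the complement `[a, c₁]`, of mass `q`, would need a mean above
  -- `zH`.
  have hhigh : p * zL ≤ M c₁ := by
    have hdc₁ : d c₁ = b := hΦmono.injective (by rw [hdΦ c₁ le_rfl]; linarith)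
    simp only [hM, hdc₁]
    have h1 := le_setIntegral_coe (μ := E.prior) (measurableSet_Icc (a := c₁) (b := b)) (t := c₁)
      fun x hx => hx.1
    have h2 := setIntegral_coe_le (μ := E.prior) (measurableSet_Icc (a := a) (b := c₁)) (t := c₁)
      fun x hx => hx.2
    rw [measureReal_Icc_eq hc₁b, setIntegral_Icc_eq integrable_coe hc₁b] at h1
    rw [measureReal_Icc_eq hac₁, setIntegral_Icc_eq integrable_coe hac₁] at h2
    change (Φ b - Φ c₁) * c₁ ≤ Ψ b - Ψ c₁ at h1
    change Ψ c₁ - Ψ a ≤ (Φ c₁ - Φ a) * c₁ at h2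
    have e3 : Φ b - Φ c₁ = p := by linarith
    have e4 : Φ c₁ - Φ a = q := by linarith
    rw [e3] at h1
    rw [e4] at h2
    by_contra hcon
    push Not at hcon
    have h5 : (c₁ : ℝ) < zL := lt_of_mul_lt_mul_left (h1.trans_lt hcon) hL.le
    have h6 : q * (c₁ : ℝ) < q * zH := mul_lt_mul_of_pos_left (h5.trans hzR) hH
    linarith
  obtain ⟨c, hc, hMeq⟩ := isPreconnected_Icc.intermediate_value
    (Set.left_mem_Icc.2 hac₁) (Set.right_mem_Icc.2 hac₁) hMc.continuousOn ⟨hlow, hhigh⟩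
  refine ⟨c, d c, hb.isSplit_of_low hz hs hc.1 (hcd c hc.2) (hdb c hc.2) ?_ ?_⟩
  · rw [measureReal_Icc_eq (hcd c hc.2)]
    change Φ (d c) - Φ c = p
    linarith [hdΦ c hc.2]
  · rw [setIntegral_Icc_eq integrable_coe (hcd c hc.2)]
    exact hMeq


/-! ### The lowest recommended action -/

variable {n : ℕ} [NeZero n] {E : Environment n} {G : Measure unitInterval}
  {J : Set (unitInterval × unitInterval)}

/-- `j` is the lowest action that `G` recommends with positive probability. -/
def IsLowestRecommended (E : Environment n) (G : Measure unitInterval) (j : Fin n) : Prop :=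
  IsLeast {i | G (E.recommending i) ≠ 0} j

theorem exists_isLowestRecommended (E : Environment n) (G : Measure unitInterval)
    [IsProbabilityMeasure G] : ∃ j, E.IsLowestRecommended G j := by
  classical
  have hne : {i | G (E.recommending i) ≠ 0}.Nonempty := by
    by_contra h
    rw [Set.not_nonempty_iff_eq_empty, Set.eq_empty_iff_forall_notMem] at h
    have h1 : G (⋃ i, E.recommending i) = 0 :=
      measure_iUnion_null fun i => not_not.1 (h i)
    have h2 : (⋃ i, E.recommending i) = Set.univ :=
      Set.eq_univ_of_forall fun x => Set.mem_iUnion.2 ⟨_, E.mem_recommending.2 rfl⟩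
    rw [h2, measure_univ] at h1
    exact one_ne_zero h1
  obtain ⟨j, hj⟩ := (Set.toFinite {i | G (E.recommending i) ≠ 0}).exists_minimal hne
  exact ⟨j, hj.1, fun i hi => le_of_not_gt fun hlt => hlt.not_ge (hj.2 hi hlt.le)⟩

theorem IsLowestRecommended.ae_le {j : Fin n} (hj : E.IsLowestRecommended G j) :
    ∀ᵐ x ∂G, j ≤ E.top x := by
  have : ∀ i : Fin n, ∀ᵐ x ∂G, E.top x = i → j ≤ i := fun i => by
    by_cases h : j ≤ i
    · exact .of_forall fun _ _ => h
    · have h0 : G (E.recommending i) = 0 := by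
        by_contra h0
        exact h (hj.2 h0)
      filter_upwards [measure_eq_zero_iff_ae_notMem.1 h0] with x hx hxi
      exact absurd (E.mem_recommending.2 hxi) hx
  filter_upwards [ae_all_iff.2 this] with x hx using hx _ rfl

theorem IsLowestRecommended.le_of_singleton {j : Fin n} (hj : E.IsLowestRecommended G j)
    {z : unitInterval} (hz : G {z} ≠ 0) : j ≤ E.top z := by
  by_contra h
  exact hz (measure_mono_null (by simpa using h) (ae_iff.1 hj.ae_le))

theorem IsOptimalSignal.eq_cutoff_of_singleton (hG : E.IsOptimalSignal G) {j : Fin n}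
    (hj : E.IsLowestRecommended G j) {z : unitInterval} (hz : G {z} ≠ 0) (h : j < E.top z) :
    z = E.γ (E.top z) := by
  by_contra hcon
  exact hz (measure_mono_null (by simpa using hcon) (ae_iff.1 (hG.ae_eq_cutoff hj.1 h)))

set_option maxHeartbeats 800000 in
/-- If a block of an optimal signal distribution splits into the lowest recommended action and a
higher one, then all states of the block below the low component are pooled low, or the block
starts at the lowest state. -/
theorem IsSplit.left_eq [IsProbabilityMeasure G] (hG : E.IsOptimalSignal G)
    (hJ : E.IsBiPoolingFamily G J) {a b : unitInterval} (hI : (a, b) ∈ J)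
    {zL zH c d : unitInterval} (hs : supp G a b = {zL, zH}) (hz : zL < zH)
    (hj : E.IsLowestRecommended G (E.top zL)) (hne : E.top zL ≠ E.top zH)
    (h : E.IsSplit G a b zL zH c d) (ha : 0 < a) : c = a := by
  by_contra hca
  have hle : CxLE G E.prior := ((E.isMPC_iff G).1 hG.1).2
  have hac : a < c := lt_of_le_of_ne h.le_left (Ne.symm hca)
  have hb : E.IsBlock G a b := hJ.block _ hI
  have hva : a ∈ offSet J := hJ.left_mem_offSet hI
  have hvb : b ∈ offSet J := hJ.right_mem_offSet hI
  have hzR : (zL : ℝ) < zH := hz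
  have hzLb : zL ∈ Set.Ioo a b := hb.supp_subset (by simp [hs])
  have hzHb : zH ∈ Set.Ioo a b := hb.supp_subset (by simp [hs])
  have hlt : E.top zL < E.top zH := lt_of_le_of_ne (E.top_mono hz.le) hne
  have hvlt : E.v (E.top zL) < E.v (E.top zH) := E.v_strictMono hlt
  set p := G.real {zL} with hp
  set q := G.real {zH} with hq
  have hp0 : 0 < p := measureReal_singleton_pos hb (by simp [hs])
  have hq0 : 0 < q := measureReal_singleton_pos hb (by simp [hs])
  -- masses and integrals of the four pieces
  have rac : E.prior.restrict (Set.Ioc a c) = E.prior.restrict (Set.Icc a c) :=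
    Measure.restrict_congr_set Ioc_ae_eq_Icc
  have rcd : E.prior.restrict (Set.Ioc c d) = E.prior.restrict (Set.Icc c d) :=
    Measure.restrict_congr_set Ioc_ae_eq_Icc
  have rdb : E.prior.restrict (Set.Ioc d b) = E.prior.restrict (Set.Icc d b) :=
    Measure.restrict_congr_set Ioc_ae_eq_Icc
  set m := E.prior.real (Set.Icc a c) with hm
  set μ := ∫ x in Set.Icc a c, (x : ℝ) ∂E.prior with hμ
  set m' := E.prior.real (Set.Icc d b) with hm'
  set μ' := ∫ x in Set.Icc d b, (x : ℝ) ∂E.prior with hμ'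
  have hm0 : 0 < m := measureReal_Icc_pos hac
  have hmq : m + m' = q := by
    rw [hm, hm', ← measureReal_union_Icc h.lt, measureReal_def, h.mass_high, ← measureReal_def]
  have hμq : μ + μ' = q * zH := by
    rw [hμ, hμ', ← setIntegral_union_Icc h.lt integrable_coe, h.mean_high]
  have hmL : E.prior.real (Set.Icc c d) = p := by
    rw [measureReal_def, h.mass_low, ← measureReal_def]
  have hμL := h.mean_low
  have hczL : (c : ℝ) ≤ zL := by
    have := le_setIntegral_coe (μ := E.prior) (measurableSet_Icc (a := c) (b := d)) (t := c)
      fun x hx => hx.1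
    rw [hmL, hμL] at this
    exact le_of_mul_le_mul_left this hp0
  have hμc : μ < m * c := by
    have h1 : 0 < ∫ x in Set.Icc a c, ((c : ℝ) - x) ∂E.prior := by
      rw [setIntegral_pos_iff_support_of_nonneg_ae]
      · refine (E.prior_Ioo_pos hac).trans_le (measure_mono fun x hx => ⟨?_, ⟨hx.1.le, hx.2.le⟩⟩)
        have : (x : ℝ) < c := hx.2
        simpa [sub_eq_zero] using this.ne'
      · refine (ae_restrict_iff' measurableSet_Icc).2 (.of_forall fun x hx => ?_)
        have : (x : ℝ) ≤ c := hx.2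
        simpa using this
      · exact ((integrable_const _).sub integrable_coe).integrableOn
    rw [integral_sub (integrable_const _) integrable_coe, setIntegral_const, smul_eq_mul] at h1
    linarith
  -- The shortfall of the left arm `[a, c]` relative to the mean `zH`. The mean of the arm is below
  -- `c ≤ zL`, so `A` exceeds `m * (zH - zL)`.
  set A := m * zH - μ with hA
  have hAm : m * (zH - zL) < A := by
    have : m * (c : ℝ) ≤ m * zL := mul_le_mul_of_nonneg_left hczL hm0.le
    rw [hA]; linarith
  have hA0 : 0 < A := lt_trans (mul_pos hm0 (sub_pos.2 hzR)) hAm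
  set s : ℝ := A / (p * (zH - zL)) with hs'
  have hden : 0 < p * ((zH : ℝ) - zL) := mul_pos hp0 (sub_pos.2 hzR)
  have hs0 : 0 < s := div_pos hA0 hden
  have hsA : s * (p * (zH - zL)) = A := div_mul_cancel₀ _ hden.ne'
  have hsp : m < s * p := by
    refine lt_of_mul_lt_mul_right (a := (zH : ℝ) - zL) ?_ (sub_pos.2 hzR).le
    calc m * ((zH : ℝ) - zL) < A := hAm
      _ = s * p * (zH - zL) := by rw [← hsA]; ring
  -- A fraction `t` of the left arm leaves the high pool and a fraction `r` of the low component
  -- replaces it. The ratio `r = s * t` keeps the high mean at `zH`, and dividing by `1 + s` makes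
  -- both fractions at most one. Since `s * p > m`, the high pool gains mass, which contradicts
  -- optimality.
  set t : NNReal := ⟨1 / (1 + s), by positivity⟩ with ht
  set r : NNReal := ⟨s / (1 + s), by positivity⟩ with hr
  have htR : (t : ℝ) = 1 / (1 + s) := rfl
  have hrR : (r : ℝ) = s * t := by rw [htR]; change s / (1 + s) = _; ring
  have ht0 : (0 : ℝ) < t := by rw [htR]; positivity
  have ht1 : t ≤ 1 := by
    rw [← NNReal.coe_le_coe, htR, NNReal.coe_one, div_le_one (by positivity)]; linarith
  have hr1 : r ≤ 1 := by
    rw [← NNReal.coe_le_coe, NNReal.coe_one]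
    change s / (1 + s) ≤ 1
    rw [div_le_one (by positivity)]; linarith
  have htc : ((1 - t : NNReal) : ℝ) = 1 - t := by rw [NNReal.coe_sub ht1]; rfl
  have hrc : ((1 - r : NNReal) : ℝ) = 1 - r := by rw [NNReal.coe_sub hr1]; rfl
  set F := E.prior with hF
  set νH := F.restrict (Set.Ioc d b) + (1 - t) • F.restrict (Set.Ioc a c) +
    r • F.restrict (Set.Ioc c d) with hνH
  -- Up to `b` the prior is pooled afresh and `G` is kept only above `b`, so the low pool also takes
  -- all the states up to `a`.
  set νL := F.restrict (Set.Iic a) + t • F.restrict (Set.Ioc a c) +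
    (1 - r) • F.restrict (Set.Ioc c d) with hνL
  have hsum : G.restrict (Set.Ioi b) + νL + νH = G.restrict (Set.Ioi b) + F.restrict (Set.Iic b) := by
    have h1 : (1 - t) • F.restrict (Set.Ioc a c) + t • F.restrict (Set.Ioc a c) =
        F.restrict (Set.Ioc a c) := by
      rw [← add_smul, tsub_add_cancel_of_le ht1, one_smul]
    have h2 : (1 - r) • F.restrict (Set.Ioc c d) + r • F.restrict (Set.Ioc c d) =
        F.restrict (Set.Ioc c d) := by
      rw [← add_smul, tsub_add_cancel_of_le hr1, one_smul]
    have h3 : F.restrict (Set.Iic b) = F.restrict (Set.Iic a) + F.restrict (Set.Ioc a c) +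
        F.restrict (Set.Ioc c d) + F.restrict (Set.Ioc d b) := by
      rw [← Measure.restrict_union (Set.Iic_disjoint_Ioc le_rfl) measurableSet_Ioc,
        Set.Iic_union_Ioc_eq_Iic hac.le,
        ← Measure.restrict_union (Set.Iic_disjoint_Ioc le_rfl) measurableSet_Ioc,
        Set.Iic_union_Ioc_eq_Iic h.lt.le,
        ← Measure.restrict_union (Set.Iic_disjoint_Ioc le_rfl) measurableSet_Ioc,
        Set.Iic_union_Ioc_eq_Iic h.lt_right.le]
    rw [add_assoc, h3, ← h1, ← h2, hνH, hνL]
    congr 1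
    abel
  have hcx : CxLE (G.restrict (Set.Ioi b) + νL + νH) F := by
    rw [hsum]
    have := (hJ.cxLE_Ioi hle hvb).add (CxLE.refl (F.restrict (Set.Iic b)))
    rwa [add_comm (F.restrict (Set.Ioi b)), ← Measure.restrict_union
      (Set.Iic_disjoint_Ioi le_rfl) measurableSet_Ioi,
      Set.Iic_union_Ioi, Measure.restrict_univ] at this
  have key := hG.pool_le hcx
  set k := F.real (Set.Iic a) with hk
  have hGk : G.real (Set.Iic a) = k := by
    rw [measureReal_def, hJ.mass_eq measurableSet_Iic (saturated_Iic hva), ← measureReal_def]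
  -- Here `0 < a` matters: `G` has mass up to `a`, and this will place the cutoff of the lowest
  -- recommended action at or below `a`, so that the states of the left arm keep the low pool
  -- obedient.
  have hk0 : 0 < k := by
    have : 0 < F.real (Set.Icc 0 a) := measureReal_Icc_pos ha
    rwa [show Set.Icc (0 : unitInterval) a = Set.Iic a from Set.Icc_bot] at this
  have hνHm : νH.real Set.univ = m' + (1 - t) * m + r * p := by
    rw [hνH, measureReal_add_apply, measureReal_add_apply, measureReal_nnreal_smul_apply,
      measureReal_nnreal_smul_apply, rac, rcd, rdb, htc]
    simp [hm', hm, hmL]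
  have hνLm : νL.real Set.univ = k + t * m + (1 - r) * p := by
    rw [hνL, measureReal_add_apply, measureReal_add_apply, measureReal_nnreal_smul_apply,
      measureReal_nnreal_smul_apply, rac, rcd, hrc]
    simp [hk, hm, hmL]
  have hνHi : ∫ x, (x : ℝ) ∂νH = μ' + (1 - t) * μ + r * (p * zL) := by
    rw [hνH, integral_add_measure integrable_coe integrable_coe,
      integral_add_measure integrable_coe integrable_coe, integral_smul_nnreal_measure,
      integral_smul_nnreal_measure, rac, rcd, rdb, hμL, ← htc]
    rfl
  have hνLi : ∫ x, (x : ℝ) ∂νL = ∫ x in Set.Iic a, (x : ℝ) ∂F + t * μ + (1 - r) * (p * zL) := by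
    rw [hνL, integral_add_measure integrable_coe integrable_coe,
      integral_add_measure integrable_coe integrable_coe, integral_smul_nnreal_measure,
      integral_smul_nnreal_measure, rac, rcd, hμL, ← hrc]
    rfl
  have hr0 : (0 : ℝ) ≤ r := r.2
  have hr1R : (r : ℝ) ≤ 1 := by exact_mod_cast hr1
  have ht1R : (t : ℝ) ≤ 1 := by exact_mod_cast ht1
  have hHpos : 0 < νH.real Set.univ := by
    rw [hνHm]
    have hm'0 : 0 < m' := measureReal_Icc_pos h.lt_right
    have : 0 ≤ (1 - (t : ℝ)) * m := mul_nonneg (by linarith) hm0.le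
    have : 0 ≤ (r : ℝ) * p := mul_nonneg hr0 hp0.le
    linarith
  have hLpos : 0 < νL.real Set.univ := by
    rw [hνLm]
    have : 0 ≤ (t : ℝ) * m := by positivity
    have : 0 ≤ (1 - (r : ℝ)) * p := mul_nonneg (by linarith) hp0.le
    linarith
  have huH : E.v (E.top zH) ≤ E.u (bary νH) := by
    refine E.u_ge ((E.γ_top_le zH).trans (le_bary hHpos ?_))
    rw [hνHm, hνHi, hrR]
    have h1 : (t : ℝ) * (s * (p * (zH - zL))) = t * A := by rw [hsA]
    have h2 : q * (zH : ℝ) = (m + m') * zH := by rw [hmq]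
    rw [hA] at h1
    exact le_of_eq (by linear_combination h1 - h2 - hμq)
  -- the lowest action stays obedient
  have hcut : E.γ (E.top zL) ≤ a := by
    by_contra hcon
    have h0 : G (Set.Iic a) = 0 := by
      refine measure_eq_zero_iff_ae_notMem.2 ?_
      filter_upwards [hj.ae_le] with x hx hxa
      exact hcon ((E.le_top_iff.1 hx).trans hxa)
    rw [measureReal_def, h0] at hGk
    exact hk0.ne hGk
  have huL : E.v (E.top zL) ≤ E.u (bary νL) := by
    refine E.u_ge (le_bary hLpos ?_)
    have h1 : k * (E.γ (E.top zL) : ℝ) ≤ ∫ x in Set.Iic a, (x : ℝ) ∂F := by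
      have : 0 ≤ ∫ x in Set.Iic a, ((x : ℝ) - E.γ (E.top zL)) ∂G := by
        refine integral_nonneg_of_ae (ae_restrict_of_ae ?_)
        filter_upwards [hj.ae_le] with x hx
        exact sub_nonneg.2 (Subtype.coe_le_coe.2 (E.le_top_iff.1 hx))
      rw [setIntegral_sub_const, hJ.mean_eq measurableSet_Iic (saturated_Iic hva), hGk] at this
      linarith
    have h2 : m * (E.γ (E.top zL) : ℝ) ≤ μ := le_setIntegral_coe measurableSet_Icc
      fun x hx => Subtype.coe_le_coe.2 (hcut.trans hx.1)
    have h3 : (E.γ (E.top zL) : ℝ) ≤ zL := E.γ_top_le zL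
    have h4 : (1 - (r : ℝ)) * p * (E.γ (E.top zL) : ℝ) ≤ (1 - r) * p * zL :=
      mul_le_mul_of_nonneg_left h3 (mul_nonneg (by linarith) hp0.le)
    have h5 := mul_le_mul_of_nonneg_left h2 ht0.le
    rw [hνLm, hνLi]
    linarith
  -- the payoff of `G`
  have hGu : ∫ x, E.u x ∂G ≤ ∫ x in Set.Ioi b, E.u x ∂G +
      (k * E.v (E.top zL) + (p * E.v (E.top zL) + q * E.v (E.top zH))) := by
    have e1 := integral_add_compl (μ := G) (measurableSet_Ioi (a := b)) (E.integrable_u G)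
    have hIic : G.restrict (Set.Ioi b)ᶜ = G.restrict (Set.Iic a) + G.restrict (Set.Ioo a b) := by
      rw [← Measure.restrict_union (show Disjoint (Set.Iic a) (Set.Ioo a b) from
        Set.disjoint_left.2 fun x hx hx' => absurd hx'.1 (not_lt.2 hx)) measurableSet_Ioo, Set.Iic_union_Ioo_eq_Iio hb.lt, Set.compl_Ioi]
      refine (Measure.restrict_congr_set (Filter.eventuallyEq_set.2 ?_)).symm
      filter_upwards [measure_eq_zero_iff_ae_notMem.1 (hJ.singleton_eq_zero hvb)] with x hx
      exact ⟨fun h => show x ≤ b from le_of_lt h, fun h => lt_of_le_of_ne h hx⟩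
    rw [hIic, integral_add_measure (E.integrable_u _) (E.integrable_u _),
      hb.setIntegral_pair hz hs (E.integrable_u G), E.u_eq zL, E.u_eq zH] at e1
    have h1 : ∫ x in Set.Iic a, E.u x ∂G ≤ k * E.v (E.top zL) := by
      calc ∫ x in Set.Iic a, E.u x ∂G ≤ ∫ _ in Set.Iic a, E.v (E.top zL) ∂G := by
            refine setIntegral_mono_on (E.integrable_u G).integrableOn
              (integrable_const _).integrableOn measurableSet_Iic fun x hx => ?_
            rw [E.u_eq]
            exact E.v_strictMono.monotone (E.top_mono (hx.trans hzLb.1.le))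
        _ = k * E.v (E.top zL) := by rw [setIntegral_const, smul_eq_mul, hGk]
    linarith
  have h1 := mul_le_mul_of_nonneg_left huH hHpos.le
  have h2 := mul_le_mul_of_nonneg_left huL hLpos.le
  rw [hνHm] at h1 key
  rw [hνLm] at h2 key
  have h3 : (t : ℝ) * m < r * p := by
    rw [hrR]
    have := mul_lt_mul_of_pos_left hsp ht0
    linarith
  have h4 := mul_lt_mul_of_pos_left hvlt (sub_pos.2 h3)
  have h5 : q * E.v (E.top zH) = (m + m') * E.v (E.top zH) := by rw [hmq]
  linarith


variable {n : ℕ} [NeZero n] {E : Environment n} {G : Measure unitInterval}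
  {J : Set (unitInterval × unitInterval)}

/-! ### Assignments of states to actions -/

/-- The set of states `S i` is assigned to the action `a_i`, consistently with `G`. -/
structure IsAssignment (E : Environment n) (G : Measure unitInterval)
    (S : Fin n → Set unitInterval) : Prop where
  measurable : ∀ i, MeasurableSet (S i)
  null : ∀ i k, i ≠ k → E.prior (S i ∩ S k) = 0
  mass : ∀ i, E.prior (S i) = G (E.recommending i)
  mean : ∀ i, ∫ x in S i, (x : ℝ) ∂E.prior = ∫ x in E.recommending i, (x : ℝ) ∂G

theorem preimage_top (E : Environment n) (A : Set (Fin n)) :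
    E.top ⁻¹' A = ⋃ i : A, E.recommending i := by
  ext x
  simp only [Set.mem_preimage, Set.mem_iUnion, E.mem_recommending]
  exact ⟨fun h => ⟨⟨_, h⟩, rfl⟩, fun ⟨i, hi⟩ => hi ▸ i.2⟩

theorem pairwise_disjoint_recommending (E : Environment n) {i k : Fin n} (h : i ≠ k) :
    Disjoint (E.recommending i) (E.recommending k) :=
  Set.disjoint_left.2 fun _ hx hx' =>
    h ((E.mem_recommending.1 hx).symm.trans (E.mem_recommending.1 hx'))

theorem IsAssignment.measure_iUnion {S : Fin n → Set unitInterval} (hS : E.IsAssignment G S)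
    (A : Set (Fin n)) : E.prior (⋃ i : A, S i) = G (E.top ⁻¹' A) := by
  rw [E.preimage_top, measure_iUnion₀ (f := fun i : A => S i) (fun i k h => hS.null i k fun h' => h (Subtype.ext h'))
    (fun i => (hS.measurable i).nullMeasurableSet),
    MeasureTheory.measure_iUnion (fun i k h => E.pairwise_disjoint_recommending
      fun h' => h (Subtype.ext h')) fun i => E.measurableSet_recommending i]
  exact tsum_congr fun i => hS.mass i

theorem IsAssignment.setIntegral_iUnion [IsFiniteMeasure G] {S : Fin n → Set unitInterval}
    (hS : E.IsAssignment G S) (A : Set (Fin n)) :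
    ∫ x in ⋃ i : A, S i, (x : ℝ) ∂E.prior = ∫ x in E.top ⁻¹' A, (x : ℝ) ∂G := by
  rw [E.preimage_top, integral_iUnion_ae (s := fun i : A => S i) (fun i => (hS.measurable i).nullMeasurableSet)
    (fun i k h => hS.null i k fun h' => h (Subtype.ext h')) integrable_coe.integrableOn,
    integral_iUnion (s := fun i : A => E.recommending i) (fun i => E.measurableSet_recommending i)
      (fun i k h => E.pairwise_disjoint_recommending fun h' => h (Subtype.ext h'))
      integrable_coe.integrableOn]
  exact tsum_congr fun i => hS.mean i

theorem IsAssignment.measurableSet_iUnion {S : Fin n → Set unitInterval}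
    (hS : E.IsAssignment G S) (A : Set (Fin n)) : MeasurableSet (⋃ i : A, S i) :=
  .iUnion fun i => hS.measurable i

/-- States outside `Ioi e` are at most `e` and states inside exceed it, so `e` separates the
differences of any set from `Ioi e`. -/
theorem IsAssignment.ae_eq_Ioi_of_eq [IsFiniteMeasure G] {S : Fin n → Set unitInterval}
    (hS : E.IsAssignment G S) {A : Set (Fin n)} {e : unitInterval}
    (hm : G (E.top ⁻¹' A) = E.prior (Set.Ioi e))
    (hi : ∫ x in E.top ⁻¹' A, (x : ℝ) ∂G = ∫ x in Set.Ioi e, (x : ℝ) ∂E.prior) :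
    (⋃ i : A, S i) =ᵐ[E.prior] Set.Ioi e :=
  ae_eq_of_threshold (hS.measurableSet_iUnion A) measurableSet_Ioi
    ((hS.measure_iUnion A).trans hm) ((hS.setIntegral_iUnion A).trans hi) e
    (.of_forall fun _ _ hx => not_lt.1 hx) (.of_forall fun _ hx _ => le_of_lt hx)

theorem IsAssignment.ae_eq_Ioi [IsFiniteMeasure G] {S : Fin n → Set unitInterval}
    (hS : E.IsAssignment G S) (hJ : E.IsBiPoolingFamily G J) {A : Set (Fin n)} {e : unitInterval}
    (he : e ∈ offSet J) (h : E.top ⁻¹' A =ᵐ[G] Set.Ioi e) :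
    (⋃ i : A, S i) =ᵐ[E.prior] Set.Ioi e :=
  hS.ae_eq_Ioi_of_eq
    ((measure_congr h).trans (hJ.mass_eq measurableSet_Ioi (saturated_Ioi he)))
    ((congrArg (fun μ => ∫ x : unitInterval, (x : ℝ) ∂μ) (Measure.restrict_congr_set h)).trans
      (hJ.mean_eq measurableSet_Ioi (saturated_Ioi he)))

/-! ### Blocks that recommend two actions -/

/-- A block of `G` whose two signals recommend different actions. -/
structure IsTwoActionBlock (E : Environment n) (G : Measure unitInterval)
    (J : Set (unitInterval × unitInterval)) (a b zL zH : unitInterval) : Prop where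
  mem : (a, b) ∈ J
  signals_lt : zL < zH
  supp_eq : supp G a b = {zL, zH}
  ne : E.top zL ≠ E.top zH

section TwoActions

variable {a b zL zH : unitInterval}

theorem IsTwoActionBlock.lt (h : E.IsTwoActionBlock G J a b zL zH) : E.top zL < E.top zH :=
  lt_of_le_of_ne (E.top_mono h.signals_lt.le) h.ne

theorem IsTwoActionBlock.mem_low (h : E.IsTwoActionBlock G J a b zL zH)
    (hJ : E.IsBiPoolingFamily G J) : zL ∈ Set.Ioo a b :=
  (hJ.block _ h.mem).supp_subset (by simp [h.supp_eq])

theorem IsTwoActionBlock.mem_high (h : E.IsTwoActionBlock G J a b zL zH)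
    (hJ : E.IsBiPoolingFamily G J) : zH ∈ Set.Ioo a b :=
  (hJ.block _ h.mem).supp_subset (by simp [h.supp_eq])

theorem IsTwoActionBlock.low_ne_zero (h : E.IsTwoActionBlock G J a b zL zH)
    (hJ : E.IsBiPoolingFamily G J) : G {zL} ≠ 0 :=
  (hJ.block _ h.mem).singleton_ne_zero (by simp [h.supp_eq])

theorem IsTwoActionBlock.high_ne_zero (h : E.IsTwoActionBlock G J a b zL zH)
    (hJ : E.IsBiPoolingFamily G J) : G {zH} ≠ 0 :=
  (hJ.block _ h.mem).singleton_ne_zero (by simp [h.supp_eq])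

theorem IsTwoActionBlock.ae_eq_or (h : E.IsTwoActionBlock G J a b zL zH) :
    ∀ᵐ x ∂G, x ∈ Set.Ioo a b → x = zL ∨ x = zH := by
  filter_upwards [ae_mem_supp G a b] with x hx hxI
  have := hx hxI
  rwa [h.supp_eq] at this

variable {j : Fin n}

theorem IsTwoActionBlock.le_low (h : E.IsTwoActionBlock G J a b zL zH)
    (hJ : E.IsBiPoolingFamily G J) (hj : E.IsLowestRecommended G j) : j ≤ E.top zL :=
  hj.le_of_singleton (h.low_ne_zero hJ)

theorem IsTwoActionBlock.high_eq (h : E.IsTwoActionBlock G J a b zL zH)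
    (hG : E.IsOptimalSignal G) (hJ : E.IsBiPoolingFamily G J)
    (hj : E.IsLowestRecommended G j) : zH = E.γ (E.top zH) :=
  hG.eq_cutoff_of_singleton hj (h.high_ne_zero hJ) ((h.le_low hJ hj).trans_lt h.lt)

/-- The block has no signal above `zH`, so an action higher than that of `zH` needs a signal beyond
`b`. Conversely, `zH` is the cutoff of its action, the only signal at which this action is
recommended, so signals beyond `b` recommend higher ones. -/
theorem IsTwoActionBlock.above (h : E.IsTwoActionBlock G J a b zL zH)
    (hG : E.IsOptimalSignal G) (hJ : E.IsBiPoolingFamily G J)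
    (hj : E.IsLowestRecommended G j) :
    E.top ⁻¹' Set.Ioi (E.top zH) =ᵐ[G] Set.Ioi b := by
  have hHb := h.mem_high hJ
  refine Filter.eventuallyEq_set.2 ?_
  filter_upwards [h.ae_eq_or, hG.ae_eq_cutoff hj.1 ((h.le_low hJ hj).trans_lt h.lt),
    measure_eq_zero_iff_ae_notMem.1 (hJ.singleton_eq_zero (hJ.right_mem_offSet h.mem))]
    with x h1 h2 h3
  constructor
  · intro (hx : E.top zH < E.top x)
    by_contra hxb
    have hxz : zH < x := lt_of_not_ge fun hle => (E.top_mono hle).not_gt hx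
    have hxb' : x < b := lt_of_le_of_ne (not_lt.1 hxb) h3
    rcases h1 ⟨hHb.1.trans hxz, hxb'⟩ with rfl | rfl
    · exact hxz.not_gt h.signals_lt
    · exact lt_irrefl _ hxz
  · intro (hx : b < x)
    refine lt_of_le_of_ne (E.top_mono (hHb.2.trans hx).le) fun heq => ?_
    have := h2 heq.symm
    rw [← h.high_eq hG hJ hj] at this
    exact (hHb.2.trans hx).ne this.symm

theorem IsTwoActionBlock.from (h : E.IsTwoActionBlock G J a b zL zH)
    (hG : E.IsOptimalSignal G) (hJ : E.IsBiPoolingFamily G J)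
    (hj : E.IsLowestRecommended G j) (hjL : j < E.top zL) :
    E.top ⁻¹' Set.Ici (E.top zL) =ᵐ[G] Set.Ioi a := by
  have hLb := h.mem_low hJ
  have hzL : zL = E.γ (E.top zL) := hG.eq_cutoff_of_singleton hj (h.low_ne_zero hJ) hjL
  refine Filter.eventuallyEq_set.2 ?_
  filter_upwards [h.ae_eq_or, hG.ae_eq_cutoff hj.1 hjL] with x h1 h2
  constructor
  · intro (hx : E.top zL ≤ E.top x)
    by_contra hxa
    have hxz : x < zL := (not_lt.1 hxa).trans_lt hLb.1
    have := h2 (le_antisymm (E.top_mono hxz.le) hx)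
    rw [← hzL] at this
    exact hxz.ne this
  · intro (hx : a < x)
    refine E.top_mono ?_
    rcases lt_or_ge x b with hxb | hxb
    · rcases h1 ⟨hx, hxb⟩ with rfl | rfl
      · exact le_rfl
      · exact h.signals_lt.le
    · exact hLb.2.le.trans hxb

/-- A signal recommending such an action would lie strictly between `zL` and `zH`, inside the block.
-/
theorem IsTwoActionBlock.between (h : E.IsTwoActionBlock G J a b zL zH)
    (hJ : E.IsBiPoolingFamily G J) {k : Fin n} (h1 : E.top zL < k) (h2 : k < E.top zH) :
    G (E.recommending k) = 0 := by
  refine measure_eq_zero_iff_ae_notMem.2 ?_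
  filter_upwards [h.ae_eq_or] with x hx hxk
  rw [E.mem_recommending] at hxk
  subst hxk
  have hLx : zL < x := lt_of_not_ge fun hle => (E.top_mono hle).not_gt h1
  have hxH : x < zH := lt_of_not_ge fun hle => (E.top_mono hle).not_gt h2
  rcases hx ⟨(h.mem_low hJ).1.trans hLx, hxH.trans (h.mem_high hJ).2⟩ with rfl | rfl
  · exact lt_irrefl _ hLx
  · exact lt_irrefl _ hxH

end TwoActions

/-! ### The states to which high actions are assigned -/

/-- The states assigned to `a_i` and all higher actions form an interval up to the highest state,
unless a two-action block separates `a_i` from the next lower action. -/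
theorem exists_threshold [IsProbabilityMeasure G] (hG : E.IsOptimalSignal G)
    (hJ : E.IsBiPoolingFamily G J) {i j : Fin n} (hj : E.IsLowestRecommended G j) :
    (∃ e, ∀ S, E.IsAssignment G S → (⋃ k : Set.Ici i, S k) =ᵐ[E.prior] Set.Ioi e) ∨
    ∃ a b zL zH, E.IsTwoActionBlock G J a b zL zH ∧ E.top zL < i ∧ i ≤ E.top zH ∧
      (a = 0 ∨ j < E.top zL) := by
  have hle : CxLE G E.prior := ((E.isMPC_iff G).1 hG.1).2
  have htop : E.top ⁻¹' Set.Ici i = Set.Ici (E.γ i) := Set.ext fun x => E.le_top_iff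
  -- Off the blocks the threshold is `γ i` itself. If `γ i` is interior to a block with all signals
  -- on one side of it, the threshold is an end point of the block.
  by_cases hoff : E.γ i ∈ offSet J
  · refine .inl ⟨E.γ i, fun S hS => hS.ae_eq_Ioi hJ hoff ?_⟩
    rw [htop]
    refine Filter.eventuallyEq_set.2 ?_
    filter_upwards [measure_eq_zero_iff_ae_notMem.1 (hJ.singleton_eq_zero hoff)] with x hx
    exact ⟨fun h => lt_of_le_of_ne h (Ne.symm hx), fun h => show E.γ i ≤ x from le_of_lt h⟩
  rw [mem_offSet] at hoff
  push Not at hoff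
  obtain ⟨⟨a, b⟩, hI, hγ⟩ := hoff
  simp only at hγ
  have hb := hJ.block _ hI
  have hva := hJ.left_mem_offSet hI
  have hvb := hJ.right_mem_offSet hI
  by_cases hge : ∀ z ∈ supp G a b, E.γ i ≤ z
  · refine .inl ⟨a, fun S hS => hS.ae_eq_Ioi hJ hva ?_⟩
    rw [htop]
    refine Filter.eventuallyEq_set.2 ?_
    filter_upwards [ae_mem_supp G a b] with x hx
    refine ⟨fun h => hγ.1.trans_le h, fun h => ?_⟩
    rcases lt_or_ge x b with hxb | hxb
    · exact hge x (hx ⟨h, hxb⟩)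
    · exact hγ.2.le.trans hxb
  by_cases hlt : ∀ z ∈ supp G a b, z < E.γ i
  · refine .inl ⟨b, fun S hS => hS.ae_eq_Ioi hJ hvb ?_⟩
    rw [htop]
    refine Filter.eventuallyEq_set.2 ?_
    filter_upwards [ae_mem_supp G a b,
      measure_eq_zero_iff_ae_notMem.1 (hJ.singleton_eq_zero hvb)] with x hx hxb
    refine ⟨fun h => ?_, fun h => hγ.2.le.trans (le_of_lt h)⟩
    by_contra hcon
    exact (hlt x (hx ⟨hγ.1.trans_le h, lt_of_le_of_ne (not_lt.1 hcon) hxb⟩)).not_ge h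
  push Not at hge hlt
  obtain ⟨z, hz, hzlt⟩ := hge
  obtain ⟨z', hz', hzge⟩ := hlt
  rcases hb.supp_eq with ⟨w, hw⟩ | ⟨zL, zH, hLH, hs⟩
  · simp only [hw, Set.mem_singleton_iff] at hz hz'
    subst hz hz'
    exact absurd hzge (not_le.2 hzlt)
  have hzL : zL < E.γ i := by
    rcases (by simpa [hs] using hz : z = zL ∨ z = zH) with rfl | rfl
    · exact hzlt
    · exact hLH.trans hzlt
  have hzH : E.γ i ≤ zH := by
    rcases (by simpa [hs] using hz' : z' = zL ∨ z' = zH) with rfl | rfl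
    · exact hzge.trans hLH.le
    · exact hzge
  have hLi : E.top zL < i := lt_of_not_ge fun h => (E.le_top_iff.1 h).not_gt hzL
  have hiH : i ≤ E.top zH := E.le_top_iff.2 hzH
  have htwo : E.IsTwoActionBlock G J a b zL zH := ⟨hI, hLH, hs, (hLi.trans_le hiH).ne⟩
  by_cases hcase : a = 0 ∨ j < E.top zL
  · exact .inr ⟨a, b, zL, zH, htwo, hLi, hiH, hcase⟩
  push Not at hcase
  have hjL : E.top zL = j := le_antisymm hcase.2 (htwo.le_low hJ hj)
  obtain ⟨c, d, hcd⟩ := hJ.exists_isSplit hle hI hLH hs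
  simp only at hcd
  have hca : c = a := hcd.left_eq hG hJ hI hs hLH (hjL ▸ hj) htwo.ne
    (lt_of_le_of_ne unitInterval.nonneg' (Ne.symm hcase.1))
  left
  -- Since `c = a`, the high component is `[d, b]` up to a null set. The actions from `a_i` up
  -- therefore have the mass and mean of `(d, b]` together with everything above `b`.
  refine ⟨d, fun S hS => ?_⟩
  have hset : E.top ⁻¹' Set.Ici i =ᵐ[G] ({zH} ∪ Set.Ioi b : Set unitInterval) := by
    rw [htop]
    refine Filter.eventuallyEq_set.2 ?_
    filter_upwards [htwo.ae_eq_or,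
      measure_eq_zero_iff_ae_notMem.1 (hJ.singleton_eq_zero hvb)] with x hx hxb
    constructor
    · intro (h : E.γ i ≤ x)
      rcases lt_or_gt_of_ne (show x ≠ b from hxb) with h' | h'
      · rcases hx ⟨hγ.1.trans_le h, h'⟩ with rfl | rfl
        · exact absurd h (not_le.2 hzL)
        · exact .inl rfl
      · exact .inr h'
    · rintro (rfl | h)
      · exact hzH
      · exact hγ.2.le.trans (le_of_lt h)
  have hdis : Disjoint ({zH} : Set unitInterval) (Set.Ioi b) := by
    rw [Set.disjoint_singleton_left]
    exact fun h => (htwo.mem_high hJ).2.not_gt h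
  have hBH : (Set.Icc a c ∪ Set.Icc d b : Set unitInterval) =ᵐ[E.prior] Set.Ioc d b := by
    rw [hca, Set.Icc_self]
    have h1 : ({a} : Set unitInterval) =ᵐ[E.prior] (∅ : Set unitInterval) :=
      ae_eq_empty.2 (measure_singleton a)
    simpa using h1.union (Ioc_ae_eq_Icc (μ := E.prior) (a := d) (b := b)).symm
  have hIoi : Set.Ioi d = Set.Ioc d b ∪ Set.Ioi b := (Set.Ioc_union_Ioi_eq_Ioi hcd.lt_right.le).symm
  have hdis' : Disjoint (Set.Ioc d b) (Set.Ioi b) :=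
    Set.disjoint_left.2 fun x hx hx' => absurd hx.2 (not_le.2 hx')
  refine hS.ae_eq_Ioi_of_eq ?_ ?_
  · rw [measure_congr hset, measure_union hdis measurableSet_Ioi, hIoi,
      measure_union hdis' measurableSet_Ioi, ← measure_congr hBH, hcd.mass_high,
      hJ.mass_eq measurableSet_Ioi (saturated_Ioi hvb)]
  · rw [Measure.restrict_congr_set hset, setIntegral_union hdis measurableSet_Ioi
      integrable_coe.integrableOn integrable_coe.integrableOn, hIoi,
      setIntegral_union hdis' measurableSet_Ioi
      integrable_coe.integrableOn integrable_coe.integrableOn, ← Measure.restrict_congr_set hBH,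
      hcd.mean_high, hJ.mean_eq measurableSet_Ioi (saturated_Ioi hvb), integral_singleton,
      smul_eq_mul]

/-! ### Deterministic representations are assignments -/

variable {B : Fin n → Set unitInterval}

/-- A set with nonempty interior has positive prior mass; with `hs`, being skipped becomes a
property of `G` alone. -/
theorem not_isSkipped_iff_of_prob {i : Fin n} (hp : E.prior (B i) = G (E.recommending i))
    (hs : IsSkipped (B i) → E.prior (B i) = 0) : ¬ IsSkipped (B i) ↔ G (E.recommending i) ≠ 0 := by
  rw [← hp]
  refine ⟨fun h h0 => h ?_, fun h h' => h (hs h')⟩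
  by_contra hne
  exact (isOpen_interior.measure_pos E.prior (Set.nonempty_iff_ne_empty.2 hne)).ne'
    (measure_mono_null interior_subset h0)

theorem IsDeterministicRep.not_isSkipped_iff (hB : E.IsDeterministicRep G B) {i : Fin n} :
    ¬ IsSkipped (B i) ↔ G (E.recommending i) ≠ 0 :=
  not_isSkipped_iff_of_prob (hB.prob i) (hB.skipped_null i)

theorem IsDeterministicRep.isLowest_iff (hB : E.IsDeterministicRep G B) {j : Fin n} :
    IsLowest B j ↔ E.IsLowestRecommended G j := by
  rw [IsLowest, IsLowestRecommended]
  simp only [hB.not_isSkipped_iff]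

theorem setIntegral_eq_condMean (E : Environment n) (S : Set unitInterval) :
    ∫ x in S, (x : ℝ) ∂E.prior = E.prior.real S * E.condMean S := by
  by_cases h : E.prior S = 0
  · rw [Measure.restrict_zero_set h, measureReal_def, h]; simp
  · rw [condMean, setAverage_eq, smul_eq_mul, mul_inv_cancel_left₀]
    exact (ENNReal.toReal_pos h (measure_ne_top _ _)).ne'

theorem iUnion_recommending (E : Environment n) : (⋃ i, E.recommending i) = Set.univ :=
  Set.eq_univ_of_forall fun _ => Set.mem_iUnion.2 ⟨_, E.mem_recommending.2 rfl⟩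

/-- For a partition of the states, consistency with `G` has to be checked for all actions but
one. -/
theorem isAssignment_of_forall_ne [IsProbabilityMeasure G] {S : Fin n → Set unitInterval}
    (hle : CxLE G E.prior) (hm : ∀ i, MeasurableSet (S i))
    (hnull : ∀ i k, i ≠ k → E.prior (S i ∩ S k) = 0) (hcover : ⋃ i, S i = Set.univ) (j : Fin n)
    (hmass : ∀ i, i ≠ j → E.prior (S i) = G (E.recommending i))
    (hmean : ∀ i, i ≠ j →
      ∫ x in S i, (x : ℝ) ∂E.prior = ∫ x in E.recommending i, (x : ℝ) ∂G) :
    E.IsAssignment G S := by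
  -- The pieces have the same total on both sides, so the remaining one agrees by subtraction. It is
  -- applied to `f = 1` for mass and to `f = x` for mean.
  have key : ∀ f : unitInterval → ℝ, Continuous f → ∫ x, f x ∂G = ∫ x, f x ∂E.prior →
      (∀ i, i ≠ j → ∫ x in S i, f x ∂E.prior = ∫ x in E.recommending i, f x ∂G) →
      ∫ x in S j, f x ∂E.prior = ∫ x in E.recommending j, f x ∂G := by
    intro f hf hfe hfi
    have h1 := integral_iUnion_ae (μ := E.prior) (s := S) (f := f)
      (fun i => (hm i).nullMeasurableSet) (fun i k h => hnull i k h)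
      (integrable_of_continuous hf).integrableOn
    have h2 := integral_iUnion (μ := G) (s := E.recommending) (f := f)
      E.measurableSet_recommending (fun i k h => E.pairwise_disjoint_recommending h)
      (integrable_of_continuous hf).integrableOn
    rw [hcover, setIntegral_univ, tsum_fintype] at h1
    rw [E.iUnion_recommending, setIntegral_univ, tsum_fintype, hfe, h1,
      ← Finset.add_sum_erase _ _ (Finset.mem_univ j),
      ← Finset.add_sum_erase _ _ (Finset.mem_univ j),
      Finset.sum_congr rfl fun k hk => hfi k (Finset.ne_of_mem_erase hk)] at h2
    exact add_right_cancel h2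
  refine ⟨hm, hnull, fun i => ?_, fun i => ?_⟩
  · by_cases hi : i = j
    · subst hi
      have := key (fun _ => 1) continuous_const (by simp) fun k hk => by
        simp [measureReal_def, hmass k hk]
      simp only [setIntegral_const, smul_eq_mul, mul_one] at this
      exact (measureReal_eq_measureReal_iff (measure_ne_top _ _) (measure_ne_top _ _)).1 this
    · exact hmass i hi
  · by_cases hi : i = j
    · subst hi
      exact key _ continuous_subtype_val hle.mean hmean
    · exact hmean i hi

theorem IsOptimalSignal.setIntegral_recommending [IsFiniteMeasure G] (hG : E.IsOptimalSignal G)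
    {i j : Fin n} (hj : E.IsLowestRecommended G j) (hji : j < i) :
    ∫ x in E.recommending i, (x : ℝ) ∂G = G.real (E.recommending i) * E.γ i := by
  rw [setIntegral_congr_ae (g := fun _ => (E.γ i : ℝ)) (E.measurableSet_recommending i)]
  · simp
  · filter_upwards [hG.ae_eq_cutoff hj.1 hji] with x hx hxi
    rw [← hx (E.mem_recommending.1 hxi)]

/-- Above the lowest recommended action both sides have conditional mean `γ_i`; an action of
probability zero contributes nothing. The definition only bounds the mean of the lowest set from
below, and the total mean then determines it. -/
theorem IsDeterministicRep.isAssignment [IsProbabilityMeasure G] (hB : E.IsDeterministicRep G B)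
    (hG : E.IsOptimalSignal G) : E.IsAssignment G B := by
  obtain ⟨j, hj⟩ := E.exists_isLowestRecommended G
  refine isAssignment_of_forall_ne ((E.isMPC_iff G).1 hG.1).2
    (fun i => (hB.closed i).measurableSet) hB.null hB.cover j (fun i _ => hB.prob i)
    fun i hi => ?_
  by_cases h0 : G (E.recommending i) = 0
  · rw [Measure.restrict_zero_set h0, Measure.restrict_zero_set ((hB.prob i).trans h0)]
  · have hji : j < i := lt_of_le_of_ne (hj.2 h0) (Ne.symm hi)
    rw [setIntegral_eq_condMean, hB.mean_higher j (hB.isLowest_iff.2 hj) i hji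
      (hB.not_isSkipped_iff.2 h0), measureReal_def, hB.prob i,
      hG.setIntegral_recommending hj hji, measureReal_def]


variable {n : ℕ} [NeZero n] {E : Environment n} {G : Measure unitInterval}
  {J : Set (unitInterval × unitInterval)}

/-! ### Components of blocks -/

theorem null_frontier_Icc (E : Environment n) (a b : unitInterval) :
    E.prior (frontier (Set.Icc a b)) = 0 := by
  refine measure_mono_null (t := {a, b}) (fun x hx => ?_) ((Set.toFinite _).measure_zero _)
  have h1 : x ∈ Set.Icc a b := isClosed_Icc.frontier_subset hx
  have h2 : x ∉ Set.Ioo a b := fun h => hx.2 (interior_maximal Set.Ioo_subset_Icc_self isOpen_Ioo h)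
  rcases h1.1.eq_or_lt with h | h
  · exact .inl h.symm
  · exact .inr (le_antisymm h1.2 (not_lt.1 fun h' => h2 ⟨h, h'⟩))

theorem null_frontier_union {S T : Set unitInterval} (hS : E.prior (frontier S) = 0)
    (hT : E.prior (frontier T) = 0) : E.prior (frontier (S ∪ T)) = 0 :=
  measure_mono_null ((frontier_union_subset S T).trans
    (Set.union_subset_union Set.inter_subset_left Set.inter_subset_right))
    (measure_union_null hS hT)

theorem condMean_eq {S : Set unitInterval} {z : unitInterval} (h0 : G {z} ≠ 0)
    (hm : E.prior S = G {z}) (hi : ∫ x in S, (x : ℝ) ∂E.prior = G.real {z} * z) :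
    E.condMean S = z := by
  have h1 : E.prior.real S ≠ 0 := (ENNReal.toReal_pos (hm ▸ h0) (measure_ne_top _ _)).ne'
  have h2 : G.real {z} = E.prior.real S := by rw [measureReal_def, measureReal_def, hm]
  rw [setIntegral_eq_condMean, h2] at hi
  exact mul_left_cancel₀ h1 hi

theorem IsSplit.union {a b zL zH c d : unitInterval} (h : E.IsSplit G a b zL zH c d) :
    Set.Icc c d ∪ (Set.Icc a c ∪ Set.Icc d b) = Set.Icc a b := by
  rw [← Set.union_assoc, Set.union_comm (Set.Icc c d), Set.Icc_union_Icc_eq_Icc h.le_left h.lt.le,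
    Set.Icc_union_Icc_eq_Icc (h.le_left.trans h.lt.le) h.lt_right.le]

theorem IsSplit.null {a b zL zH c d : unitInterval} :
    E.IsSplit G a b zL zH c d → E.prior (Set.Icc c d ∩ (Set.Icc a c ∪ Set.Icc d b)) = 0 := fun _ =>
  measure_mono_null (t := {c, d}) (fun x hx => by
    rcases hx with ⟨h1, h2 | h2⟩
    · exact .inl (le_antisymm h2.2 h1.1)
    · exact .inr (le_antisymm h1.2 h2.1)) ((Set.toFinite _).measure_zero _)

theorem IsSplit.isNestedIntervals {a b zL zH c d : unitInterval}
    (h : E.IsSplit G a b zL zH c d) (hb : E.IsBlock G a b) (hz : zL < zH)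
    (hs : supp G a b = {zL, zH}) :
    E.IsNestedIntervals G a b zL zH (Set.Icc c d) (Set.Icc a c ∪ Set.Icc d b) :=
  ⟨{ block := hb
     signals_lt := hz
     supp_eq := hs
     closed_low := isClosed_Icc
     closed_high := isClosed_Icc.union isClosed_Icc
     union := h.union
     null := h.null
     mean_low := condMean_eq (hb.singleton_ne_zero (by simp [hs])) h.mass_low h.mean_low
     mean_high := condMean_eq (hb.singleton_ne_zero (by simp [hs])) h.mass_high h.mean_high },
   c, d, h.le_left, h.lt.le, h.lt_right.le, rfl, rfl⟩

/-- `c` and `d` split every block with two signals into nested intervals. -/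
def IsSplitting (E : Environment n) (G : Measure unitInterval)
    (J : Set (unitInterval × unitInterval)) (c d : unitInterval × unitInterval → unitInterval) :
    Prop :=
  ∀ I ∈ J, ∀ zL zH, zL < zH → supp G I.1 I.2 = {zL, zH} →
    E.IsSplit G I.1 I.2 zL zH (c I) (d I)

theorem pair_unique {zL zH wL wH : unitInterval} (hz : zL < zH) (hw : wL < wH)
    (h : ({zL, zH} : Set unitInterval) = {wL, wH}) : zL = wL ∧ zH = wH := by
  rcases Set.pair_eq_pair_iff.1 h with h | ⟨h1, h2⟩
  · exact h
  · rw [h1, h2] at hz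
    exact absurd hz hw.not_gt

open Classical in
/-- The states of the block `I` that are pooled into the signal `z`. -/
def component (G : Measure unitInterval) (c d : unitInterval × unitInterval → unitInterval)
    (I : unitInterval × unitInterval) (z : unitInterval) : Set unitInterval :=
  if supp G I.1 I.2 = {z} then Set.Icc I.1 I.2
  else if IsLeast (supp G I.1 I.2) z then Set.Icc (c I) (d I)
  else Set.Icc I.1 (c I) ∪ Set.Icc (d I) I.2

section Component

variable {c d : unitInterval × unitInterval → unitInterval} {I I' : unitInterval × unitInterval}
  {z z' zL zH : unitInterval}

theorem component_single (h : supp G I.1 I.2 = {z}) : component G c d I z = Set.Icc I.1 I.2 :=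
  if_pos h

theorem pair_ne_singleton (hz : zL < zH) (w : unitInterval) :
    ({zL, zH} : Set unitInterval) ≠ {w} := fun h => by
  have h1 : zL = w := by simpa using h.subset (Set.mem_insert _ _)
  have h2 : zH = w := by simpa using h.subset (Set.mem_insert_of_mem _ rfl)
  exact hz.ne (h1.trans h2.symm)

theorem component_low (hz : zL < zH) (h : supp G I.1 I.2 = {zL, zH}) :
    component G c d I zL = Set.Icc (c I) (d I) := by
  rw [component, if_neg (h ▸ pair_ne_singleton hz zL), if_pos]
  rw [h]
  refine ⟨Set.mem_insert _ _, ?_⟩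
  rintro x (rfl | rfl)
  · exact le_rfl
  · exact hz.le

theorem component_high (hz : zL < zH) (h : supp G I.1 I.2 = {zL, zH}) :
    component G c d I zH = Set.Icc I.1 (c I) ∪ Set.Icc (d I) I.2 := by
  rw [component, if_neg (h ▸ pair_ne_singleton hz zH), if_neg]
  rw [h]
  exact fun hl => (hl.2 (Set.mem_insert _ _)).not_gt hz

/-- Case distinction for the components of a block. -/
theorem component_cases (hJ : E.IsBiPoolingFamily G J) (hcd : E.IsSplitting G J c d) (hI : I ∈ J)
    (hz : z ∈ supp G I.1 I.2) :
    (supp G I.1 I.2 = {z} ∧ component G c d I z = Set.Icc I.1 I.2) ∨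
    (∃ w, z < w ∧ supp G I.1 I.2 = {z, w} ∧ component G c d I z = Set.Icc (c I) (d I) ∧
      E.IsSplit G I.1 I.2 z w (c I) (d I)) ∨
    (∃ w, w < z ∧ supp G I.1 I.2 = {w, z} ∧
      component G c d I z = Set.Icc I.1 (c I) ∪ Set.Icc (d I) I.2 ∧
      E.IsSplit G I.1 I.2 w z (c I) (d I)) := by
  rcases (hJ.block I hI).supp_eq with ⟨w, hw⟩ | ⟨zL, zH, hLH, hs⟩
  · have : z = w := by simpa [hw] using hz
    subst this
    exact .inl ⟨hw, component_single hw⟩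
  · rcases (by simpa [hs] using hz : z = zL ∨ z = zH) with rfl | rfl
    · exact .inr (.inl ⟨zH, hLH, hs, component_low hLH hs, hcd I hI _ _ hLH hs⟩)
    · exact .inr (.inr ⟨zL, hLH, hs, component_high hLH hs, hcd I hI _ _ hLH hs⟩)

theorem isClosed_component : IsClosed (component G c d I z) := by
  unfold component
  split_ifs
  · exact isClosed_Icc
  · exact isClosed_Icc
  · exact isClosed_Icc.union isClosed_Icc

theorem null_frontier_component (E : Environment n) : E.prior (frontier (component G c d I z)) = 0 := by
  unfold component
  split_ifs
  · exact E.null_frontier_Icc _ _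
  · exact E.null_frontier_Icc _ _
  · exact null_frontier_union (E.null_frontier_Icc _ _) (E.null_frontier_Icc _ _)

theorem component_subset (hJ : E.IsBiPoolingFamily G J) (hcd : E.IsSplitting G J c d) (hI : I ∈ J)
    (hz : z ∈ supp G I.1 I.2) : component G c d I z ⊆ Set.Icc I.1 I.2 := by
  rcases component_cases hJ hcd hI hz with ⟨-, h⟩ | ⟨w, -, -, h, hs⟩ | ⟨w, -, -, h, hs⟩
  · exact h.subset
  · rw [h, ← hs.union]; exact Set.subset_union_left
  · rw [h, ← hs.union]; exact Set.subset_union_right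

theorem prior_component (hJ : E.IsBiPoolingFamily G J) (hcd : E.IsSplitting G J c d) (hI : I ∈ J)
    (hz : z ∈ supp G I.1 I.2) : E.prior (component G c d I z) = G {z} := by
  rcases component_cases hJ hcd hI hz with ⟨hs, h⟩ | ⟨w, -, -, h, hs⟩ | ⟨w, -, -, h, hs⟩
  · rw [h, ← measure_congr Ioo_ae_eq_Icc, ← (hJ.block I hI).mass, ← hs,
      ← Measure.restrict_apply_univ, restrict_Ioo_eq G (hJ.block I hI), Measure.restrict_apply_univ]
  · rw [h, hs.mass_low]
  · rw [h, hs.mass_high]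

theorem setIntegral_component (hJ : E.IsBiPoolingFamily G J) (hcd : E.IsSplitting G J c d)
    (hI : I ∈ J) (hz : z ∈ supp G I.1 I.2) :
    ∫ x in component G c d I z, (x : ℝ) ∂E.prior = G.real {z} * z := by
  rcases component_cases hJ hcd hI hz with ⟨hs, h⟩ | ⟨w, -, -, h, hs⟩ | ⟨w, -, -, h, hs⟩
  · rw [h, ← Measure.restrict_congr_set Ioo_ae_eq_Icc, ← (hJ.block I hI).mean,
      restrict_Ioo_eq G (hJ.block I hI), hs, integral_singleton, smul_eq_mul]
  · rw [h, hs.mean_low]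
  · rw [h, hs.mean_high]

theorem condMean_component (hJ : E.IsBiPoolingFamily G J) (hcd : E.IsSplitting G J c d)
    (hI : I ∈ J) (hz : z ∈ supp G I.1 I.2) : E.condMean (component G c d I z) = z :=
  condMean_eq ((hJ.block I hI).singleton_ne_zero hz) (prior_component hJ hcd hI hz)
    (setIntegral_component hJ hcd hI hz)

theorem prior_component_inter (hJ : E.IsBiPoolingFamily G J) (hcd : E.IsSplitting G J c d)
    (hI : I ∈ J) (hI' : I' ∈ J) (hz : z ∈ supp G I.1 I.2) (hz' : z' ∈ supp G I'.1 I'.2)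
    (hne : z ≠ z') : E.prior (component G c d I z ∩ component G c d I' z') = 0 := by
  by_cases h : I = I'
  · subst h
    rcases component_cases hJ hcd hI hz with ⟨hs, h⟩ | ⟨w, hw, hs, h, hsp⟩ | ⟨w, hw, hs, h, hsp⟩
    · rw [hs] at hz'
      exact absurd hz'.symm hne
    · have : z' = w := by simpa [hs, Ne.symm hne] using hz'
      subst this
      rw [h, component_high hw hs]
      exact hsp.null
    · have : z' = w := by simpa [hs, Ne.symm hne] using hz'
      subst this
      rw [h, component_low hw hs, Set.inter_comm]
      exact hsp.null
  · refine measure_mono_null (Set.inter_subset_inter (component_subset hJ hcd hI hz)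
      (component_subset hJ hcd hI' hz')) ?_
    rcases hJ.le_or_le hI hI' h with h | h
    · exact measure_mono_null (fun x hx => le_antisymm hx.1.2 (h.trans hx.2.1))
        (measure_singleton I.2)
    · exact measure_mono_null (fun x hx => le_antisymm hx.2.2 (h.trans hx.1.1))
        (measure_singleton I'.2)

end Component

theorem IsBiPoolingFamily.exists_isSplitting [IsProbabilityMeasure G]
    (hJ : E.IsBiPoolingFamily G J) (hle : CxLE G E.prior) : ∃ c d, E.IsSplitting G J c d := by
  have : ∀ I : unitInterval × unitInterval, ∃ p : unitInterval × unitInterval, I ∈ J →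
      ∀ zL zH, zL < zH → supp G I.1 I.2 = {zL, zH} → E.IsSplit G I.1 I.2 zL zH p.1 p.2 := by
    intro I
    by_cases hI : I ∈ J
    · rcases (hJ.block I hI).supp_eq with ⟨w, hw⟩ | ⟨zL, zH, hLH, hs⟩
      · exact ⟨0, fun _ zL zH h hs => absurd (hs.symm.trans hw) (pair_ne_singleton h w)⟩
      · obtain ⟨c, d, h⟩ := hJ.exists_isSplit hle hI hLH hs
        refine ⟨(c, d), fun _ wL wH hw hs' => ?_⟩
        obtain ⟨rfl, rfl⟩ := pair_unique hLH hw (hs.symm.trans hs')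
        exact h
    · exact ⟨0, fun h => absurd h hI⟩
  choose p hp using this
  exact ⟨fun I => (p I).1, fun I => (p I).2, hp⟩

theorem IsBiPoolingFamily.mem_supp_of_singleton (hJ : E.IsBiPoolingFamily G J) {z : unitInterval}
    (hz : G {z} ≠ 0) : ∃ I ∈ J, z ∈ supp G I.1 I.2 := by
  have hoff : z ∉ offSet J := fun h => hz (hJ.singleton_eq_zero h)
  rw [mem_offSet] at hoff
  push Not at hoff
  obtain ⟨I, hI, hzI⟩ := hoff
  refine ⟨I, hI, ?_⟩
  by_contra hcon
  have hsub : {z} ⊆ {x | ¬ (x ∈ Set.Ioo I.1 I.2 → x ∈ supp G I.1 I.2)} :=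
    Set.singleton_subset_iff.2 fun h => hcon (h hzI)
  exact hz (measure_mono_null hsub (ae_iff.1 (ae_mem_supp G I.1 I.2)))

/-- The signals that recommend `a_i` collapse to one atom at `γ i`. Cutoffs may coincide, so `top (γ
i) = i` is not automatic; it follows from the positive probability. -/
theorem IsOptimalSignal.measure_recommending (hG : E.IsOptimalSignal G) {i j : Fin n}
    (hj : E.IsLowestRecommended G j) (hji : j < i) (h0 : G (E.recommending i) ≠ 0) :
    E.top (E.γ i) = i ∧ G {E.γ i} = G (E.recommending i) := by
  have hae := hG.ae_eq_cutoff hj.1 hji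
  have htop : E.top (E.γ i) = i := by
    by_contra hcon
    refine h0 (measure_eq_zero_iff_ae_notMem.2 ?_)
    filter_upwards [hae] with x hx hxi
    rw [E.mem_recommending] at hxi
    exact hcon (hx hxi ▸ hxi)
  refine ⟨htop, measure_congr (Filter.eventuallyEq_set.2 ?_)⟩
  filter_upwards [hae] with x hx
  rw [E.mem_recommending, Set.mem_singleton_iff]
  exact ⟨fun h => h ▸ htop, hx⟩

/-- An open set minus a closed set is open, and a null open set is empty. -/
theorem subset_of_ae_subset {U T : Set unitInterval} (hU : IsOpen U) (hT : IsClosed T)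
    (h : U ≤ᵐ[E.prior] T) : U ⊆ T := by
  have h0 : E.prior (U \ T) = 0 := ae_le_set.1 h
  rw [(hU.sdiff hT).measure_eq_zero_iff E.prior] at h0
  exact Set.sdiff_eq_empty.1 h0


variable {n : ℕ} [NeZero n] {E : Environment n} {G : Measure unitInterval}
  {J : Set (unitInterval × unitInterval)}

/-! ### Existence of canonical representations -/

theorem closure_interior_closure_of_isOpen {U : Set unitInterval} (hU : IsOpen U) :
    closure (interior (closure U)) = closure U :=
  (closure_minimal interior_subset isClosed_closure).antisymm
    (closure_mono (interior_maximal subset_closure hU))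

/-- The closure of the complement misses the interior of `C`, so it meets `C` only in the frontier.
-/
theorem null_closure_compl_inter {C W : Set unitInterval} (hC : IsClosed C)
    (hCW : C ⊆ W) (h0 : E.prior (frontier C) = 0) : E.prior (closure Wᶜ ∩ C) = 0 := by
  refine measure_mono_null (fun x hx => ?_) h0
  rw [hC.frontier_eq]
  refine ⟨hx.2, fun hxi => ?_⟩
  rw [← compl_compl (interior C), ← closure_compl] at hxi
  exact hxi (closure_mono (Set.compl_subset_compl.2 hCW) hx.1)

-- A recommended action above the lowest has a single signal, hence lies in one block, and it gets
-- the component of that signal. The lowest action gets the closure of what is left, which is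
-- automatically the closure of its interior. The delicate case is a two-action block whose low
-- action is the lowest one: the leftover closure must meet the block in the low component only.
set_option maxHeartbeats 1000000 in
theorem exists_isCanonicalRep (hG : E.IsOptimalSignal G) (hJ : E.IsBiPoolingFamily G J) :
    ∃ B, E.IsCanonicalRep G B := by
  classical
  obtain ⟨hp, hle⟩ := (E.isMPC_iff G).1 hG.1
  obtain ⟨j, hj⟩ := E.exists_isLowestRecommended G
  obtain ⟨c, d, hcd⟩ := hJ.exists_isSplitting hle
  -- high actions and their blocks
  set hi : Fin n → Prop := fun i => j < i ∧ G (E.recommending i) ≠ 0 with hhi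
  have hblk : ∀ i, ∃ I : unitInterval × unitInterval, hi i → I ∈ J ∧ E.γ i ∈ supp G I.1 I.2 := by
    intro i
    by_cases h : hi i
    · obtain ⟨I, hI, hz⟩ := hJ.mem_supp_of_singleton (z := E.γ i)
        (by rw [(hG.measure_recommending hj h.1 h.2).2]; exact h.2)
      exact ⟨I, fun _ => ⟨hI, hz⟩⟩
    · exact ⟨0, fun h' => absurd h' h⟩
  choose blk hblk using hblk
  have htop : ∀ i, hi i → E.top (E.γ i) = i := fun i h => (hG.measure_recommending hj h.1 h.2).1
  have hmass : ∀ i, hi i → G {E.γ i} = G (E.recommending i) :=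
    fun i h => (hG.measure_recommending hj h.1 h.2).2
  set C : Fin n → Set unitInterval := fun i =>
    if hi i then component G c d (blk i) (E.γ i) else ∅ with hC
  have hCpos : ∀ i, hi i → C i = component G c d (blk i) (E.γ i) := fun i h => if_pos h
  have hCneg : ∀ i, ¬ hi i → C i = ∅ := fun i h => if_neg h
  have hCcl : ∀ i, IsClosed (C i) := fun i => by
    by_cases h : hi i
    · rw [hCpos i h]; exact isClosed_component
    · rw [hCneg i h]; exact isClosed_empty
  have hCfr : ∀ i, E.prior (frontier (C i)) = 0 := fun i => by
    by_cases h : hi i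
    · rw [hCpos i h]; exact null_frontier_component E
    · rw [hCneg i h]; simp
  set W := ⋃ i, C i with hW
  have hWcl : IsClosed W := isClosed_iUnion_of_finite hCcl
  set B : Fin n → Set unitInterval := fun i => if i = j then closure Wᶜ else C i with hB
  have hBj : B j = closure Wᶜ := if_pos rfl
  have hBne : ∀ i, i ≠ j → B i = C i := fun i h => if_neg h
  have hhij : ¬ hi j := fun h => lt_irrefl _ h.1
  have hBhi : ∀ i, hi i → B i = component G c d (blk i) (E.γ i) := fun i h => by
    rw [hBne i h.1.ne', hCpos i h]
  have hclosed : ∀ i, IsClosed (B i) := fun i => by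
    by_cases h : i = j
    · rw [h, hBj]; exact isClosed_closure
    · rw [hBne i h]; exact hCcl i
  have hcover : ⋃ i, B i = Set.univ := by
    refine Set.eq_univ_of_forall fun x => ?_
    by_cases hx : x ∈ W
    · obtain ⟨i, hxi⟩ := Set.mem_iUnion.1 hx
      have hij : i ≠ j := by
        rintro rfl
        rw [hCneg _ hhij] at hxi
        exact hxi
      exact Set.mem_iUnion.2 ⟨i, by rwa [hBne i hij]⟩
    · exact Set.mem_iUnion.2 ⟨j, by rw [hBj]; exact subset_closure hx⟩
  have hCnull : ∀ i k, i ≠ k → E.prior (C i ∩ C k) = 0 := by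
    intro i k hik
    by_cases h : hi i
    · by_cases h' : hi k
      · rw [hCpos i h, hCpos k h']
        refine prior_component_inter hJ hcd (hblk i h).1 (hblk k h').1 (hblk i h).2 (hblk k h').2
          fun heq => hik ?_
        rw [← htop i h, ← htop k h', heq]
      · rw [hCneg k h']; simp
    · rw [hCneg i h]; simp
  have hjC : ∀ i, E.prior (closure Wᶜ ∩ C i) = 0 := fun i =>
    null_closure_compl_inter (hCcl i) (Set.subset_iUnion C i) (hCfr i)
  have hnull : ∀ i k, i ≠ k → E.prior (B i ∩ B k) = 0 := by
    intro i k hik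
    by_cases h : i = j
    · subst h
      rw [hBj, hBne k (Ne.symm hik)]
      exact hjC k
    · by_cases h' : k = j
      · subst h'
        rw [hBj, hBne i h, Set.inter_comm]
        exact hjC i
      · rw [hBne i h, hBne k h']
        exact hCnull i k hik
  have hzero : ∀ i, i ≠ j → ¬ hi i → G (E.recommending i) = 0 := by
    intro i hij h
    by_contra h0
    exact h ⟨lt_of_le_of_ne (hj.2 h0) (Ne.symm hij), h0⟩
  have hassign : E.IsAssignment G B := by
    refine isAssignment_of_forall_ne hle (fun i => (hclosed i).measurableSet) hnull hcover j
      (fun i hij => ?_) fun i hij => ?_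
    · by_cases h : hi i
      · rw [hBhi i h, prior_component hJ hcd (hblk i h).1 (hblk i h).2, hmass i h]
      · rw [hBne i hij, hCneg i h, hzero i hij h, measure_empty]
    · by_cases h : hi i
      · rw [hBhi i h, setIntegral_component hJ hcd (hblk i h).1 (hblk i h).2,
          hG.setIntegral_recommending hj h.1, measureReal_def, hmass i h, ← measureReal_def]
      · rw [hBne i hij, hCneg i h, Measure.restrict_zero_set (hzero i hij h)]
        simp
  have hskip : ∀ i, IsSkipped (B i) → E.prior (B i) = 0 := by
    intro i hs
    by_cases h : i = j
    · subst h
      rw [hBj] at hs ⊢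
      have h1 : Wᶜ = ∅ := Set.subset_empty_iff.1 (hs ▸ interior_maximal subset_closure
        hWcl.isOpen_compl)
      rw [h1]; simp
    · rw [hBne i h] at hs ⊢
      have : C i ⊆ frontier (C i) := by
        rw [(hCcl i).frontier_eq, hs]; simp
      exact measure_mono_null this (hCfr i)
  have hunsk : ∀ i, ¬ IsSkipped (B i) ↔ G (E.recommending i) ≠ 0 := fun i =>
    not_isSkipped_iff_of_prob (hassign.mass i) (hskip i)
  have hlow : ∀ k, IsLowest B k → k = j := fun k hk => by
    rw [IsLowest] at hk
    simp only [hunsk] at hk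
    exact hk.unique hj
  have hrep : E.IsDeterministicRep G B := by
    refine ⟨hclosed, hcover, hnull, hskip, fun k hk => ?_, fun k hk i hki hi' => ?_, hassign.mass⟩
    · rw [hlow k hk]
      have h1 : 0 < E.prior.real (B j) :=
        ENNReal.toReal_pos (by rw [hassign.mass j]; exact hj.1) (measure_ne_top _ _)
      have h2 : G.real (E.recommending j) * (E.γ j : ℝ) ≤ ∫ x in E.recommending j, (x : ℝ) ∂G :=
        le_setIntegral_coe (E.measurableSet_recommending j) fun x hx =>
          Subtype.coe_le_coe.2 (E.le_top_iff.1 (E.mem_recommending.1 hx).ge)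
      rw [← hassign.mean j, setIntegral_eq_condMean, measureReal_def, ← hassign.mass j,
        ← measureReal_def] at h2
      exact le_of_mul_le_mul_left h2 h1
    · rw [hlow k hk] at hki
      have h : hi i := ⟨hki, (hunsk i).1 hi'⟩
      rw [hBhi i h]
      exact condMean_component hJ hcd (hblk i h).1 (hblk i h).2
  have hCsub : ∀ i, hi i → C i ⊆ Set.Icc (blk i).1 (blk i).2 := fun i h => by
    rw [hCpos i h]; exact component_subset hJ hcd (hblk i h).1 (hblk i h).2
  have hdisj : ∀ I ∈ J, ∀ i, hi i → blk i ≠ I → Disjoint (Set.Ioo I.1 I.2) (C i) := by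
    intro I hI i h hne
    refine Disjoint.mono_right (hCsub i h) (Set.disjoint_left.2 fun x hx hx' => ?_)
    rcases hJ.le_or_le hI (hblk i h).1 (Ne.symm hne) with h1 | h1
    · exact (hx.2.trans_le h1).not_ge hx'.1
    · exact (h1.trans_lt hx.1).not_ge hx'.2
  have hblkeq : ∀ I ∈ J, ∀ i, hi i → E.γ i ∈ supp G I.1 I.2 → blk i = I := fun I hI i h hz =>
    hJ.eq_of_mem (hblk i h).1 hI ((hJ.block _ (hblk i h).1).supp_subset (hblk i h).2)
      ((hJ.block I hI).supp_subset hz)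
  refine ⟨B, hrep, J, hJ, fun I hI i hs => ?_, fun I hI zL zH hz hs L H hLH hzL hzH => ?_,
    fun k hk => ?_⟩
  · -- blocks that recommend one action
    have hb := hJ.block I hI
    obtain ⟨z, hz⟩ := hb.nonempty
    have hzi : E.top z = i := E.mem_recommending.1 (hs hz)
    have hji : j ≤ i := hzi ▸ hj.le_of_singleton (hb.singleton_ne_zero hz)
    rcases hji.eq_or_lt with h | h
    · subst h
      rw [hBj, ← closure_Ioo hb.lt.ne]
      refine closure_mono fun x hx hxW => ?_
      obtain ⟨k, hxk⟩ := Set.mem_iUnion.1 hxW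
      have hk : hi k := by
        by_contra hk
        rw [hCneg k hk] at hxk
        exact hxk
      refine Set.disjoint_left.1 (hdisj I hI k hk fun heq => ?_) hx hxk
      have h1 := (hblk k hk).2
      rw [heq] at h1
      have h2 := E.mem_recommending.1 (hs h1)
      rw [htop k hk] at h2
      exact hk.1.ne' h2
    · have hall : ∀ w ∈ supp G I.1 I.2, w = E.γ i := fun w hw => by
        have hwi : E.top w = i := E.mem_recommending.1 (hs hw)
        have := hG.eq_cutoff_of_singleton hj (hb.singleton_ne_zero hw) (hwi ▸ h)
        rwa [hwi] at this
      have hzγ := hall z hz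
      have hsing : supp G I.1 I.2 = {E.γ i} :=
        Set.eq_singleton_iff_unique_mem.2 ⟨hzγ ▸ hz, hall⟩
      have hhi' : hi i := ⟨h, fun h0 => hb.singleton_ne_zero hz (measure_mono_null
        (Set.singleton_subset_iff.2 (hs hz)) h0)⟩
      rw [hBhi i hhi', hblkeq I hI i hhi' (by simp [hsing]), component_single hsing]
  · -- blocks that recommend two actions
    obtain ⟨a, b⟩ := I
    simp only at hs ⊢
    have hb := hJ.block _ hI
    have hzL' : E.top zL = L := E.mem_recommending.1 hzL
    have hzH' : E.top zH = H := E.mem_recommending.1 hzH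
    subst hzL' hzH'
    have htwo : E.IsTwoActionBlock G J a b zL zH := ⟨hI, hz, hs, hLH⟩
    have hsp := hcd _ hI zL zH hz hs
    simp only at hsp
    set c' := c (a, b) with hc'
    set d' := d (a, b) with hd'
    have hrec : ∀ z, G {z} ≠ 0 → G (E.recommending (E.top z)) ≠ 0 := fun z h0 h1 =>
      h0 (measure_mono_null (Set.singleton_subset_iff.2 (E.mem_recommending.2 rfl)) h1)
    have hjH : j < E.top zH := (htwo.le_low hJ hj).trans_lt htwo.lt
    have hHhi : hi (E.top zH) := ⟨hjH, hrec _ (htwo.high_ne_zero hJ)⟩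
    have hγH : E.γ (E.top zH) = zH := (htwo.high_eq hG hJ hj).symm
    have hBH : B (E.top zH) = Set.Icc a c' ∪ Set.Icc d' b := by
      rw [hBhi _ hHhi, hblkeq _ hI _ hHhi (by simp [hs, hγH]), hγH]
      exact component_high hz hs
    have hsubH : Set.Icc a c' ∪ Set.Icc d' b ⊆ Set.Icc a b := by
      rw [← hsp.union]; exact Set.subset_union_right
    have hsubL : Set.Icc c' d' ⊆ Set.Icc a b := by
      rw [← hsp.union]; exact Set.subset_union_left
    have hBL : B (E.top zL) ∩ Set.Icc a b = Set.Icc c' d' := by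
      rcases (htwo.le_low hJ hj).eq_or_lt with h | h
      · rw [← h, hBj]
        have hHW : Set.Icc a c' ∪ Set.Icc d' b ⊆ W := by
          rw [← hBH, hBne _ hjH.ne']; exact Set.subset_iUnion C _
        refine subset_antisymm ?_ fun x hx => ⟨?_, hsubL hx⟩
        · rintro x ⟨hxW, hxI⟩
          by_contra hx
          have hout : x < c' ∨ d' < x := by
            by_contra hcon
            push Not at hcon
            exact hx hcon
          rcases hout with hxc | hxd
          -- A left arm is present, so the block starts at 0 by `IsSplit.left_eq`. All of `Iio c'`
          -- is then covered by `W`, and an open subset of `W` is disjoint from the closure of `Wᶜ`.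
          · have ha0 : a = 0 := by
              by_contra ha0
              have := hsp.left_eq hG hJ hI hs hz (h ▸ hj) htwo.ne
                (lt_of_le_of_ne unitInterval.nonneg' (Ne.symm ha0))
              rw [this] at hxc
              exact hxc.not_ge hxI.1
            have hsub : Set.Iio c' ⊆ W := fun y hy => hHW (.inl ⟨by
              rw [ha0]; exact unitInterval.nonneg', le_of_lt hy⟩)
            have : x ∈ (Set.Iio c')ᶜ := closure_minimal (Set.compl_subset_compl.2 hsub)
              isOpen_Iio.isClosed_compl hxW
            exact this hxc
          -- States beyond `b` belong to actions above the high one, at first almost everywhere and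
          -- then everywhere, because the finite union of their sets is closed. With the right arm,
          -- `W` covers all of `Ioi d'`.
          · have habove := hassign.ae_eq_Ioi hJ (hJ.right_mem_offSet hI) (htwo.above hG hJ hj)
            have hsub1 : Set.Ioi b ⊆ ⋃ k : Set.Ioi (E.top zH), B k :=
              subset_of_ae_subset isOpen_Ioi (isClosed_iUnion_of_finite fun k => hclosed k)
                habove.symm.le
            have hsub : Set.Ioi d' ⊆ W := fun y hy => by
              rcases le_or_gt y b with hyb | hyb
              · exact hHW (.inr ⟨le_of_lt hy, hyb⟩)
              · obtain ⟨k, hk⟩ := Set.mem_iUnion.1 (hsub1 hyb)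
                rw [hBne _ (hjH.trans k.2).ne'] at hk
                exact Set.mem_iUnion.2 ⟨_, hk⟩
            have : x ∈ (Set.Ioi d')ᶜ := closure_minimal (Set.compl_subset_compl.2 hsub)
              isOpen_Ioi.isClosed_compl hxW
            exact this hxd
        · rw [← closure_Ioo hsp.lt.ne] at hx
          refine closure_mono (fun y hy hyW => ?_) hx
          obtain ⟨k, hyk⟩ := Set.mem_iUnion.1 hyW
          have hk : hi k := by
            by_contra hk
            rw [hCneg k hk] at hyk
            exact hyk
          by_cases hbk : blk k = (a, b)
          · have h1 := (hblk k hk).2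
            rw [hbk, hs] at h1
            have h2 : k = E.top zH := by
              rcases h1 with h1 | h1
              · have h2 := htop k hk
                rw [h1, ← h] at h2
                exact absurd h2 hk.1.ne
              · rw [← htop k hk, h1]
            rw [h2, ← hBne _ hjH.ne', hBH] at hyk
            rcases hyk with hyk | hyk
            · exact hy.1.not_ge hyk.2
            · exact hy.2.not_ge hyk.1
          · exact Set.disjoint_left.1 (hdisj _ hI k hk hbk)
              ⟨hsp.le_left.trans_lt hy.1, hy.2.trans hsp.lt_right⟩ hyk
      · have hLhi : hi (E.top zL) := ⟨h, hrec _ (htwo.low_ne_zero hJ)⟩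
        have hγL : E.γ (E.top zL) = zL :=
          (hG.eq_cutoff_of_singleton hj (htwo.low_ne_zero hJ) h).symm
        rw [hBhi _ hLhi, hblkeq _ hI _ hLhi (by simp [hs, hγL]), hγL,
          component_low (I := (a, b)) hz hs]
        exact Set.inter_eq_left.2 hsubL
    rw [hBL, hBH, Set.inter_eq_left.2 hsubH]
    exact hsp.isNestedIntervals hb hz hs
  · rw [hlow k hk]
    refine ⟨?_, fun i hji hi' => ?_⟩
    · rw [hBj, closure_interior_closure_of_isOpen hWcl.isOpen_compl]
    · have h : hi i := ⟨hji, (hunsk i).1 hi'⟩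
      exact ⟨blk i, (hblk i h).1, by rw [hBne i hji.ne']; exact hCsub i h⟩


variable {n : ℕ} [NeZero n] {E : Environment n} {G : Measure unitInterval}
  {J : Set (unitInterval × unitInterval)}

/-! ### The structure of canonical representations -/

/-- Nested intervals prescribe conditional means only. Mass and mean of the whole block give two
linear equations for the masses of the two components, with a unique solution because `zL ≠ zH`. -/
theorem IsNestedIntervals.exists_isSplit [IsProbabilityMeasure G] {a b zL zH : unitInterval}
    {BL BH : Set unitInterval} (h : E.IsNestedIntervals G a b zL zH BL BH) :
    ∃ c d, E.IsSplit G a b zL zH c d ∧ BL = Set.Icc c d ∧ BH = Set.Icc a c ∪ Set.Icc d b := by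
  obtain ⟨hp, c, d, hac, hcd, hdb, rfl, rfl⟩ := h
  refine ⟨c, d, ?_, rfl, rfl⟩
  have hb := hp.block
  have hz := hp.signals_lt
  have hzR : (zL : ℝ) < zH := hz
  have e1 : E.prior.real (Set.Ioo a b) = E.prior.real (Set.Icc a b) :=
    measureReal_congr Ioo_ae_eq_Icc
  have hmass := hb.mass_pair hz hp.supp_eq
  have hmean := hb.mean_pair hz hp.supp_eq
  rw [Measure.restrict_congr_set (Ioo_ae_eq_Icc (μ := E.prior) (a := a) (b := b)), ← hp.union]
    at hmean
  rw [e1, ← hp.union] at hmass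
  have hd : AEDisjoint E.prior (Set.Icc c d) (Set.Icc a c ∪ Set.Icc d b) := hp.null
  rw [measureReal_union₀ hp.closed_high.nullMeasurableSet hd] at hmass
  rw [setIntegral_union₀ hd hp.closed_high.nullMeasurableSet integrable_coe.integrableOn
    integrable_coe.integrableOn, setIntegral_eq_condMean, setIntegral_eq_condMean, hp.mean_low,
    hp.mean_high] at hmean
  set mL := E.prior.real (Set.Icc c d) with hmL
  set mH := E.prior.real (Set.Icc a c ∪ Set.Icc d b) with hmH
  have hm : mL = G.real {zL} := by
    have : (mL - G.real {zL}) * ((zH : ℝ) - zL) = 0 := by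
      linear_combination (zH : ℝ) * hmass - hmean
    rcases mul_eq_zero.1 this with h | h
    · exact sub_eq_zero.1 h
    · exact absurd (sub_eq_zero.1 h) hzR.ne'
  refine hb.isSplit_of_low hz hp.supp_eq hac hcd hdb hm ?_
  rw [setIntegral_eq_condMean, hp.mean_low, ← hmL, hm]

/-- A canonical representation `B`, the family `J` of intervals that exhibits it, the splitting
`c`, `d` of the blocks that it induces, and the lowest recommended action `j`. -/
structure IsCanonicalData (E : Environment n) (G : Measure unitInterval)
    (B : Fin n → Set unitInterval) (J : Set (unitInterval × unitInterval))
    (c d : unitInterval × unitInterval → unitInterval) (j : Fin n) : Prop where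
  rep : E.IsDeterministicRep G B
  family : E.IsBiPoolingFamily G J
  splitting : E.IsSplitting G J c d
  single : ∀ I ∈ J, ∀ i, supp G I.1 I.2 ⊆ E.recommending i → Set.Icc I.1 I.2 ⊆ B i
  split : ∀ I ∈ J, ∀ zL zH : unitInterval, zL < zH → supp G I.1 I.2 = {zL, zH} →
    E.top zL ≠ E.top zH → B (E.top zL) ∩ Set.Icc I.1 I.2 = Set.Icc (c I) (d I) ∧
      B (E.top zH) ∩ Set.Icc I.1 I.2 = Set.Icc I.1 (c I) ∪ Set.Icc (d I) I.2
  lowest : E.IsLowestRecommended G j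
  regular : B j = closure (interior (B j))
  higher : ∀ i, j < i → ¬ IsSkipped (B i) → ∃ I ∈ J, B i ⊆ Set.Icc I.1 I.2

variable {B : Fin n → Set unitInterval}

/-- In a two-action block the representation dictates the split. A block with two signals and one
action carries no prescribed split, and an arbitrary one is supplied. -/
theorem IsCanonicalRep.exists_data [IsProbabilityMeasure G] (hle : CxLE G E.prior)
    (hB : E.IsCanonicalRep G B) : ∃ J c d j, E.IsCanonicalData G B J c d j := by
  obtain ⟨hrep, J, hJ, h1, h2, h3⟩ := hB
  obtain ⟨j, hj⟩ := E.exists_isLowestRecommended G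
  have hex : ∀ I : unitInterval × unitInterval, ∃ p : unitInterval × unitInterval, I ∈ J →
      ∀ zL zH, zL < zH → supp G I.1 I.2 = {zL, zH} → E.IsSplit G I.1 I.2 zL zH p.1 p.2 ∧
      (E.top zL ≠ E.top zH → B (E.top zL) ∩ Set.Icc I.1 I.2 = Set.Icc p.1 p.2 ∧
        B (E.top zH) ∩ Set.Icc I.1 I.2 = Set.Icc I.1 p.1 ∪ Set.Icc p.2 I.2) := by
    intro I
    by_cases hI : I ∈ J
    · rcases (hJ.block I hI).supp_eq with ⟨w, hw⟩ | ⟨zL, zH, hLH, hs⟩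
      · exact ⟨0, fun _ zL zH h hs => absurd (hs.symm.trans hw) (pair_ne_singleton h w)⟩
      · by_cases hne : E.top zL = E.top zH
        · obtain ⟨c, d, h⟩ := hJ.exists_isSplit hle hI hLH hs
          refine ⟨(c, d), fun _ wL wH hw hs' => ?_⟩
          obtain ⟨rfl, rfl⟩ := pair_unique hLH hw (hs.symm.trans hs')
          exact ⟨h, fun h' => absurd hne h'⟩
        · obtain ⟨c, d, h, e1, e2⟩ := (h2 I hI zL zH hLH hs _ _ hne (E.mem_recommending.2 rfl)
            (E.mem_recommending.2 rfl)).exists_isSplit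
          refine ⟨(c, d), fun _ wL wH hw hs' => ?_⟩
          obtain ⟨rfl, rfl⟩ := pair_unique hLH hw (hs.symm.trans hs')
          exact ⟨h, fun _ => ⟨e1, e2⟩⟩
    · exact ⟨0, fun h => absurd h hI⟩
  choose p hp using hex
  have h3' := h3 j (hrep.isLowest_iff.2 hj)
  exact ⟨J, fun I => (p I).1, fun I => (p I).2, j, hrep, hJ,
    fun I hI zL zH h hs => (hp I hI zL zH h hs).1, h1,
    fun I hI zL zH h hs hne => (hp I hI zL zH h hs).2 hne, hj, h3'.1, h3'.2⟩

variable {c d : unitInterval × unitInterval → unitInterval} {j : Fin n}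

namespace IsCanonicalData

theorem component_subset_rep (h : E.IsCanonicalData G B J c d j)
    {I : unitInterval × unitInterval} (hI : I ∈ J) {z : unitInterval}
    (hz : z ∈ supp G I.1 I.2) : component G c d I z ⊆ B (E.top z) := by
  have hsub := component_subset h.family h.splitting hI hz
  rcases component_cases h.family h.splitting hI hz with
    ⟨hs, hc⟩ | ⟨w, hw, hs, hc, hsp⟩ | ⟨w, hw, hs, hc, hsp⟩
  · refine hsub.trans (h.single I hI _ ?_)
    rw [hs]
    exact Set.singleton_subset_iff.2 (E.mem_recommending.2 rfl)
  · by_cases hne : E.top z = E.top w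
    · refine hsub.trans (h.single I hI _ ?_)
      rw [hs]
      rintro x (rfl | rfl)
      · exact E.mem_recommending.2 rfl
      · exact E.mem_recommending.2 hne.symm
    · rw [hc, ← (h.split I hI z w hw hs hne).1]
      exact Set.inter_subset_left
  · by_cases hne : E.top w = E.top z
    · refine hsub.trans (h.single I hI _ ?_)
      rw [hs]
      rintro x (rfl | rfl)
      · exact E.mem_recommending.2 hne
      · exact E.mem_recommending.2 rfl
    · rw [hc, ← (h.split I hI w z hw hs hne).2]
      exact Set.inter_subset_left

/-- The set of a higher action lies in one interval of the family; containing a component of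
positive mass, it must lie in `I`. The other signal of `I`, if any, recommends a different action,
since two signals for this action would both equal its cutoff. -/
theorem rep_eq_component (h : E.IsCanonicalData G B J c d j) (hG : E.IsOptimalSignal G)
    {I : unitInterval × unitInterval} (hI : I ∈ J) {z : unitInterval}
    (hz : z ∈ supp G I.1 I.2) (hj : j < E.top z) : B (E.top z) = component G c d I z := by
  have hJ := h.family
  have h0 : G {z} ≠ 0 := (hJ.block I hI).singleton_ne_zero hz
  have hzγ := hG.eq_cutoff_of_singleton h.lowest h0 hj
  have hsub := component_subset hJ h.splitting hI hz
  have hpos : E.prior (component G c d I z) ≠ 0 := by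
    rwa [prior_component hJ h.splitting hI hz]
  have hunsk : ¬ IsSkipped (B (E.top z)) := by
    rw [h.rep.not_isSkipped_iff]
    exact fun h1 => h0 (measure_mono_null
      (Set.singleton_subset_iff.2 (E.mem_recommending.2 rfl)) h1)
  obtain ⟨I', hI', hBI'⟩ := h.higher _ hj hunsk
  have hII' : I = I' := by
    by_contra hne
    refine hpos (measure_mono_null (t := Set.Icc I.1 I.2 ∩ Set.Icc I'.1 I'.2)
      (fun x hx => ⟨hsub hx, hBI' (h.component_subset_rep hI hz hx)⟩) ?_)
    rcases hJ.le_or_le hI hI' hne with h | h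
    · exact measure_mono_null (fun x hx => le_antisymm hx.1.2 (h.trans hx.2.1))
        (measure_singleton I.2)
    · exact measure_mono_null (fun x hx => le_antisymm hx.2.2 (h.trans hx.1.1))
        (measure_singleton I'.2)
  subst hII'
  refine subset_antisymm ?_ (h.component_subset_rep hI hz)
  have hne : ∀ w ∈ supp G I.1 I.2, w ≠ z → E.top w ≠ E.top z := fun w hw hwz heq => by
    have := hG.eq_cutoff_of_singleton h.lowest ((hJ.block I hI).singleton_ne_zero hw) (heq ▸ hj)
    rw [heq, ← hzγ] at this
    exact hwz this
  rcases component_cases hJ h.splitting hI hz with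
    ⟨hs, hc⟩ | ⟨w, hw, hs, hc, hsp⟩ | ⟨w, hw, hs, hc, hsp⟩
  · rwa [hc]
  · rw [hc, ← (h.split I hI z w hw hs (hne w (by simp [hs]) hw.ne').symm).1]
    exact fun x hx => ⟨hx, hBI' hx⟩
  · rw [hc, ← (h.split I hI w z hw hs (hne w (by simp [hs]) hw.ne)).2]
    exact fun x hx => ⟨hx, hBI' hx⟩

theorem le_of_Icc_subset {S : Set unitInterval} {x y e : unitInterval} (hxy : x < y)
    (hS : Set.Icc x y ⊆ S) (h0 : E.prior (S ∩ Set.Ioi e) = 0) : y ≤ e := by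
  by_contra hcon
  have hlt : max x e < y := max_lt hxy (not_le.1 hcon)
  refine (E.prior_Ioo_pos hlt).ne' (measure_mono_null (fun w hw => ?_) h0)
  refine Set.mem_inter (hS ⟨?_, hw.2.le⟩) ?_
  · exact (le_max_left x e).trans hw.1.le
  · exact (le_max_right x e).trans_lt hw.1

theorem le_of_not_isSkipped (h : E.IsCanonicalData G B J c d j) {k : Fin n}
    (hk : ¬ IsSkipped (B k)) : j ≤ k :=
  h.lowest.2 (h.rep.not_isSkipped_iff.1 hk)

/-- The supremum of a set of a canonical representation is its essential supremum. -/
theorem subset_Iic (h : E.IsCanonicalData G B J c d j) (hG : E.IsOptimalSignal G) {k : Fin n}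
    (hk : ¬ IsSkipped (B k)) {e : unitInterval} (h0 : E.prior (B k ∩ Set.Ioi e) = 0) :
    B k ⊆ Set.Iic e := by
  -- The lowest set is the closure of its interior. Every other unskipped set is a component, whose
  -- rightmost interval is nondegenerate. In both cases there is mass arbitrarily close to the
  -- supremum.
  rcases (h.le_of_not_isSkipped hk).eq_or_lt with hjk | hjk
  · subst hjk
    have h1 : interior (B j) ∩ Set.Ioi e = ∅ :=
      ((isOpen_interior.inter isOpen_Ioi).measure_eq_zero_iff E.prior).1
        (measure_mono_null (Set.inter_subset_inter_left _ interior_subset) h0)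
    rw [h.regular]
    refine closure_minimal (fun x hx => ?_) isClosed_Iic
    by_contra hcon
    exact (Set.eq_empty_iff_forall_notMem.1 h1) x ⟨hx, show e < x from lt_of_not_ge hcon⟩
  · have hGk := h.rep.not_isSkipped_iff.1 hk
    obtain ⟨htop, hmass⟩ := hG.measure_recommending h.lowest hjk hGk
    obtain ⟨I, hI, hz⟩ := h.family.mem_supp_of_singleton (z := E.γ k) (by rwa [hmass])
    have heq := h.rep_eq_component hG hI hz (by rwa [htop])
    rw [htop] at heq
    rcases component_cases h.family h.splitting hI hz with
      ⟨hs, hc⟩ | ⟨w, hw, hs, hc, hsp⟩ | ⟨w, hw, hs, hc, hsp⟩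
    · rw [heq, hc] at h0 ⊢
      exact fun x hx => hx.2.trans (le_of_Icc_subset (h.family.block I hI).lt subset_rfl h0)
    · rw [heq, hc] at h0 ⊢
      exact fun x hx => hx.2.trans (le_of_Icc_subset hsp.lt subset_rfl h0)
    · rw [heq, hc] at h0 ⊢
      have hle := le_of_Icc_subset hsp.lt_right Set.subset_union_right h0
      rintro x (hx | hx)
      · exact hx.2.trans ((hsp.lt.le.trans hsp.lt_right.le).trans hle)
      · exact hx.2.trans hle

theorem null_inter_Ioi (h : E.IsCanonicalData G B J c d j) {k : Fin n} {A : Set (Fin n)}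
    (hkA : k ∉ A) {e : unitInterval} (hA : (⋃ i : A, B i) =ᵐ[E.prior] Set.Ioi e) :
    E.prior (B k ∩ Set.Ioi e) = 0 := by
  rw [← measure_congr ((Filter.EventuallyEq.refl _ (B k)).inter hA), Set.inter_iUnion]
  exact measure_iUnion_null fun i => h.rep.null _ _ fun hki => hkA (hki ▸ i.2)

/-- A two-action block in which the low action is recommended nowhere else is represented by the
full sets of the two actions. -/
theorem rep_eq_of_two (h : E.IsCanonicalData G B J c d j) [IsProbabilityMeasure G]
    (hG : E.IsOptimalSignal G) {a b zL zH : unitInterval} (h2 : E.IsTwoActionBlock G J a b zL zH)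
    (hcase : a = 0 ∨ j < E.top zL) :
    B (E.top zL) = Set.Icc (c (a, b)) (d (a, b)) ∧
      B (E.top zH) = Set.Icc a (c (a, b)) ∪ Set.Icc (d (a, b)) b := by
  have hjL := h2.le_low h.family h.lowest
  refine ⟨?_, ?_⟩
  · rcases hjL.eq_or_lt with hj | hj
    · have ha : a = 0 := hcase.resolve_right (hj ▸ lt_irrefl _)
      have hunsk : ¬ IsSkipped (B j) := h.rep.not_isSkipped_iff.2 h.lowest.1
      have hle : B j ⊆ Set.Iic b := by
        refine h.subset_Iic hG hunsk (h.null_inter_Ioi (A := Set.Ioi (E.top zH)) ?_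
          ((h.rep.isAssignment hG).ae_eq_Ioi h.family (h.family.right_mem_offSet h2.mem)
          (h2.above hG h.family h.lowest)))
        exact fun hh => (hj.trans_lt h2.lt).not_gt hh
      have := (h.split _ h2.mem zL zH h2.signals_lt h2.supp_eq h2.ne).1
      rw [← this, ← hj, eq_comm, Set.inter_eq_left]
      intro x hx
      refine ⟨?_, hle hx⟩
      simp only [ha]
      exact unitInterval.nonneg'
    · rw [h.rep_eq_component hG h2.mem (by simp [h2.supp_eq]) hj]
      exact component_low h2.signals_lt h2.supp_eq
  · rw [h.rep_eq_component hG h2.mem (by simp [h2.supp_eq]) (hjL.trans_lt h2.lt)]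
    exact component_high h2.signals_lt h2.supp_eq

theorem not_isSkipped_top (h : E.IsCanonicalData G B J c d j) {z : unitInterval}
    (hz : G {z} ≠ 0) : ¬ IsSkipped (B (E.top z)) :=
  h.rep.not_isSkipped_iff.2 fun h1 => hz (measure_mono_null
    (Set.singleton_subset_iff.2 (E.mem_recommending.2 rfl)) h1)

/-! ### The two conditions -/

/-- Under the two conditions no state prefers to reveal itself. -/
theorem le_cutoff_succ (h : E.IsCanonicalData G B J c d j) [IsProbabilityMeasure G]
    (hG : E.IsOptimalSignal G) (hskip : E.SkipCondition B) (hnest : E.NestedCondition G B)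
    {k : Fin n} (hk : ¬ IsSkipped (B k)) {x : unitInterval} (hx : x ∈ B k) :
    x ≤ E.cutoff k.succ := by
  have hassign := h.rep.isAssignment hG
  by_cases hlast : (k : ℕ) + 1 < n
  swap
  · have : k.succ = Fin.last n := by ext; simp; omega
    rw [this, E.cutoff_last]
    exact unitInterval.le_one'
  -- The next action, whose lower cutoff is the upper cutoff of `a_k`.
  set i : Fin n := ⟨k + 1, hlast⟩ with hi
  have hki : k < i := by rw [Fin.lt_def]; simp [hi]
  have hlt : ∀ l : Fin n, l < i → l ≤ k := fun l hl => by
    rw [Fin.lt_def] at hl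
    rw [Fin.le_def]
    simp only [hi] at hl
    omega
  change x ≤ E.γ i
  by_cases his : IsSkipped (B i)
  · exact (le_sSup hx).trans (hskip i (by simp [hi]) his k hki hk)
  rcases exists_threshold hG h.family h.lowest (i := i) with
    ⟨e, he⟩ | ⟨a, b, zL, zH, h2, hLi, hiH, hcase⟩
  · have hB := he B hassign
    have h1 : B k ⊆ Set.Iic e :=
      h.subset_Iic hG hk (h.null_inter_Ioi (fun hh => hki.not_ge hh) hB)
    -- The set `B i` lies beyond `e` up to a null set and has mean `γ i`, hence `e ≤ γ i`.
    refine (show x ≤ e from h1 hx).trans ?_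
    have h2 : (B i ∩ Set.Ioi e : Set unitInterval) =ᵐ[E.prior] B i := by
      refine Filter.eventuallyEq_set.2 ?_
      filter_upwards [Filter.eventuallyEq_set.1 hB] with y hy
      exact ⟨fun hh => hh.1, fun hh => ⟨hh, hy.1 (Set.mem_iUnion.2 ⟨⟨i, Set.mem_Ici.2 le_rfl⟩, hh⟩)⟩⟩
    have h3 := le_setIntegral_coe (μ := E.prior) (S := B i ∩ Set.Ioi e) (t := e)
      ((hassign.measurable i).inter measurableSet_Ioi) fun y hy => le_of_lt hy.2
    rw [measureReal_congr h2, Measure.restrict_congr_set h2, setIntegral_eq_condMean,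
      h.rep.mean_higher j (h.rep.isLowest_iff.2 h.lowest) i
        ((h.le_of_not_isSkipped hk).trans_lt hki) his] at h3
    refine Subtype.coe_le_coe.1 (le_of_mul_le_mul_left h3 (ENNReal.toReal_pos ?_
      (measure_ne_top _ _)))
    rw [h.rep.prob i]
    exact h.rep.not_isSkipped_iff.1 his
  -- No action strictly between the two of the block is recommended, so the consecutive unskipped
  -- actions `k` and `i` are exactly these two.
  · have hkL : k = E.top zL := by
      refine ((hlt _ hLi).eq_or_lt.resolve_right fun hh => ?_).symm
      exact h.rep.not_isSkipped_iff.1 hk (h2.between h.family hh (hki.trans_le hiH))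
    have hiH' : i = E.top zH := hiH.eq_or_lt.resolve_right fun hh =>
      h.rep.not_isSkipped_iff.1 his (h2.between h.family hLi hh)
    obtain ⟨e1, e2⟩ := h.rep_eq_of_two hG h2 hcase
    have hn := (h.splitting _ h2.mem zL zH h2.signals_lt h2.supp_eq).isNestedIntervals
      (h.family.block _ h2.mem) h2.signals_lt h2.supp_eq
    simp only at hn
    rw [← e1, ← e2, ← hkL, ← hiH'] at hn
    exact (le_sSup hx).trans (hnest k i hki ⟨a, b, zL, zH, hn⟩)

/-- If some assignment of the states to actions, consistent with `G`, is proof against states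
revealing themselves, then so are canonical representations. -/
theorem subset_Iic_of_assignment (h : E.IsCanonicalData G B J c d j) [IsProbabilityMeasure G]
    (hG : E.IsOptimalSignal G) {D : Fin n → Set unitInterval} (hD : E.IsAssignment G D)
    (hreveal : ∀ i, ∀ᵐ x ∂E.prior, E.γ i < x → x ∈ ⋃ k : Set.Ici i, D k)
    {i k : Fin n} (hki : k < i) (hk : ¬ IsSkipped (B k)) : B k ⊆ Set.Iic (E.γ i) := by
  have hassign := h.rep.isAssignment hG
  have hJ := h.family
  have hjk := h.le_of_not_isSkipped hk
  rcases exists_threshold hG hJ h.lowest (i := i) with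
    ⟨e, he⟩ | ⟨a, b, zL, zH, h2, hLi, hiH, hcase⟩
  · have h1 : B k ⊆ Set.Iic e :=
      h.subset_Iic hG hk (h.null_inter_Ioi (fun hh => hki.not_ge hh) (he B hassign))
    refine h1.trans (Set.Iic_subset_Iic.2 ?_)
    -- States strictly between `γ i` and `e` would gain from revealing themselves, so they would
    -- belong to actions from `a_i` up, whose states all lie beyond `e`.
    by_contra hcon
    refine (E.prior_Ioo_pos (not_le.1 hcon)).ne' (measure_eq_zero_iff_ae_notMem.2 ?_)
    filter_upwards [hreveal i, Filter.eventuallyEq_set.1 (he D hD)] with x hx hx' hxI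
    exact (show e < x from hx'.1 (hx hxI.1)).not_gt hxI.2
  · have hzLi : zL < E.γ i := lt_of_not_ge fun hh => (E.le_top_iff.2 hh).not_gt hLi
    have hkL : k ≤ E.top zL := le_of_not_gt fun hh =>
      h.rep.not_isSkipped_iff.1 hk (h2.between hJ hh (hki.trans_le hiH))
    rcases hkL.lt_or_eq with hkL | rfl
    · have hjL : j < E.top zL := hjk.trans_lt hkL
      have h1 : B k ⊆ Set.Iic a := h.subset_Iic hG hk (h.null_inter_Ioi
        (fun hh => hkL.not_ge hh) (hassign.ae_eq_Ioi hJ (hJ.left_mem_offSet h2.mem)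
          (h2.from hG hJ h.lowest hjL)))
      exact h1.trans (Set.Iic_subset_Iic.2 ((h2.mem_low hJ).1.trans hzLi).le)
    · obtain ⟨e1, e2⟩ := h.rep_eq_of_two hG h2 hcase
      have hsp := h.splitting _ h2.mem zL zH h2.signals_lt h2.supp_eq
      simp only at hsp
      set c' := c (a, b) with hc'
      set d' := d (a, b) with hd'
      rw [e1]
      refine fun x hx => hx.2.trans (show d' ≤ E.γ i from ?_)
      -- If `γ i < d'`, revelation puts almost all states of the block above `γ i` into `D (E.top
      -- zH)`. Compared with `B (E.top zH)`, this set can lose only states up to `c'` and gain only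
      -- states from `c'` on. By `ae_eq_of_threshold` the two sets then agree, yet the states
      -- between `max c' (γ i)` and `d'` belong only to the former.
      by_contra hcon
      have hcon : E.γ i < d' := not_le.1 hcon
      have habove := hD.ae_eq_Ioi hJ (hJ.right_mem_offSet h2.mem) (h2.above hG hJ h.lowest)
      -- states of the block above the cutoff get the high action
      have hmid : ∀ᵐ x ∂E.prior, E.γ i < x → x < b → x ∈ D (E.top zH) := by
        have hnull : ∀ l : Fin n, ∀ᵐ x ∂E.prior, i ≤ l → l < E.top zH → x ∉ D l := fun l => by
          by_cases hl : i ≤ l ∧ l < E.top zH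
          · have := hD.mass l
            rw [h2.between hJ (hLi.trans_le hl.1) hl.2] at this
            filter_upwards [measure_eq_zero_iff_ae_notMem.1 this] with x hx _ _ using hx
          · exact .of_forall fun x h1 h2 => absurd ⟨h1, h2⟩ hl
        filter_upwards [hreveal i, Filter.eventuallyEq_set.1 habove, ae_all_iff.2 hnull]
          with x h1 h2 h3 hx hxb
        obtain ⟨⟨l, hl⟩, hxl⟩ := Set.mem_iUnion.1 (h1 hx)
        rcases lt_trichotomy l (E.top zH) with hlt | heq | hgt
        · exact absurd hxl (h3 l hl hlt)
        · exact heq ▸ hxl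
        · exact absurd (h2.1 (Set.mem_iUnion.2 ⟨⟨l, hgt⟩, hxl⟩)) hxb.not_gt
      have hDH : ∀ᵐ x ∂E.prior, x ∈ D (E.top zH) → a < x ∧ x ≤ b := by
        have hlow : ∀ᵐ x ∂E.prior, x ∈ D (E.top zH) → a < x := by
          rcases hcase with ha | hjL
          · filter_upwards [measure_eq_zero_iff_ae_notMem.1
              (measure_singleton (μ := E.prior) a)] with x hx _
            refine lt_of_le_of_ne ?_ (Ne.symm hx)
            rw [ha]; exact unitInterval.nonneg'
          · filter_upwards [Filter.eventuallyEq_set.1 (hD.ae_eq_Ioi hJ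
              (hJ.left_mem_offSet h2.mem) (h2.from hG hJ h.lowest hjL))] with x hx hxD
            exact hx.1 (Set.mem_iUnion.2 ⟨⟨_, h2.lt.le⟩, hxD⟩)
        have hdis : ∀ᵐ x ∂E.prior, ∀ l, l ≠ E.top zH → x ∈ D (E.top zH) → x ∉ D l := by
          refine ae_all_iff.2 fun l => ?_
          by_cases hl : l = E.top zH
          · exact .of_forall fun x hx => absurd hl hx
          · filter_upwards [measure_eq_zero_iff_ae_notMem.1 (hD.null l _ hl)] with x hx _ h1 h2
            exact hx ⟨h2, h1⟩
        filter_upwards [hlow, hdis, Filter.eventuallyEq_set.1 habove] with x h1 h2 h3 hx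
        refine ⟨h1 hx, not_lt.1 fun hxb => ?_⟩
        obtain ⟨⟨l, hl⟩, hxl⟩ := Set.mem_iUnion.1 (h3.2 hxb)
        exact h2 l (ne_of_gt hl) hx hxl
      have heq := ae_eq_of_threshold (hassign.measurable (E.top zH)) (hD.measurable (E.top zH))
        ((hassign.mass _).trans (hD.mass _).symm) ((hassign.mean _).trans (hD.mean _).symm) c'
        (by
          rw [e2]
          filter_upwards [hmid, measure_eq_zero_iff_ae_notMem.1
            (measure_singleton (μ := E.prior) b)] with x h1 h2 hx hxD
          rcases hx with hx | hx
          · exact hx.2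
          · exact absurd (h1 (hcon.trans_le hx.1) (lt_of_le_of_ne hx.2 h2)) hxD)
        (by
          rw [e2]
          filter_upwards [hDH] with x h1 hx hxB
          by_contra hcx
          exact hxB (.inl ⟨(h1 hx).1.le, (not_le.1 hcx).le⟩))
      refine (E.prior_Ioo_pos (max_lt hsp.lt hcon)).ne' (measure_eq_zero_iff_ae_notMem.2 ?_)
      rw [e2] at heq
      filter_upwards [Filter.eventuallyEq_set.1 heq, hmid] with x h1 h2 hx
      have hcx : c' < x := (le_max_left _ _).trans_lt hx.1
      have hγx : E.γ i < x := (le_max_right _ _).trans_lt hx.1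
      rcases h1.2 (h2 hγx (hx.2.trans hsp.lt_right)) with hh | hh
      · exact hh.2.not_gt hcx
      · exact hh.1.not_gt hx.2

/-- The two conditions follow if some assignment is proof against states revealing themselves. -/
theorem conditions_of_assignment (h : E.IsCanonicalData G B J c d j) [IsProbabilityMeasure G]
    (hG : E.IsOptimalSignal G) {D : Fin n → Set unitInterval} (hD : E.IsAssignment G D)
    (hreveal : ∀ i, ∀ᵐ x ∂E.prior, E.γ i < x → x ∈ ⋃ k : Set.Ici i, D k) :
    E.SkipCondition B ∧ E.NestedCondition G B := by
  refine ⟨fun i _ _ k hki hk => sSup_le fun x hx =>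
    h.subset_Iic_of_assignment hG hD hreveal hki hk hx, fun L H hLH hn => ?_⟩
  obtain ⟨a, b, zL, zH, hn⟩ := hn
  obtain ⟨c', d', hsp, e1, -⟩ := hn.exists_isSplit
  refine sSup_le fun x hx => h.subset_Iic_of_assignment hG hD hreveal hLH ?_ hx
  rw [h.rep.not_isSkipped_iff, ← h.rep.prob, e1, hsp.mass_low]
  exact hn.1.block.singleton_ne_zero (by simp [hn.1.supp_eq])

end IsCanonicalData

end Environment

/-! ### From equilibria to assignments -/

theorem map_val_injective {μ ν : Measure unitInterval}
    (h : μ.map (fun x : unitInterval => (x : ℝ)) = ν.map fun x : unitInterval => (x : ℝ)) :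
    μ = ν := by
  have key : ∀ κ : Measure unitInterval,
      (κ.map fun x : unitInterval => (x : ℝ)).map (Set.projIcc 0 1 zero_le_one) = κ := by
    intro κ
    rw [Measure.map_map continuous_projIcc.measurable measurable_subtype_coe]
    have : (Set.projIcc (0 : ℝ) 1 zero_le_one ∘ fun x : unitInterval => (x : ℝ)) = id :=
      funext fun x => Set.projIcc_val _ x
    rw [this, Measure.map_id]
  rw [← key μ, h, key]

theorem coe_bary (ν : Measure unitInterval) [IsProbabilityMeasure ν] :
    (bary ν : ℝ) = ∫ x, (x : ℝ) ∂ν := by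
  rw [← mass_mul_bary]; simp

theorem measurable_bary {α : Type*} [MeasurableSpace α] (κ : Kernel α unitInterval)
    [IsMarkovKernel κ] : Measurable fun a => bary (κ a) := by
  have h : Measurable fun a => ∫ x, (x : ℝ) ∂(κ a) :=
    (StronglyMeasurable.integral_kernel measurable_subtype_coe.stronglyMeasurable).measurable
  refine (MeasurableEmbedding.subtype_coe (measurableSet_Icc (a := (0 : ℝ)) (b := 1))).measurable_comp_iff.1 ?_
  have h' : (Subtype.val ∘ fun a => bary (κ a)) = fun a => ∫ x, (x : ℝ) ∂(κ a) :=
    funext fun a => coe_bary _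
  rw [h']
  exact h

namespace Environment

variable {n : ℕ} [NeZero n] {E : Environment n} {G : Measure unitInterval}
  {σ : Kernel unitInterval Message} {τ : Kernel Message (Fin n)} {p : Kernel Message unitInterval}

theorem v_nonneg (i : Fin n) : 0 ≤ E.v i := by
  rw [← E.v_zero]
  exact E.v_strictMono.monotone (Fin.zero_le _)

theorem measurable_messagePayoff (E : Environment n) (τ : Kernel Message (Fin n)) :
    Measurable (E.messagePayoff τ) :=
  Finset.measurable_sum _ fun i _ =>
    ((τ.measurable_coe (MeasurableSet.singleton i)).ennreal_toReal).mul_const _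

theorem messagePayoff_eq [IsMarkovKernel τ] (m : Message) :
    E.messagePayoff τ m = ∫ i, E.v i ∂(τ m) := by
  rw [integral_fintype (Integrable.of_finite)]
  simp [messagePayoff]

namespace IsEquilibrium

theorem mem_A (h : E.IsEquilibrium σ τ p) {m : Message} {i : Fin n} (hi : 0 < τ m {i}) :
    bary (p m) ∈ E.A i := by
  have := h.markov_belief
  have := h.receiver_optimal m i hi
  rw [← coe_bary] at this
  exact this

theorem ae_mem_A (h : E.IsEquilibrium σ τ p) (m : Message) :
    ∀ᵐ i ∂(τ m), bary (p m) ∈ E.A i := by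
  rw [ae_iff_of_countable]
  exact fun i hi => h.mem_A (pos_iff_ne_zero.2 hi)

/-- Receiver mixes only over actions that are optimal at her posterior mean, and these lie between
`low` and `top`. The lower bound is `le_messagePayoff`. -/
theorem messagePayoff_le (h : E.IsEquilibrium σ τ p) (m : Message) :
    E.messagePayoff τ m ≤ E.u (bary (p m)) := by
  have := h.markov_receiver
  rw [messagePayoff_eq]
  calc ∫ i, E.v i ∂(τ m) ≤ ∫ _, E.u (bary (p m)) ∂(τ m) :=
        integral_mono_ae .of_finite (integrable_const _)
          ((h.ae_mem_A m).mono fun i hi => E.u_ge hi.1)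
    _ = _ := by simp

theorem le_messagePayoff (h : E.IsEquilibrium σ τ p) (m : Message) :
    E.v (E.low (bary (p m))) ≤ E.messagePayoff τ m := by
  have := h.markov_receiver
  rw [messagePayoff_eq]
  calc E.v (E.low (bary (p m))) = ∫ _, E.v (E.low (bary (p m))) ∂(τ m) := by simp
    _ ≤ ∫ i, E.v i ∂(τ m) :=
        integral_mono_ae (integrable_const _) .of_finite
          ((h.ae_mem_A m).mono fun i hi => E.v_strictMono.monotone (E.low_le_iff.2 hi.2))

theorem messagePayoff_nonneg (h : E.IsEquilibrium σ τ p) (m : Message) :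
    0 ≤ E.messagePayoff τ m :=
  (v_nonneg _).trans (h.le_messagePayoff m)

/-- A state that is fully revealed is believed. -/
theorem bary_singleton (h : E.IsEquilibrium σ τ p) (ω : unitInterval) :
    bary (p ({ω} : Message)) = ω := by
  have := h.markov_belief
  have h1 : ∀ᵐ x ∂(p ({ω} : Message)), x = ω := by
    filter_upwards [Measure.support_mem_ae (μ := p ({ω} : Message))] with x hx
    simpa using h.belief_verifiable _ hx
  refine Subtype.ext ?_
  rw [coe_bary, integral_congr_ae (g := fun _ => (ω : ℝ)) (h1.mono fun x hx => by rw [hx])]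
  simp

/-- Bayes' rule in integrated form: both orders of disintegration of the joint law of message and
state. -/
theorem lintegral_swap (h : E.IsEquilibrium σ τ p) {g : Message × unitInterval → ENNReal}
    (hg : Measurable g) :
    ∫⁻ ω, ∫⁻ m, g (m, ω) ∂(σ ω) ∂E.prior = ∫⁻ m, ∫⁻ ω, g (m, ω) ∂(p m) ∂(σ ∘ₘ E.prior) := by
  have := h.markov_belief
  have := h.markov_sender
  rw [← Measure.lintegral_compProd hg, ← h.bayes, lintegral_map hg measurable_swap,
    Measure.lintegral_compProd (f := fun q => g q.swap) (hg.comp measurable_swap)]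
  rfl

/-- The level sets of Sender's equilibrium payoff, when it attains the commitment payoff. -/
theorem exists_assignment (h : E.IsEquilibrium σ τ p) [IsProbabilityMeasure G]
    (hlaw : (σ ∘ₘ E.prior).map (fun m => ∫ x, (x : ℝ) ∂(p m)) =
      G.map (fun x : unitInterval => (x : ℝ)))
    (hpay : ∫ m, E.messagePayoff τ m ∂(σ ∘ₘ E.prior) = ∫ x, E.u x ∂G) :
    ∃ D, E.IsAssignment G D ∧
      ∀ i, ∀ᵐ x ∂E.prior, E.γ i < x → x ∈ ⋃ k : Set.Ici i, D k := by
  have := h.markov_belief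
  have := h.markov_sender
  have hM : Measurable fun m => bary (p m) := measurable_bary p
  have hmap : (σ ∘ₘ E.prior).map (fun m => bary (p m)) = G := by
    refine map_val_injective ?_
    rw [Measure.map_map measurable_subtype_coe hM, ← hlaw]
    congr 1
    exact funext fun m => coe_bary _
  have hw := E.measurable_messagePayoff τ
  have huM : Integrable (fun m => E.u (bary (p m))) (σ ∘ₘ E.prior) := by
    have := E.integrable_u G
    rw [← hmap] at this
    exact this.comp_measurable hM
  have hwint : Integrable (E.messagePayoff τ) (σ ∘ₘ E.prior) :=
    huM.mono' hw.aestronglyMeasurable (.of_forall fun m => by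
      rw [Real.norm_of_nonneg (h.messagePayoff_nonneg m)]; exact h.messagePayoff_le m)
  -- Payoffs never exceed `u` at the posterior mean and the two integrals agree, so on the path
  -- Receiver must break ties in Sender's favour.
  have hae : ∀ᵐ m ∂(σ ∘ₘ E.prior), E.messagePayoff τ m = E.v (E.top (bary (p m))) := by
    have h0 : ∫ m, (E.u (bary (p m)) - E.messagePayoff τ m) ∂(σ ∘ₘ E.prior) = 0 := by
      rw [integral_sub huM hwint, hpay, sub_eq_zero, ← hmap,
        integral_map hM.aemeasurable E.measurable_u.aestronglyMeasurable]
    rw [integral_eq_zero_iff_of_nonneg (fun m => sub_nonneg.2 (h.messagePayoff_le m))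
      (huM.sub hwint)] at h0
    filter_upwards [h0] with m hm
    rw [← E.u_eq]
    exact (sub_eq_zero.1 hm).symm
  have hae' : ∀ᵐ ω ∂E.prior, ∀ᵐ m ∂(σ ω), E.messagePayoff τ m = E.v (E.top (bary (p m))) :=
    Measure.ae_ae_of_ae_comp hae
  -- All messages used in a state are equally good, so the integral is their common payoff; writing
  -- it as an integral makes it measurable in the state.
  let s : unitInterval → ℝ := fun ω => ∫ m, E.messagePayoff τ m ∂(σ ω)
  have hs : Measurable s := (StronglyMeasurable.integral_kernel hw.stronglyMeasurable).measurable
  have hconst : ∀ ω, ∀ᵐ m ∂(σ ω), E.messagePayoff τ m = s ω := by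
    intro ω
    obtain ⟨m₀, hm₀⟩ := (h.sender_optimal ω).exists
    have : ∀ᵐ m ∂(σ ω), E.messagePayoff τ m = E.messagePayoff τ m₀ := by
      filter_upwards [h.sender_optimal ω] with m hm
      exact le_antisymm (hm₀.2 m hm.1) (hm.2 m₀ hm₀.1)
    have h1 : s ω = E.messagePayoff τ m₀ := by
      simp only [s]
      rw [integral_congr_ae this]; simp
    rw [h1]
    exact this
  have hbest : ∀ ω, ∀ m : Message, ω ∈ m → E.messagePayoff τ m ≤ s ω := by
    intro ω m hm
    obtain ⟨m₀, hm₀, hm₁⟩ := ((h.sender_optimal ω).and (hconst ω)).exists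
    exact hm₁ ▸ hm₀.2 m hm
  have hD : ∀ i, MeasurableSet {ω | s ω = E.v i} := fun i => hs (MeasurableSet.singleton _)
  -- For almost every state, its payoff is `v i` exactly when its messages have posterior means
  -- recommending `a_i`. Bayes' rule therefore carries integrals over the level set to integrals
  -- over these messages; `φ = 1` gives masses and `φ = x` gives means.
  have key : ∀ i, ∀ φ : unitInterval → ENNReal, Measurable φ →
      ∫⁻ ω in {ω | s ω = E.v i}, φ ω ∂E.prior =
        ∫⁻ m in (fun m => bary (p m)) ⁻¹' E.recommending i, ∫⁻ ω, φ ω ∂(p m) ∂(σ ∘ₘ E.prior) := by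
    intro i φ hφ
    have hS : MeasurableSet ((fun m => bary (p m)) ⁻¹' E.recommending i) :=
      hM (E.measurableSet_recommending i)
    have hg : Measurable fun q : Message × unitInterval =>
        ((fun m => bary (p m)) ⁻¹' E.recommending i).indicator (fun _ => φ q.2) q.1 := by
      have : (fun q : Message × unitInterval =>
          ((fun m => bary (p m)) ⁻¹' E.recommending i).indicator (fun _ => φ q.2) q.1) =
          (Prod.fst ⁻¹' ((fun m => bary (p m)) ⁻¹' E.recommending i)).indicator
            fun q => φ q.2 := rfl
      rw [this]
      exact (hφ.comp measurable_snd).indicator (measurable_fst hS)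
    have hsw := h.lintegral_swap hg
    have hL : ∀ᵐ ω ∂E.prior, ∫⁻ m, ((fun m => bary (p m)) ⁻¹' E.recommending i).indicator
        (fun _ => φ ω) m ∂(σ ω) = {ω | s ω = E.v i}.indicator φ ω := by
      filter_upwards [hae'] with ω hω
      have : ∀ᵐ m ∂(σ ω), ((fun m => bary (p m)) ⁻¹' E.recommending i).indicator
          (fun _ => φ ω) m = {ω | s ω = E.v i}.indicator φ ω := by
        filter_upwards [hω, hconst ω] with m h1 h2
        have : m ∈ (fun m => bary (p m)) ⁻¹' E.recommending i ↔ ω ∈ {ω | s ω = E.v i} := by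
          rw [Set.mem_preimage, E.mem_recommending]
          change _ ↔ s ω = E.v i
          rw [← h2, h1, E.v_strictMono.injective.eq_iff]
        by_cases hm : ω ∈ {ω | s ω = E.v i}
        · rw [Set.indicator_of_mem (this.2 hm), Set.indicator_of_mem hm]
        · rw [Set.indicator_of_notMem (fun h => hm (this.1 h)), Set.indicator_of_notMem hm]
      rw [lintegral_congr_ae this]; simp
    rw [lintegral_congr_ae hL, lintegral_indicator (hD i)] at hsw
    rw [hsw, ← lintegral_indicator hS]
    refine lintegral_congr fun m => ?_
    by_cases hm : m ∈ (fun m => bary (p m)) ⁻¹' E.recommending i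
    · simp only [Set.indicator_of_mem hm]
    · simp [Set.indicator_of_notMem hm]
  refine ⟨fun i => {ω | s ω = E.v i}, ⟨hD, fun i k hik => ?_, fun i => ?_, fun i => ?_⟩, fun i => ?_⟩
  · have : {ω | s ω = E.v i} ∩ {ω | s ω = E.v k} = ∅ :=
      Set.eq_empty_of_forall_notMem fun ω hω =>
        hik (E.v_strictMono.injective (hω.1.symm.trans hω.2))
    rw [this, measure_empty]
  · have := key i (fun _ => 1) measurable_const
    simp only [lintegral_const, measure_univ, mul_one, one_mul, Measure.restrict_apply_univ] at this
    rw [this, ← Measure.map_apply hM (E.measurableSet_recommending i), hmap]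
  · have := key i (fun x => ENNReal.ofReal (x : ℝ)) measurable_subtype_coe.ennreal_ofReal
    have h2 : ∀ m, ∫⁻ x, ENNReal.ofReal (x : ℝ) ∂(p m) = ENNReal.ofReal (bary (p m) : ℝ) := by
      intro m
      rw [coe_bary, ofReal_integral_eq_lintegral_ofReal integrable_coe (.of_forall fun x => x.2.1)]
    simp only [h2] at this
    rw [← setLIntegral_map (E.measurableSet_recommending i)
      (f := fun x : unitInterval => ENNReal.ofReal (x : ℝ))
      measurable_subtype_coe.ennreal_ofReal hM, hmap, ← ofReal_setIntegral_coe,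
      ← ofReal_setIntegral_coe] at this
    exact (ENNReal.ofReal_eq_ofReal_iff (integral_coe_nonneg _) (integral_coe_nonneg _)).1 this
  · filter_upwards [hae'] with ω hω hi
    obtain ⟨m, hm1, hm2⟩ := (hω.and (hconst ω)).exists
    refine Set.mem_iUnion.2 ⟨⟨E.top (bary (p m)), ?_⟩, hm2.symm.trans hm1⟩
    change i ≤ E.top (bary (p m))
    rw [← E.v_strictMono.le_iff_le, ← hm1, hm2]
    -- Deviate to full revelation, which yields at least `v (low ω)`. Even with ties broken against
    -- Sender the action is at least `a_i`, because `ω` strictly exceeds `γ i`.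
    refine le_trans (E.v_strictMono.monotone ?_) ((h.le_messagePayoff _).trans
      (hbest ω {ω} (by simp)))
    rw [h.bary_singleton]
    by_contra hlt
    rw [not_le] at hlt
    have h1 : ω ≤ E.cutoff (E.low ω).succ := E.low_le_iff.1 le_rfl
    have h2 : E.cutoff (E.low ω).succ ≤ E.γ i := E.cutoff_mono (by
      rw [Fin.le_def]; simpa using hlt)
    exact absurd (h1.trans h2) (not_le.2 hi)

end IsEquilibrium

end Environment

/-! ### The lowest state of a message -/

/-- The lowest state in which a message is feasible. -/
def minState (m : Message) : unitInterval := sInf (m : Set unitInterval)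

theorem minState_mem (m : Message) : minState m ∈ m :=
  m.isCompact.sInf_mem m.nonempty

theorem minState_le {m : Message} {x : unitInterval} (hx : x ∈ m) : minState m ≤ x :=
  sInf_le hx

theorem minState_singleton (x : unitInterval) : minState {x} = x := by
  simp [minState]

/-- The distance from 0 to a closed set is Lipschitz in the Hausdorff metric; hence the lowest state
depends measurably on the message. -/
theorem coe_minState (m : Message) :
    (minState m : ℝ) = Metric.infDist 0 (m : Set unitInterval) := by
  have hd : ∀ x : unitInterval, dist 0 x = x := fun x => by
    rw [Subtype.dist_eq, Real.dist_eq, Set.Icc.coe_zero, zero_sub, abs_neg,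
      abs_of_nonneg x.2.1]
  refine le_antisymm ?_ ?_
  · refine (Metric.le_infDist m.nonempty).2 fun x hx => ?_
    rw [hd]
    exact minState_le hx
  · calc Metric.infDist 0 (m : Set unitInterval) ≤ dist 0 (minState m) :=
          Metric.infDist_le_dist_of_mem (minState_mem m)
      _ = _ := hd _

theorem measurable_minState : Measurable minState := by
  refine (MeasurableEmbedding.subtype_coe
    (measurableSet_Icc (a := (0 : ℝ)) (b := 1))).measurable_comp_iff.1 ?_
  have : (Subtype.val ∘ minState) = fun m : Message => Metric.infDist 0 (m : Set unitInterval) :=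
    funext coe_minState
  rw [this]
  exact (Metric.lipschitz_infDist_set (0 : unitInterval)).continuous.measurable

theorem measurable_singleton_message : Measurable fun x : unitInterval => ({x} : Message) :=
  (TopologicalSpace.NonemptyCompacts.isometry_singleton).continuous.measurable

theorem bary_dirac (x : unitInterval) : bary (Measure.dirac x) = x :=
  Subtype.ext (by rw [coe_bary, integral_dirac])

/-! ### Selecting one of countably many sets -/

section Selection

variable {Ω ι α : Type*} [LinearOrder α] (r : ι → α) (C : ι → Set Ω)

/-- The points at which `i` has the lowest rank among the indices available there. -/
def firstIn (i : ι) : Set Ω := C i \ ⋃ k, ⋃ _ : r k < r i, C k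

variable {r C}

theorem firstIn_subset (i : ι) : firstIn r C i ⊆ C i := Set.sdiff_subset

theorem le_of_mem_firstIn {i k : ι} {x : Ω} (hx : x ∈ firstIn r C i) (hk : x ∈ C k) :
    r i ≤ r k := by
  by_contra h
  exact hx.2 (Set.mem_iUnion₂.2 ⟨k, not_le.1 h, hk⟩)

theorem eq_of_mem_firstIn (hr : Function.Injective r) {i k : ι} {x : Ω}
    (hx : x ∈ firstIn r C i) (hk : x ∈ firstIn r C k) : i = k :=
  hr (le_antisymm (le_of_mem_firstIn hx (firstIn_subset _ hk))
    (le_of_mem_firstIn hk (firstIn_subset _ hx)))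

theorem iUnion_firstIn [WellFoundedLT α] : ⋃ i, firstIn r C i = ⋃ i, C i := by
  refine Set.Subset.antisymm (Set.iUnion_mono firstIn_subset) fun x hx => ?_
  obtain ⟨i, hi⟩ := Set.mem_iUnion.1 hx
  obtain ⟨k, hk, hmin⟩ := (InvImage.wf r wellFounded_lt).has_min {k | x ∈ C k} ⟨i, hi⟩
  refine Set.mem_iUnion.2 ⟨k, hk, fun h => ?_⟩
  obtain ⟨l, hl, hxl⟩ := Set.mem_iUnion₂.1 h
  exact hmin l hxl hl

theorem measurableSet_firstIn [MeasurableSpace Ω] [Countable ι] (hC : ∀ i, MeasurableSet (C i))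
    (i : ι) : MeasurableSet (firstIn r C i) :=
  (hC i).diff (MeasurableSet.iUnion fun k => MeasurableSet.iUnion fun _ => hC k)

theorem firstIn_ae_eq [MeasurableSpace Ω] [Countable ι] {μ : Measure Ω}
    (hnull : ∀ i k, i ≠ k → μ (C i ∩ C k) = 0) (i : ι) : firstIn r C i =ᵐ[μ] C i := by
  refine (firstIn_subset i).eventuallyLE.antisymm (ae_le_set.2 ?_)
  refine measure_mono_null (t := ⋃ k, ⋃ _ : r k < r i, C i ∩ C k) ?_
    (measure_iUnion_null fun k => measure_iUnion_null fun hk =>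
      hnull i k fun h => hk.ne (congrArg r h.symm))
  rintro x ⟨hx, hx'⟩
  by_contra h
  refine hx' ⟨hx, fun h' => h ?_⟩
  obtain ⟨k, hk, hxk⟩ := Set.mem_iUnion₂.1 h'
  exact Set.mem_iUnion₂.2 ⟨k, hk, hx, hxk⟩

end Selection

/-! ### Equilibria from disclosure schemes -/

namespace Environment

variable {n : ℕ} [NeZero n] {E : Environment n} {G : Measure unitInterval}

/-- Countably many messages, pooling the states in which Sender obtains the signals `z i`, such
that Sender reveals the other states and no state gains from being revealed. -/
structure IsDisclosureScheme (E : Environment n) (G : Measure unitInterval) {ι : Type*}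
    (C : ι → Message) (z : ι → unitInterval) : Prop where
  null : ∀ i k, i ≠ k → E.prior (C i ∩ C k : Set unitInterval) = 0
  mass : ∀ i, E.prior (C i : Set unitInterval) = G {z i}
  mass_ne_zero : ∀ i, G {z i} ≠ 0
  mean : ∀ i, E.condMean (C i) = z i
  low_le : ∀ i, ∀ x ∈ C i, E.low x ≤ E.top (z i)
  eq_sum : G = Measure.sum (fun i => G {z i} • Measure.dirac (z i)) +
    E.prior.restrict (⋃ i, (C i : Set unitInterval))ᶜ

namespace IsDisclosureScheme

variable {ι : Type*} {C : ι → Message} {z : ι → unitInterval}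

/-- Messages of the scheme have positive prior mass and the prior has no atoms, so revealing a state
is never confused with pooling. -/
theorem singleton_notMem_range (h : E.IsDisclosureScheme G C z) (x : unitInterval) :
    ({x} : Message) ∉ Set.range C := by
  rintro ⟨i, hi⟩
  apply h.mass_ne_zero i
  rw [← h.mass, hi]
  simp

open Classical in
/-- Receiver's beliefs: Bayes' rule after the messages of the scheme, and the least favourable
state after any other message. -/
def belief [Countable ι] (E : Environment n) (C : ι → Message) : Kernel Message unitInterval where
  toFun m := if m ∈ Set.range C then E.prior[|(m : Set unitInterval)]
    else Measure.dirac (minState m)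
  measurable' := by
    -- The beliefs differ from the point mass at the lowest state only on the countable range of
    -- `C`.
    refine (Measure.measurable_dirac.comp measurable_minState).measurable_of_countable_ne
      ((Set.countable_range C).mono fun m hm => ?_)
    by_contra h
    exact hm (if_neg h).symm

theorem belief_of_mem [Countable ι] {m : Message} (hm : m ∈ Set.range C) :
    belief E C m = E.prior[|(m : Set unitInterval)] := if_pos hm

theorem belief_of_notMem [Countable ι] {m : Message} (hm : m ∉ Set.range C) :
    belief E C m = Measure.dirac (minState m) := if_neg hm

theorem isMarkovKernel_belief [Countable ι] (h : E.IsDisclosureScheme G C z) :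
    IsMarkovKernel (belief E C) := by
  refine ⟨fun m => ?_⟩
  by_cases hm : m ∈ Set.range C
  · rw [belief_of_mem hm]
    obtain ⟨i, rfl⟩ := hm
    exact cond_isProbabilityMeasure (by rw [h.mass]; exact h.mass_ne_zero i)
  · rw [belief_of_notMem hm]
    infer_instance

theorem bary_belief [Countable ι] (h : E.IsDisclosureScheme G C z) (i : ι) :
    bary (belief E C (C i)) = z i := by
  have := h.isMarkovKernel_belief
  refine Subtype.ext ?_
  rw [coe_bary, belief_of_mem ⟨i, rfl⟩, ← h.mean, condMean, ProbabilityTheory.cond, average_eq, integral_smul_measure,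
    measureReal_def, Measure.restrict_apply_univ, ENNReal.toReal_inv]

open Classical in
/-- Receiver's action. -/
def action [Countable ι] (E : Environment n) (C : ι → Message) (m : Message) : Fin n :=
  -- Ties favour Sender after messages of the scheme, as the commitment payoff requires, and go
  -- against her after all others, as deterrence requires.
  if m ∈ Set.range C then E.top (bary (belief E C m)) else E.low (bary (belief E C m))

theorem measurable_action [Countable ι] (h : E.IsDisclosureScheme G C z) :
    Measurable (action E C) := by
  have := h.isMarkovKernel_belief
  refine (E.measurable_low.comp (measurable_bary (belief E C))).measurable_of_countable_ne
    ((Set.countable_range C).mono fun m hm => ?_)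
  by_contra h
  exact hm (if_neg h).symm

theorem action_apply [Countable ι] (h : E.IsDisclosureScheme G C z) (i : ι) :
    action E C (C i) = E.top (z i) := by
  rw [action, if_pos ⟨i, rfl⟩, h.bary_belief]

theorem action_of_notMem [Countable ι] {m : Message} (hm : m ∉ Set.range C) :
    action E C m = E.low (minState m) := by
  rw [action, if_neg hm, belief_of_notMem hm, bary_dirac]

theorem bary_mem_A [Countable ι] (m : Message) :
    bary (belief E C m) ∈ E.A (action E C m) := by
  unfold action
  split_ifs
  · exact E.top_mem_A _
  · exact E.low_mem_A _

/-- The order in which Sender prefers the messages of the scheme: by Receiver's action, with some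
tie-breaking. -/
def rank (E : Environment n) [Encodable ι] (z : ι → unitInterval) (i : ι) : (Fin n)ᵒᵈ ×ₗ ℕ :=
  toLex (OrderDual.toDual (E.top (z i)), Encodable.encode i)

theorem rank_injective [Encodable ι] : Function.Injective (rank E z) := by
  intro i k h
  exact Encodable.encode_injective (congrArg (fun q => (ofLex q).2) h)

theorem top_le_of_rank_le [Encodable ι] {i k : ι} (h : rank E z i ≤ rank E z k) :
    E.top (z k) ≤ E.top (z i) := by
  rcases Prod.Lex.le_iff.1 h with h | h
  · exact le_of_lt h
  · exact (congrArg OrderDual.ofDual h.1).ge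

open Classical in
/-- Sender's message. -/
def message [Encodable ι] (E : Environment n) (C : ι → Message) (z : ι → unitInterval)
    (x : unitInterval) : Message :=
  if h : ∃ i, x ∈ firstIn (rank E z) (fun i => (C i : Set unitInterval)) i then C h.choose else {x}

theorem message_of_mem [Encodable ι] {i : ι} {x : unitInterval}
    (hx : x ∈ firstIn (rank E z) (fun i => (C i : Set unitInterval)) i) :
    message E C z x = C i := by
  have h : ∃ i, x ∈ firstIn (rank E z) (fun i => (C i : Set unitInterval)) i := ⟨i, hx⟩
  rw [message, dif_pos h, eq_of_mem_firstIn rank_injective h.choose_spec hx]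

theorem message_of_notMem [Encodable ι] {x : unitInterval}
    (hx : x ∉ ⋃ i, (C i : Set unitInterval)) : message E C z x = {x} := by
  refine dif_neg fun h => hx ?_
  obtain ⟨i, hi⟩ := h
  exact Set.mem_iUnion.2 ⟨i, firstIn_subset i hi⟩

theorem mem_or_notMem [Encodable ι] (E : Environment n) (C : ι → Message) (z : ι → unitInterval)
    (x : unitInterval) :
    (∃ i, x ∈ firstIn (rank E z) (fun i => (C i : Set unitInterval)) i) ∨
      x ∉ ⋃ i, (C i : Set unitInterval) := by
  rw [← iUnion_firstIn (r := rank E z), Set.mem_iUnion]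
  exact em _

theorem measurableSet_part [Encodable ι] (i : ι) :
    MeasurableSet (firstIn (rank E z) (fun i => (C i : Set unitInterval)) i) :=
  measurableSet_firstIn (fun i => (C i).isCompact.measurableSet) i

theorem measurableSet_rest [Countable ι] (C : ι → Message) :
    MeasurableSet (⋃ i, (C i : Set unitInterval))ᶜ :=
  (MeasurableSet.iUnion fun i => (C i).isCompact.measurableSet).compl

theorem measurable_message [Encodable ι] : Measurable (message E C z) := by
  intro T hT
  have : message E C z ⁻¹' T =
      (⋃ i, ⋃ _ : C i ∈ T, firstIn (rank E z) (fun i => (C i : Set unitInterval)) i) ∪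
        ((⋃ i, (C i : Set unitInterval))ᶜ ∩ (fun x : unitInterval => ({x} : Message)) ⁻¹' T) := by
    ext x
    simp only [Set.mem_preimage, Set.mem_union, Set.mem_iUnion₂, Set.mem_inter_iff,
      Set.mem_compl_iff]
    rcases mem_or_notMem E C z x with ⟨i, hi⟩ | hx
    · rw [message_of_mem hi]
      constructor
      · exact fun h => .inl ⟨i, h, hi⟩
      · rintro (⟨k, hk, hxk⟩ | ⟨h, -⟩)
        · rwa [eq_of_mem_firstIn rank_injective hi hxk]
        · exact absurd (Set.mem_iUnion.2 ⟨i, firstIn_subset i hi⟩) h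
    · rw [message_of_notMem hx]
      constructor
      · exact fun h => .inr ⟨hx, h⟩
      · rintro (⟨k, -, hxk⟩ | ⟨-, h⟩)
        · exact absurd (Set.mem_iUnion.2 ⟨k, firstIn_subset k hxk⟩) hx
        · exact h
  rw [this]
  exact (MeasurableSet.iUnion fun i => MeasurableSet.iUnion fun _ => measurableSet_part i).union
    ((measurableSet_rest C).inter (measurable_singleton_message hT))

theorem mem_message [Encodable ι] (x : unitInterval) : x ∈ message E C z x := by
  rcases mem_or_notMem E C z x with ⟨i, hi⟩ | hx
  · rw [message_of_mem hi]
    exact firstIn_subset i hi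
  · rw [message_of_notMem hx]
    simp

/-- Among the scheme's messages feasible at `x`, the rank selects one with the highest action. Any
other message is attributed to its lowest state, which is at most `x`, so it yields at most `low x`;
this much is obtained by pooling, through `low_le`, and by revelation. -/
theorem action_le [Encodable ι] (h : E.IsDisclosureScheme G C z) {x : unitInterval} {m : Message}
    (hm : x ∈ m) : action E C m ≤ action E C (message E C z x) := by
  by_cases hmC : m ∈ Set.range C
  · obtain ⟨k, rfl⟩ := hmC
    rcases mem_or_notMem E C z x with ⟨i, hi⟩ | hx
    · rw [message_of_mem hi, h.action_apply, h.action_apply]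
      exact top_le_of_rank_le (le_of_mem_firstIn hi hm)
    · exact absurd (Set.mem_iUnion.2 ⟨k, hm⟩) hx
  · rw [action_of_notMem hmC]
    refine (E.low_mono (minState_le hm)).trans ?_
    rcases mem_or_notMem E C z x with ⟨i, hi⟩ | hx
    · rw [message_of_mem hi, h.action_apply]
      exact h.low_le i x (firstIn_subset i hi)
    · rw [message_of_notMem hx, action_of_notMem (h.singleton_notMem_range x), minState_singleton]

/-- Integration over the states, message by message. -/
theorem lintegral_eq [Encodable ι] (E : Environment n) (C : ι → Message) (z : ι → unitInterval)
    (f : unitInterval → ENNReal) :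
    ∫⁻ x, f x ∂E.prior = ∑' i, ∫⁻ x in firstIn (rank E z) (fun i => (C i : Set unitInterval)) i,
      f x ∂E.prior + ∫⁻ x in (⋃ i, (C i : Set unitInterval))ᶜ, f x ∂E.prior := by
  rw [← lintegral_iUnion (fun i => measurableSet_part i), iUnion_firstIn,
    lintegral_add_compl f (MeasurableSet.iUnion fun i => (C i).isCompact.measurableSet)]
  intro i k hik
  exact Set.disjoint_left.2 fun x hi hk => hik (eq_of_mem_firstIn rank_injective hi hk)

theorem restrict_part [Encodable ι] (h : E.IsDisclosureScheme G C z) (i : ι) :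
    E.prior.restrict (firstIn (rank E z) (fun i => (C i : Set unitInterval)) i) =
      E.prior.restrict (C i) :=
  Measure.restrict_congr_set (firstIn_ae_eq h.null i)

theorem lintegral_congr [Encodable ι] {f g : unitInterval → ENNReal}
    (hpart : ∀ i, ∫⁻ x in firstIn (rank E z) (fun i => (C i : Set unitInterval)) i, f x ∂E.prior =
      ∫⁻ x in firstIn (rank E z) (fun i => (C i : Set unitInterval)) i, g x ∂E.prior)
    (hrest : ∀ x ∉ ⋃ i, (C i : Set unitInterval), f x = g x) :
    ∫⁻ x, f x ∂E.prior = ∫⁻ x, g x ∂E.prior := by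
  rw [lintegral_eq E C z f, lintegral_eq E C z g]
  congr 1
  · exact tsum_congr hpart
  · exact setLIntegral_congr_fun (measurableSet_rest C) hrest

/-- Checked message by message. The states that send `C i` form `C i` up to a null set, so the
posterior is the prior conditioned on `C i`; after revelation it is the point mass at the state. -/
theorem bayes [Encodable ι] (h : E.IsDisclosureScheme G C z) :
    (E.prior ⊗ₘ Kernel.deterministic (message E C z) measurable_message).map Prod.swap =
      (Kernel.deterministic (message E C z) measurable_message ∘ₘ E.prior) ⊗ₘ belief E C := by
  have := h.isMarkovKernel_belief
  ext T hT
  rw [Measure.map_apply measurable_swap hT, Measure.compProd_apply (measurable_swap hT),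
    Measure.compProd_apply hT, Measure.deterministic_comp_eq_map,
    lintegral_map (Kernel.measurable_kernel_prodMk_left hT) measurable_message]
  refine lintegral_congr (C := C) (z := z) (fun i => ?_) fun x hx => ?_
  · have hA : MeasurableSet {x | (C i, x) ∈ T} := measurable_prodMk_left hT
    have h1 : ∀ x ∈ firstIn (rank E z) (fun i => (C i : Set unitInterval)) i,
        Kernel.deterministic (message E C z) measurable_message x
          (Prod.mk x ⁻¹' (Prod.swap ⁻¹' T)) = {x | (C i, x) ∈ T}.indicator 1 x := by
      intro x hx
      rw [Kernel.deterministic_apply,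
        Measure.dirac_apply' _ (measurable_prodMk_left (measurable_swap hT)), message_of_mem hx]
      rfl
    have h2 : ∀ x ∈ firstIn (rank E z) (fun i => (C i : Set unitInterval)) i,
        belief E C (message E C z x) (Prod.mk (message E C z x) ⁻¹' T) =
          belief E C (C i) {x | (C i, x) ∈ T} := by
      intro x hx
      rw [message_of_mem hx]
      rfl
    rw [setLIntegral_congr_fun (measurableSet_part i) h1,
      setLIntegral_congr_fun (measurableSet_part i) h2, h.restrict_part, lintegral_indicator_one hA,
      setLIntegral_const, belief_of_mem ⟨i, rfl⟩,
      cond_apply (C i).isCompact.measurableSet, Measure.restrict_apply hA, mul_comm, ← mul_assoc,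
      ENNReal.mul_inv_cancel (by rw [h.mass]; exact h.mass_ne_zero i) (measure_ne_top _ _),
      one_mul, Set.inter_comm]
  · rw [Kernel.deterministic_apply,
      Measure.dirac_apply' _ (measurable_prodMk_left (measurable_swap hT)), message_of_notMem hx,
      belief_of_notMem (h.singleton_notMem_range x), minState_singleton,
      Measure.dirac_apply' _ (measurable_prodMk_left hT)]
    rfl

/-- Pooled states produce the atoms `z i` and revealed states produce themselves, which is the
decomposition `eq_sum` of `G`. -/
theorem law [Encodable ι] (h : E.IsDisclosureScheme G C z) :
    E.prior.map (fun x => bary (belief E C (message E C z x))) = G := by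
  have := h.isMarkovKernel_belief
  have hmeas : Measurable fun x => bary (belief E C (message E C z x)) :=
    (measurable_bary (belief E C)).comp measurable_message
  ext T hT
  have h1 : ∀ i, ∫⁻ x in firstIn (rank E z) (fun i => (C i : Set unitInterval)) i,
      ((fun x => bary (belief E C (message E C z x))) ⁻¹' T).indicator 1 x ∂E.prior =
        G {z i} * T.indicator 1 (z i) := by
    intro i
    have : ∀ x ∈ firstIn (rank E z) (fun i => (C i : Set unitInterval)) i,
        ((fun x => bary (belief E C (message E C z x))) ⁻¹' T).indicator (1 : unitInterval → ENNReal) x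
          = T.indicator 1 (z i) := by
      intro x hx
      have : (fun x => bary (belief E C (message E C z x))) x = z i := by
        simp only [message_of_mem hx, h.bary_belief]
      rw [← this]
      rfl
    rw [setLIntegral_congr_fun (measurableSet_part i) this, setLIntegral_const,
      ← Measure.restrict_apply_univ, h.restrict_part, Measure.restrict_apply_univ, h.mass, mul_comm]
  have h2 : ∀ x ∈ (⋃ i, (C i : Set unitInterval))ᶜ,
      ((fun x => bary (belief E C (message E C z x))) ⁻¹' T).indicator (1 : unitInterval → ENNReal) x
        = T.indicator 1 x := by
    intro x hx
    have : (fun x => bary (belief E C (message E C z x))) x = x := by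
      simp only [message_of_notMem hx, belief_of_notMem (h.singleton_notMem_range x),
        minState_singleton, bary_dirac]
    conv_rhs => rw [← this]
    rfl
  rw [Measure.map_apply hmeas hT, ← lintegral_indicator_one (hmeas hT), lintegral_eq E C z,
    tsum_congr h1, setLIntegral_congr_fun (measurableSet_rest C) h2, lintegral_indicator_one hT]
  conv_rhs => rw [h.eq_sum]
  rw [Measure.add_apply, Measure.sum_apply _ hT]
  congr 1
  refine tsum_congr fun i => ?_
  rw [Measure.smul_apply, smul_eq_mul, Measure.dirac_apply' _ hT]

theorem isImplementable [Countable ι] (h : E.IsDisclosureScheme G C z) [IsProbabilityMeasure G]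
    (hG : E.IsOptimalSignal G) : E.IsImplementable G := by
  have := Encodable.ofCountable ι
  have := h.isMarkovKernel_belief
  have hpay : ∀ m, E.messagePayoff (Kernel.deterministic (action E C) h.measurable_action) m =
      E.v (action E C m) := fun m => by
    rw [messagePayoff_eq, Kernel.deterministic_apply, integral_dirac]
  have hM := measurable_bary (belief E C)
  have hMs : Measurable fun x => bary (belief E C (message E C z x)) := hM.comp measurable_message
  refine ⟨_, ⟨hG, rfl⟩, Kernel.deterministic (message E C z) measurable_message,
    Kernel.deterministic (action E C) h.measurable_action, belief E C,
    ⟨inferInstance, inferInstance, inferInstance, fun x => ?_, fun m i hi => ?_, fun m => ?_,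
      h.bayes⟩, ?_, ?_⟩
  · rw [Kernel.deterministic_apply, ae_dirac_eq]
    refine ⟨mem_message x, fun m hm => ?_⟩
    rw [hpay, hpay]
    exact E.v_strictMono.monotone (h.action_le hm)
  · rw [← coe_bary]
    have : i = action E C m := by
      by_contra hne
      rw [Kernel.deterministic_apply, Measure.dirac_apply' _ (MeasurableSet.singleton i),
        Set.indicator_of_notMem (fun h' => hne (Set.mem_singleton_iff.1 h').symm)] at hi
      exact lt_irrefl _ hi
    rw [this]
    exact bary_mem_A m
  · refine Measure.support_subset_of_isClosed m.isCompact.isClosed ?_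
    by_cases hm : m ∈ Set.range C
    · rw [belief_of_mem hm]
      exact ae_cond_mem m.isCompact.measurableSet
    · rw [belief_of_notMem hm, ae_dirac_eq]
      exact minState_mem m
  · rw [Measure.deterministic_comp_eq_map, Measure.map_map _ measurable_message]
    · conv_rhs => rw [← h.law]
      rw [Measure.map_map measurable_subtype_coe hMs]
      congr 1
      exact funext fun x => (coe_bary _).symm
    · have : (fun m => ∫ x, (x : ℝ) ∂(belief E C m)) = Subtype.val ∘ fun m => bary (belief E C m) :=
        funext fun m => (coe_bary _).symm
      rw [this]
      exact measurable_subtype_coe.comp hM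
  · simp only [hpay]
    rw [Measure.deterministic_comp_eq_map, integral_map (f := fun m => E.v (action E C m))
      measurable_message.aemeasurable ((measurable_of_countable E.v).comp h.measurable_action).aestronglyMeasurable]
    -- At revealed states Receiver takes the lowest optimal action, which falls short of the value
    -- function only at the finitely many cutoffs.
    have hae : ∀ᵐ x ∂E.prior, E.v (action E C (message E C z x)) =
        E.u (bary (belief E C (message E C z x))) := by
      filter_upwards [measure_eq_zero_iff_ae_notMem.1
        ((Set.finite_range E.cutoff).measure_zero E.prior)] with x hx
      rw [E.u_eq]
      rcases mem_or_notMem E C z x with ⟨i, hi⟩ | hx'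
      · rw [message_of_mem hi, h.action_apply, h.bary_belief]
      · rw [message_of_notMem hx', action_of_notMem (h.singleton_notMem_range x),
          belief_of_notMem (h.singleton_notMem_range x), minState_singleton, bary_dirac,
          E.low_eq_top hx]
    rw [integral_congr_ae hae]
    conv_rhs => rw [← h.law]
    rw [integral_map hMs.aemeasurable
      E.measurable_u.aestronglyMeasurable]

end IsDisclosureScheme


/-! ### Canonical representations yield disclosure schemes -/

variable {n : ℕ} [NeZero n] {E : Environment n} {G : Measure unitInterval}
  {J : Set (unitInterval × unitInterval)} {c d : unitInterval × unitInterval → unitInterval}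
  {B : Fin n → Set unitInterval} {j : Fin n}

theorem exists_mem_component (hJ : E.IsBiPoolingFamily G J) (hcd : E.IsSplitting G J c d)
    {I : unitInterval × unitInterval} (hI : I ∈ J) {x : unitInterval}
    (hx : x ∈ Set.Icc I.1 I.2) : ∃ z ∈ supp G I.1 I.2, x ∈ component G c d I z := by
  rcases (hJ.block I hI).supp_eq with ⟨z, hs⟩ | ⟨zL, zH, hz, hs⟩
  · exact ⟨z, hs ▸ rfl, (component_single hs).symm ▸ hx⟩
  · rw [← (hcd I hI zL zH hz hs).union] at hx
    rcases hx with hx | hx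
    · exact ⟨zL, hs ▸ Set.mem_insert _ _, (component_low hz hs).symm ▸ hx⟩
    · exact ⟨zH, hs ▸ Set.mem_insert_of_mem _ rfl, (component_high hz hs).symm ▸ hx⟩

/-- The signals that are sent with positive probability. -/
def signals (G : Measure unitInterval) : Set unitInterval := {z | G {z} ≠ 0}

theorem IsBiPoolingFamily.countable_signals (hJ : E.IsBiPoolingFamily G J) :
    (signals G).Countable := by
  refine (hJ.countable.biUnion fun I hI => (hJ.block I hI).finite.countable).mono fun z hz => ?_
  obtain ⟨I, hI, hzI⟩ := hJ.mem_supp_of_singleton hz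
  exact Set.mem_biUnion hI hzI

/-- Inside each of the countably many blocks `G` lives on atoms, and off the blocks it has none. -/
theorem IsBiPoolingFamily.compl_signals_ae_eq (hJ : E.IsBiPoolingFamily G J) :
    ((signals G)ᶜ : Set unitInterval) =ᵐ[G] offSet J := by
  have hae : ∀ᵐ x ∂G, ∀ I ∈ J, x ∈ Set.Ioo I.1 I.2 → x ∈ supp G I.1 I.2 :=
    (ae_ball_iff hJ.countable).2 fun I _ => ae_mem_supp G I.1 I.2
  refine Filter.eventuallyEq_set.2 (hae.mono fun x hx => ⟨fun h => ?_, fun h h' => ?_⟩)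
  · exact mem_offSet.2 fun I hI hxI => h ((hJ.block I hI).singleton_ne_zero (hx I hI hxI))
  · exact h' (hJ.singleton_eq_zero h)

/-- The block in which a signal lies. -/
def blockOf (hJ : E.IsBiPoolingFamily G J) (z : signals G) : unitInterval × unitInterval :=
  (hJ.mem_supp_of_singleton z.2).choose

theorem blockOf_mem (hJ : E.IsBiPoolingFamily G J) (z : signals G) : blockOf hJ z ∈ J :=
  (hJ.mem_supp_of_singleton z.2).choose_spec.1

theorem mem_supp_blockOf (hJ : E.IsBiPoolingFamily G J) (z : signals G) :
    (z : unitInterval) ∈ supp G (blockOf hJ z).1 (blockOf hJ z).2 :=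
  (hJ.mem_supp_of_singleton z.2).choose_spec.2

/-- The message that pools the states in which Sender obtains the signal `z`. -/
def pooledMessage (hJ : E.IsBiPoolingFamily G J) (hcd : E.IsSplitting G J c d) (z : signals G) :
    Message where
  carrier := component G c d (blockOf hJ z) z
  isCompact' := isClosed_component.isCompact
  nonempty' := nonempty_of_measure_ne_zero (μ := E.prior) (by
    rw [prior_component hJ hcd (blockOf_mem hJ z) (mem_supp_blockOf hJ z)]
    exact z.2)

theorem coe_pooledMessage (hJ : E.IsBiPoolingFamily G J) (hcd : E.IsSplitting G J c d)
    (z : signals G) :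
    (pooledMessage hJ hcd z : Set unitInterval) = component G c d (blockOf hJ z) z := rfl

/-- The components of a block cover it and stay inside its closed interval, so the discrepancy is
confined to the countably many end points. -/
theorem compl_pooled_ae_eq (hJ : E.IsBiPoolingFamily G J) (hcd : E.IsSplitting G J c d) :
    ((⋃ z, (pooledMessage hJ hcd z : Set unitInterval))ᶜ : Set unitInterval) =ᵐ[E.prior] offSet J := by
  have hcount : (⋃ I ∈ J, ({I.1, I.2} : Set unitInterval)).Countable :=
    hJ.countable.biUnion fun I _ => (Set.toFinite _).countable
  refine Filter.eventuallyEq_set.2 ?_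
  filter_upwards [measure_eq_zero_iff_ae_notMem.1 (hcount.measure_zero E.prior)] with x hx
  rw [Set.mem_compl_iff, Set.mem_iUnion, mem_offSet]
  constructor
  · intro h I hI hxI
    obtain ⟨z, hz, hxz⟩ := exists_mem_component hJ hcd hI (Set.Ioo_subset_Icc_self hxI)
    have hz0 := (hJ.block I hI).singleton_ne_zero hz
    refine h ⟨⟨z, hz0⟩, ?_⟩
    have : blockOf hJ ⟨z, hz0⟩ = I := hJ.eq_of_mem (blockOf_mem hJ _) hI
      ((hJ.block _ (blockOf_mem hJ _)).supp_subset (mem_supp_blockOf hJ ⟨z, hz0⟩))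
      ((hJ.block I hI).supp_subset hz)
    rw [coe_pooledMessage, this]
    exact hxz
  · rintro h ⟨z, hz⟩
    have hmem := component_subset hJ hcd (blockOf_mem hJ z) (mem_supp_blockOf hJ z) hz
    have hne : x ≠ (blockOf hJ z).1 ∧ x ≠ (blockOf hJ z).2 := by
      constructor <;> rintro rfl <;>
        exact hx (Set.mem_iUnion₂.2 ⟨_, blockOf_mem hJ z, by simp⟩)
    exact h _ (blockOf_mem hJ z) ⟨lt_of_le_of_ne hmem.1 hne.1.symm, lt_of_le_of_ne hmem.2 hne.2⟩

namespace IsCanonicalData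

/-- The messages are the components, one for each atom of `G`, rather than the sets `B i`: this
reproduces `G` itself and not merely the action probabilities. The two conditions enter only in
`low_le`. -/
theorem isDisclosureScheme (h : E.IsCanonicalData G B J c d j) [IsProbabilityMeasure G]
    (hG : E.IsOptimalSignal G) (hskip : E.SkipCondition B) (hnest : E.NestedCondition G B) :
    E.IsDisclosureScheme G (pooledMessage h.family h.splitting) (fun z => (z : unitInterval)) where
  null z z' hne := prior_component_inter h.family h.splitting (blockOf_mem _ z) (blockOf_mem _ z')
    (mem_supp_blockOf _ z) (mem_supp_blockOf _ z') fun h => hne (Subtype.ext h)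
  mass z := prior_component h.family h.splitting (blockOf_mem _ z) (mem_supp_blockOf _ z)
  mass_ne_zero z := z.2
  mean z := condMean_component h.family h.splitting (blockOf_mem _ z) (mem_supp_blockOf _ z)
  low_le z x hx := E.low_le_iff.2 (h.le_cutoff_succ hG hskip hnest (h.not_isSkipped_top z.2)
    (h.component_subset_rep (blockOf_mem _ z) (mem_supp_blockOf _ z) hx))
  eq_sum := by
    have hc : Countable (signals G) := h.family.countable_signals
    have h1 : G.restrict (signals G) =
        Measure.sum fun z : signals G => G {(z : unitInterval)} • Measure.dirac (z : unitInterval) := by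
      have : signals G = ⋃ z : signals G, {(z : unitInterval)} := by simp
      conv_lhs => rw [this]
      rw [Measure.restrict_iUnion _ fun z => measurableSet_singleton _]
      · simp only [Measure.restrict_singleton]
      · intro z z' hne
        exact Set.disjoint_singleton.2 fun h => hne (Subtype.ext h)
    rw [Measure.restrict_congr_set (compl_pooled_ae_eq h.family h.splitting), ← h1]
    have h2 : E.prior.restrict (offSet J) = G.restrict (signals G)ᶜ := by
      rw [Measure.restrict_congr_set h.family.compl_signals_ae_eq]
      exact h.family.off.symm
    rw [h2, Measure.restrict_add_restrict_compl h.family.countable_signals.measurableSet]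

theorem isImplementable_iff (h : E.IsCanonicalData G B J c d j) [IsProbabilityMeasure G]
    (hG : E.IsOptimalSignal G) :
    E.IsImplementable G ↔ E.SkipCondition B ∧ E.NestedCondition G B := by
  constructor
  · rintro ⟨R, ⟨-, rfl⟩, σ, τ, p, heq, hlaw, hpay⟩
    obtain ⟨D, hD, hreveal⟩ := heq.exists_assignment hlaw hpay
    exact h.conditions_of_assignment hG hD hreveal
  · rintro ⟨hskip, hnest⟩
    have : Countable (signals G) := h.family.countable_signals
    exact (h.isDisclosureScheme hG hskip hnest).isImplementable hG

end IsCanonicalData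

end Environment

end Disclosure

end

theorem proposition2 (n : ℕ) [NeZero n] (E : Disclosure.Environment n)
    (G : MeasureTheory.Measure unitInterval) (hG : E.IsBiPoolingSolution G) :
    (∃ B : Fin n → Set unitInterval, E.IsCanonicalRep G B) ∧
      ∀ B : Fin n → Set unitInterval, E.IsCanonicalRep G B →
        (E.IsImplementable G ↔ E.SkipCondition B ∧ E.NestedCondition G B) := by
  obtain ⟨⟨hmpc, J, hJ⟩, hopt⟩ := hG
  obtain ⟨hprob, hle⟩ := (E.isMPC_iff G).1 hmpc
  refine ⟨Disclosure.Environment.exists_isCanonicalRep hopt hJ, fun B hB => ?_⟩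
  obtain ⟨J', c, d, j, h⟩ := hB.exists_data hle
  exact h.isImplementable_iff hopt
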